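/- Let $p$ be a prime, let $k$ be a perfect field of characteristic $p$, and let $C$ be a connected smooth curve over $k$ (separated, of finite type). Let $E$ be an $F$-isocrystal on $C$, and let $\mathbb{E}_1,\mathbb{E}_2\subset E$ be two $F$-crystals inside $E$, that is, $F$-crystals (in vector bundles) on $C$ with Frobenius-compatible identifications $\mathbb{E}_i[1/p]=E$. Suppose that $\mathbb{E}_1$ and $\mathbb{E}_2$ are ordinary: for each $i$, the Hodge polygon of $\mathbb{E}_{i,\bar x}$ and the Newton polygon of $E_{\bar x}$ coincide at every geometric point $\bar x$ of $C$, and they do not depend on $\bar x$ (so that all slopes are integers). Suppose moreover that $\mathbb{E}_1$ and $\mathbb{E}_2$ agree at a point, i.e. there are a perfect field $K$ of characteristic $p$ and a point $x:\operatorname{Spec}K\to C$ such that $\mathbb{E}_{1,x}=\mathbb{E}_{2,x}$ as $W(K)$-lattices in the fibre $E_x$. Then $\mathbb{E}_1=\mathbb{E}_2$ inside $E$, i.e. there is an isomorphism of $F$-crystals $\mathbb{E}_1\cong\mathbb{E}_2$ compatible with the inclusions into $E$. -/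

import Mathlib

open CategoryTheory AlgebraicGeometry

universe u

noncomputable section

namespace FCrys

/-! ### The affine crystalline site, with `p`-adically complete divided power thickenings -/

/-- A `p`-adically complete ring `B` with a divided power ideal `I` containing `p`, such that
the divided powers of `p` are the standard ones, `γ_n(p) = p ^ n / n!` (an element of `ℤ_(p)`).
Thus `Spec (B / I) ⊆ Spf B` is an affine divided power thickening over `(ℤ_p, (p))`. -/
structure PDRing (p : ℕ) where
  carrier : Type u
  [commRing : CommRing carrier]
  complete : IsAdicComplete (Ideal.span {(p : carrier)}) carrier
  ideal : Ideal carrier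
  γ : DividedPowers ideal
  p_mem : (p : carrier) ∈ ideal
  dpow_p : ∀ n a b : ℕ, ¬ p ∣ b → b * p ^ n = a * n.factorial →
    (b : carrier) * γ.dpow n (p : carrier) = (a : carrier)

attribute [instance] PDRing.commRing

variable {p : ℕ}

namespace PDRing

/-- The ring `B / I`, which is killed by `p`. -/
abbrev residue (R : PDRing.{u} p) : Type u := R.carrier ⧸ R.ideal

theorem residue_p (R : PDRing.{u} p) : (p : R.residue) = 0 := by
  have h := Ideal.Quotient.eq_zero_iff_mem.2 R.p_mem
  rwa [map_natCast] at h

/-- The absolute Frobenius `b ↦ b ^ p` of `B / I`. -/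
def residueFrob [Fact p.Prime] (R : PDRing.{u} p) : R.residue →+* R.residue where
  toFun b := b ^ p
  map_one' := one_pow p
  map_mul' a b := mul_pow a b p
  map_zero' := zero_pow (Fact.out : p.Prime).ne_zero
  map_add' a b := by
    obtain ⟨r, hr⟩ := exists_add_pow_prime_eq (Fact.out : p.Prime) a b
    rw [hr, R.residue_p]
    ring

/-- Homomorphisms of divided power rings. -/
structure Hom (R S : PDRing.{u} p) where
  toRingHom : R.carrier →+* S.carrier
  isDP : DividedPowers.IsDPMorphism R.γ S.γ toRingHom

/-- The identity. -/
def Hom.id (R : PDRing.{u} p) : R.Hom R where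
  toRingHom := RingHom.id _
  isDP := ⟨by rw [Ideal.map_id], fun _ _ => rfl⟩

/-- Composition. -/
def Hom.comp {R S T : PDRing.{u} p} (g : S.Hom T) (f : R.Hom S) : R.Hom T where
  toRingHom := g.toRingHom.comp f.toRingHom
  isDP := DividedPowers.IsDPMorphism.comp _ g.isDP f.isDP

/-- The map `B / I → B' / I'` induced by a homomorphism `(B, I) → (B', I')`. -/
def Hom.residueMap {R S : PDRing.{u} p} (f : R.Hom S) : R.residue →+* S.residue :=
  Ideal.quotientMap S.ideal f.toRingHom (Ideal.map_le_iff_le_comap.1 f.isDP.ideal_comp)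

/-- A morphism `Spec (B / I) ⟶ X` that lands in some affine open of `X`. Together with `(B, I)`
this is an object of the (big, affine, `p`-complete) crystalline site of `X`; as in any site one
may restrict to small enough objects, so the condition on the image does not change what a
crystal is. -/
structure Point (R : PDRing.{u} p) (X : Scheme.{u}) where
  hom : Spec (CommRingCat.of R.residue) ⟶ X
  small : ∃ U : X.Opens, IsAffineOpen U ∧ ∀ t, hom t ∈ U

/-- The composition of `Spec (B / I) ⟶ X` with the absolute Frobenius. (As the absolute Frobenius
is natural, this is also the composition with the absolute Frobenius of `X`, if `X` has
characteristic `p`.) -/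
def Point.frob [Fact p.Prime] {R : PDRing.{u} p} {X : Scheme.{u}} (x : R.Point X) : R.Point X where
  hom := Spec.map (CommRingCat.ofHom R.residueFrob) ≫ x.hom
  small := by
    obtain ⟨U, hU, h⟩ := x.small
    exact ⟨U, hU, fun t => by simpa using h _⟩

/-- `f : (B, I) → (B', I')` is a morphism of thickenings over `X`. -/
def Hom.Over {R S : PDRing.{u} p} {X : Scheme.{u}} (f : R.Hom S) (x : R.Point X)
    (y : S.Point X) : Prop :=
  Spec.map (CommRingCat.ofHom f.residueMap) ≫ x.hom = y.hom

theorem Hom.over_id {R : PDRing.{u} p} {X : Scheme.{u}} (x : R.Point X) :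
    (Hom.id R).Over x x := by
  have h : (Hom.id R).residueMap = RingHom.id _ := by
    ext b
    simp [Hom.residueMap, Hom.id]
  unfold Hom.Over
  rw [h]
  simp

theorem Hom.Over.comp {R S T : PDRing.{u} p} {X : Scheme.{u}} {g : S.Hom T} {f : R.Hom S}
    {x : R.Point X} {y : S.Point X} {z : T.Point X} (hg : g.Over y z) (hf : f.Over x y) :
    (g.comp f).Over x z := by
  have h : (g.comp f).residueMap = g.residueMap.comp f.residueMap := by
    ext b
    simp [Hom.residueMap, Hom.comp]
  unfold Hom.Over at *
  rw [h, CommRingCat.ofHom_comp, Spec.map_comp, Category.assoc, hf, hg]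

theorem Hom.Over.frob [Fact p.Prime] {R S : PDRing.{u} p} {X : Scheme.{u}} {f : R.Hom S}
    {x : R.Point X} {y : S.Point X} (h : f.Over x y) : f.Over x.frob y.frob := by
  unfold Hom.Over at *
  have e : f.residueMap.comp R.residueFrob = S.residueFrob.comp f.residueMap := by
    refine RingHom.ext fun b => ?_
    exact map_pow f.residueMap b p
  simp only [Point.frob]
  rw [← h, ← Category.assoc, ← Category.assoc, ← Spec.map_comp, ← Spec.map_comp,
    ← CommRingCat.ofHom_comp, ← CommRingCat.ofHom_comp, e]

end PDRing

/-! ### Crystals and isocrystals -/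

/-- The semilinear map `f : M → N` along `φ : A → B` exhibits `N` as the base change `B ⊗[A] M`. -/
def IsBaseChangeAlong {A B M N : Type*} [CommRing A] [CommRing B] [AddCommGroup M] [AddCommGroup N]
    [Module A M] [Module B N] (φ : A →+* B) (f : M →ₛₗ[φ] N) : Prop :=
  letI : Algebra A B := φ.toAlgebra
  letI : Module A N := Module.compHom N φ
  haveI : IsScalarTower A B N := ⟨fun a b n => by
    change (φ a * b) • n = φ a • b • n
    rw [mul_smul]⟩
  IsBaseChange B
    ({ toFun := f
       map_add' := map_add f
       map_smul' := fun a m => map_smulₛₗ f a m } : M →ₗ[A] N)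

/-- The ring `B[1/p]`. -/
abbrev InvP (p : ℕ) (B : Type u) [CommRing B] : Type u := Localization.Away (p : B)

/-- The map `B[1/p] → B'[1/p]` induced by `φ : B → B'`. -/
def InvP.map (p : ℕ) {B B' : Type u} [CommRing B] [CommRing B'] (φ : B →+* B') :
    InvP p B →+* InvP p B' :=
  IsLocalization.Away.lift (p : B) (g := (algebraMap B' (InvP p B')).comp φ) (by
    have h := IsLocalization.Away.algebraMap_isUnit (S := InvP p B') (p : B')
    simpa using h)

/-- A crystal of vector bundles on `X`: a finite projective `B`-module for every object of the
crystalline site, compatible with base change. -/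
structure Crystal (p : ℕ) (X : Scheme.{u}) where
  obj : ∀ R : PDRing.{u} p, R.Point X → Type u
  [addCommGroup : ∀ R x, AddCommGroup (obj R x)]
  [module : ∀ R x, Module R.carrier (obj R x)]
  finite : ∀ R x, Module.Finite R.carrier (obj R x)
  projective : ∀ R x, Module.Projective R.carrier (obj R x)
  map : ∀ {R S : PDRing.{u} p} (f : R.Hom S) {x : R.Point X} {y : S.Point X}, f.Over x y →
    (obj R x →ₛₗ[f.toRingHom] obj S y)
  isBaseChange : ∀ {R S : PDRing.{u} p} (f : R.Hom S) {x : R.Point X} {y : S.Point X}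
    (h : f.Over x y), IsBaseChangeAlong f.toRingHom (map f h)
  map_id : ∀ {R : PDRing.{u} p} (x : R.Point X) (m : obj R x),
    map (PDRing.Hom.id R) (PDRing.Hom.over_id x) m = m
  map_comp : ∀ {R S T : PDRing.{u} p} (g : S.Hom T) (f : R.Hom S) {x : R.Point X} {y : S.Point X}
    {z : T.Point X} (hg : g.Over y z) (hf : f.Over x y) (m : obj R x),
    map (g.comp f) (hg.comp hf) m = map g hg (map f hf m)

attribute [instance] Crystal.addCommGroup Crystal.module

/-- An `F`-crystal on `X`, of characteristic `p`: a crystal `𝔼` with a morphism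
`F : F_X^* 𝔼 → 𝔼` that becomes an isomorphism after inverting `p`. The value of `F_X^* 𝔼` at
`x : Spec (B / I) ⟶ X` is the value of `𝔼` at `x ≫ F_X`. -/
structure FCrystal (p : ℕ) [Fact p.Prime] (X : Scheme.{u}) extends Crystal.{u} p X where
  frob : ∀ (R : PDRing.{u} p) (x : R.Point X), obj R x.frob →ₗ[R.carrier] obj R x
  frob_map : ∀ {R S : PDRing.{u} p} (f : R.Hom S) {x : R.Point X} {y : S.Point X} (h : f.Over x y)
    (m : obj R x.frob), map f h (frob R x m) = frob S y (map f h.frob m)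
  frob_ker : ∀ (R : PDRing.{u} p) (x : R.Point X) (m : obj R x.frob), frob R x m = 0 →
    ∃ n : ℕ, (p : R.carrier) ^ n • m = 0
  frob_coker : ∀ (R : PDRing.{u} p) (x : R.Point X) (m : obj R x),
    ∃ (n : ℕ) (m' : obj R x.frob), frob R x m' = (p : R.carrier) ^ n • m

/-- An isocrystal on `X`: a finite projective `B[1/p]`-module for every object of the crystalline
site, compatible with base change. -/
structure Isocrystal (p : ℕ) (X : Scheme.{u}) where
  obj : ∀ R : PDRing.{u} p, R.Point X → Type u
  [addCommGroup : ∀ R x, AddCommGroup (obj R x)]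
  [module : ∀ R x, Module (InvP p R.carrier) (obj R x)]
  finite : ∀ R x, Module.Finite (InvP p R.carrier) (obj R x)
  projective : ∀ R x, Module.Projective (InvP p R.carrier) (obj R x)
  map : ∀ {R S : PDRing.{u} p} (f : R.Hom S) {x : R.Point X} {y : S.Point X}, f.Over x y →
    (obj R x →ₛₗ[InvP.map p f.toRingHom] obj S y)
  isBaseChange : ∀ {R S : PDRing.{u} p} (f : R.Hom S) {x : R.Point X} {y : S.Point X}
    (h : f.Over x y), IsBaseChangeAlong (InvP.map p f.toRingHom) (map f h)
  map_id : ∀ {R : PDRing.{u} p} (x : R.Point X) (m : obj R x),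
    map (PDRing.Hom.id R) (PDRing.Hom.over_id x) m = m
  map_comp : ∀ {R S T : PDRing.{u} p} (g : S.Hom T) (f : R.Hom S) {x : R.Point X} {y : S.Point X}
    {z : T.Point X} (hg : g.Over y z) (hf : f.Over x y) (m : obj R x),
    map (g.comp f) (hg.comp hf) m = map g hg (map f hf m)

attribute [instance] Isocrystal.addCommGroup Isocrystal.module

/-- An `F`-isocrystal on `X`, of characteristic `p`: an isocrystal `E` with an isomorphism
`F : F_X^* E ≃ E`. -/
structure FIsocrystal (p : ℕ) [Fact p.Prime] (X : Scheme.{u}) extends Isocrystal.{u} p X where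
  frob : ∀ (R : PDRing.{u} p) (x : R.Point X), obj R x.frob ≃ₗ[InvP p R.carrier] obj R x
  frob_map : ∀ {R S : PDRing.{u} p} (f : R.Hom S) {x : R.Point X} {y : S.Point X} (h : f.Over x y)
    (m : obj R x.frob), map f h (frob R x m) = frob S y (map f h.frob m)

/-- An `F`-crystal inside the `F`-isocrystal `E`: an `F`-crystal `𝔼` with a morphism `ι : 𝔼 → E`,
compatible with Frobenius, that identifies `𝔼[1/p]` with `E`. -/
structure SubFCrystal {p : ℕ} [Fact p.Prime] {X : Scheme.{u}} (E : FIsocrystal.{u} p X)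
    extends FCrystal.{u} p X where
  ι : ∀ (R : PDRing.{u} p) (x : R.Point X),
    obj R x →ₛₗ[algebraMap R.carrier (InvP p R.carrier)] E.obj R x
  ι_isBaseChange : ∀ (R : PDRing.{u} p) (x : R.Point X),
    IsBaseChangeAlong (algebraMap R.carrier (InvP p R.carrier)) (ι R x)
  ι_map : ∀ {R S : PDRing.{u} p} (f : R.Hom S) {x : R.Point X} {y : S.Point X} (h : f.Over x y)
    (m : obj R x), ι S y (map f h m) = E.map f h (ι R x m)
  ι_frob : ∀ (R : PDRing.{u} p) (x : R.Point X) (m : obj R x.frob),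
    ι R x (frob R x m) = E.frob R x (ι R x.frob m)

/-- Equality of two `F`-crystals inside `E` as subobjects: an isomorphism of `F`-crystals that is
compatible with the two inclusions into `E`. -/
def SubFCrystal.EqInside [Fact p.Prime] {X : Scheme.{u}} {E : FIsocrystal.{u} p X}
    (L₁ L₂ : SubFCrystal E) : Prop :=
  ∃ e : ∀ (R : PDRing.{u} p) (x : R.Point X), L₁.obj R x ≃ₗ[R.carrier] L₂.obj R x,
    (∀ (R S : PDRing.{u} p) (f : R.Hom S) (x : R.Point X) (y : S.Point X) (h : f.Over x y)
      (m : L₁.obj R x), e S y (L₁.map f h m) = L₂.map f h (e R x m)) ∧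
    (∀ (R : PDRing.{u} p) (x : R.Point X) (m : L₁.obj R x.frob),
      e R x (L₁.frob R x m) = L₂.frob R x (e R x.frob m)) ∧
    (∀ (R : PDRing.{u} p) (x : R.Point X) (m : L₁.obj R x), L₂.ι R x (e R x m) = L₁.ι R x m)

/-! ### Fibres at points with values in perfect fields -/

section Witt

variable (p) [Fact p.Prime] (K : Type u) [Field K] [CharP K p]

theorem witt_exists_dpow (n : ℕ) {x : WittVector p K}
    (hx : x ∈ Ideal.span {(p : WittVector p K)}) :
    ∃ y : WittVector p K, (n ≠ 0 → y ∈ Ideal.span {(p : WittVector p K)}) ∧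
      (n.factorial : WittVector p K) * y = x ^ n := by
  rcases eq_or_ne n 0 with rfl | hn
  · exact ⟨1, fun h => (h rfl).elim, by simp⟩
  obtain ⟨y, rfl⟩ := Ideal.mem_span_singleton'.1 hx
  have hp : p.Prime := Fact.out
  obtain ⟨m, hm⟩ : p ^ padicValNat p n.factorial ∣ n.factorial := pow_padicValNat_dvd
  have hlt : padicValNat p n.factorial < n := padicValNat_factorial_lt_of_ne_zero p hn
  have hpm : ¬ p ∣ m := by
    rintro ⟨c, rfl⟩
    refine pow_succ_padicValNat_not_dvd (p := p) n.factorial_ne_zero ⟨c, ?_⟩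
    rw [pow_succ, mul_assoc]
    exact hm
  have hu : IsUnit (m : WittVector p K) := by
    apply WittVector.isUnit_of_coeff_zero_ne_zero
    have h0 : (m : WittVector p K).coeff 0 = (m : K) :=
      map_natCast (WittVector.constantCoeff (p := p) (R := K)) m
    rw [h0]
    exact fun h => hpm ((CharP.cast_eq_zero_iff K p m).1 h)
  obtain ⟨u, hu⟩ := hu
  obtain ⟨d, hd⟩ := Nat.exists_eq_add_of_lt hlt
  generalize padicValNat p n.factorial = v at *
  refine ⟨(↑u⁻¹ : WittVector p K) * (p : WittVector p K) ^ (d + 1) * y ^ n, fun _ => ?_, ?_⟩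
  · refine Ideal.mem_span_singleton'.2 ⟨(↑u⁻¹ : WittVector p K) * (p : WittVector p K) ^ d * y ^ n, ?_⟩
    ring
  · have h1 : (n.factorial : WittVector p K) = (p : WittVector p K) ^ v * u := by
      rw [hu, hm]
      push_cast
      ring
    have h2 : (u : WittVector p K) * (↑u⁻¹ : WittVector p K) = 1 := u.mul_inv
    rw [h1]
    calc (p : WittVector p K) ^ v * u * (↑u⁻¹ * (p : WittVector p K) ^ (d + 1) * y ^ n)
        = (u * ↑u⁻¹) * ((p : WittVector p K) ^ (v + (d + 1)) * y ^ n) := by ring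
      _ = (y * (p : WittVector p K)) ^ n := by
          rw [h2, mul_pow, one_mul, ← add_assoc, ← hd]
          ring

theorem witt_charZero : CharZero (WittVector p K) := by
  have hp : p.Prime := Fact.out
  refine charZero_of_inj_zero fun n hn => ?_
  by_contra h0
  obtain ⟨m, hm⟩ : p ^ padicValNat p n ∣ n := pow_padicValNat_dvd
  have hpm : ¬ p ∣ m := by
    rintro ⟨c, rfl⟩
    refine pow_succ_padicValNat_not_dvd (p := p) h0 ⟨c, ?_⟩
    rw [pow_succ, mul_assoc]
    exact hm
  have hm0 : (m : WittVector p K) ≠ 0 := by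
    intro h
    have h1 : (m : K) = 0 := by
      have h2 := congrArg (WittVector.constantCoeff (p := p) (R := K)) h
      rwa [map_natCast, map_zero] at h2
    exact hpm ((CharP.cast_eq_zero_iff K p m).1 h1)
  rw [hm] at hn
  push_cast at hn
  rcases mul_eq_zero.1 hn with h | h
  · exact WittVector.p_nonzero p K (eq_zero_of_pow_eq_zero h)
  · exact hm0 h

open Classical in
/-- The divided powers `x ^ n / n!` on the ideal `(p)` of `W(K)`. -/
def wittDividedPowers : DividedPowers (Ideal.span {(p : WittVector p K)}) :=
  haveI := witt_charZero p K
  DividedPowers.ofInjective (Ideal.span {(p : WittVector p K)}) ⊤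
    (algebraMap (WittVector p K) (FractionRing (WittVector p K)))
    (IsFractionRing.injective _ _)
    (DividedPowers.RatAlgebra.dividedPowers (⊤ : Ideal (FractionRing (WittVector p K))))
    (by
      rw [Ideal.map_span, Set.image_singleton, map_natCast, Ideal.span_singleton_eq_top,
        isUnit_iff_ne_zero, Nat.cast_ne_zero]
      exact (Fact.out : p.Prime).ne_zero)
    (fun n x hx => by
      obtain ⟨y, hy, h⟩ := witt_exists_dpow p K n hx
      refine ⟨y, hy, ?_⟩
      have h0 : (n.factorial : FractionRing (WittVector p K)) ≠ 0 :=
        Nat.cast_ne_zero.2 n.factorial_ne_zero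
      have h1 := congrArg (algebraMap (WittVector p K) (FractionRing (WittVector p K))) h
      rw [map_mul, map_natCast, map_pow] at h1
      rw [DividedPowers.RatAlgebra.dpow_apply, if_pos Submodule.mem_top, ← h1,
        Ring.inverse_eq_inv', inv_mul_cancel_left₀ h0])

theorem witt_frobenius_isDP : DividedPowers.IsDPMorphism (wittDividedPowers p K)
    (wittDividedPowers p K) (WittVector.frobenius : WittVector p K →+* WittVector p K) := by
  have := witt_charZero p K
  have hmap : ∀ a ∈ Ideal.span {(p : WittVector p K)},
      (WittVector.frobenius : WittVector p K →+* WittVector p K) a ∈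
        Ideal.span {(p : WittVector p K)} := by
    intro a ha
    obtain ⟨y, rfl⟩ := Ideal.mem_span_singleton'.1 ha
    refine Ideal.mem_span_singleton'.2 ⟨WittVector.frobenius y, ?_⟩
    rw [map_mul, map_natCast]
  refine ⟨Ideal.map_le_iff_le_comap.2 hmap, fun {n} a ha => ?_⟩
  have h0 : (n.factorial : WittVector p K) ≠ 0 := Nat.cast_ne_zero.2 n.factorial_ne_zero
  refine mul_left_cancel₀ h0 ?_
  rw [DividedPowers.factorial_mul_dpow_eq_pow _ (hmap a ha), ← map_pow,
    ← DividedPowers.factorial_mul_dpow_eq_pow (wittDividedPowers p K) ha, map_mul, map_natCast]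

variable [PerfectRing K p]

/-- The divided power ring `(W(K), (p))`. -/
def wittPDRing : PDRing.{u} p where
  carrier := WittVector p K
  complete := WittVector.isAdicCompleteIdealSpanP
  ideal := Ideal.span {(p : WittVector p K)}
  γ := wittDividedPowers p K
  p_mem := Ideal.mem_span_singleton_self _
  dpow_p n a b _ h := by
    have := witt_charZero p K
    have h0 : (n.factorial : WittVector p K) ≠ 0 := Nat.cast_ne_zero.2 n.factorial_ne_zero
    refine mul_left_cancel₀ h0 ?_
    rw [mul_left_comm, DividedPowers.factorial_mul_dpow_eq_pow _ (Ideal.mem_span_singleton_self _)]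
    have h1 := congrArg (Nat.cast : ℕ → WittVector p K) h
    push_cast at h1
    rw [h1, mul_comm]

variable {p K}

/-- The object `(W(K), (p))` of the crystalline site of `X` given by a point `Spec K ⟶ X`. -/
def wittPoint {X : Scheme.{u}} (x : Spec (CommRingCat.of K) ⟶ X) : (wittPDRing p K).Point X where
  hom := Spec.map (CommRingCat.ofHom
    (R := K) (S := (wittPDRing p K).residue)
    (WittVector.quotientPEquiv (p := p) (k := K)).symm.toRingHom) ≫ x
  small := by
    obtain ⟨U, hU, h, -⟩ := exists_isAffineOpen_mem_and_subset
      (x := x (IsLocalRing.closedPoint K)) (U := ⊤) trivial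
    refine ⟨U, hU, fun t => ?_⟩
    have e : ∀ s : Spec (CommRingCat.of K), s = IsLocalRing.closedPoint K := fun s =>
      Subsingleton.elim (α := PrimeSpectrum K) _ _
    rw [Scheme.Hom.comp_apply, e (Spec.map _ t)]
    exact h

variable (p K)

/-- The Witt vector Frobenius `W(K) → W(K)`. -/
def wittFrob : (wittPDRing p K).Hom (wittPDRing p K) where
  toRingHom := (WittVector.frobenius : WittVector p K →+* WittVector p K)
  isDP := witt_frobenius_isDP p K

variable {p K}

theorem wittFrob_over {X : Scheme.{u}} (x : Spec (CommRingCat.of K) ⟶ X) :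
    (wittFrob p K).Over (wittPoint x) (wittPoint x).frob := by
  have h : (wittFrob p K).residueMap = (wittPDRing p K).residueFrob := by
    refine Ideal.Quotient.ringHom_ext (RingHom.ext fun (b : WittVector p K) => ?_)
    refine Ideal.Quotient.eq.2 ?_
    refine (WittVector.mem_span_p_iff_coeff_zero_eq_zero (p := p) (k := K) _).2 ?_
    change WittVector.constantCoeff (WittVector.frobenius (p := p) (R := K) b - b ^ p) = 0
    rw [map_sub, map_pow]
    simp [WittVector.coeff_frobenius_charP]
  unfold PDRing.Hom.Over
  rw [h]
  rfl

end Witt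

section Fibre

variable [Fact p.Prime] {K : Type u} [Field K] [CharP K p] [PerfectRing K p] {X : Scheme.{u}}

/-- The fibre of a crystal at a point `x : Spec K ⟶ X`: a finite free `W(K)`-module. -/
abbrev Crystal.fibre (L : Crystal.{u} p X) (x : Spec (CommRingCat.of K) ⟶ X) : Type u :=
  L.obj (wittPDRing p K) (wittPoint x)

/-- The Frobenius-semilinear endomorphism of the fibre of an `F`-crystal at `x`. -/
def FCrystal.fibreFrob (L : FCrystal.{u} p X) (x : Spec (CommRingCat.of K) ⟶ X) :
    L.fibre x →ₛₗ[(wittFrob p K).toRingHom] L.fibre x :=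
  (L.frob (wittPDRing p K) (wittPoint x)).comp (L.map (wittFrob p K) (wittFrob_over x))

/-- The fibre of an isocrystal at a point `x : Spec K ⟶ X`: a `W(K)[1/p]`-vector space. -/
abbrev Isocrystal.fibre (E : Isocrystal.{u} p X) (x : Spec (CommRingCat.of K) ⟶ X) : Type u :=
  E.obj (wittPDRing p K) (wittPoint x)

/-- The Frobenius-semilinear endomorphism of the fibre of an `F`-isocrystal at `x`. -/
def FIsocrystal.fibreFrob (E : FIsocrystal.{u} p X) (x : Spec (CommRingCat.of K) ⟶ X) :
    E.fibre x →ₛₗ[InvP.map p (wittFrob p K).toRingHom] E.fibre x :=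
  (E.frob (wittPDRing p K) (wittPoint x)).toLinearMap.comp
    (E.map (wittFrob p K) (wittFrob_over x))

/-- The slopes of the Hodge polygon of the fibre at `x` are `a 0, …, a (n - 1)` (in some order):
`F` has elementary divisors `p ^ a i`. -/
def FCrystal.HasHodgeSlopes (L : FCrystal.{u} p X) (x : Spec (CommRingCat.of K) ⟶ X) {n : ℕ}
    (a : Fin n → ℕ) : Prop :=
  ∃ e f : Module.Basis (Fin n) (wittPDRing p K).carrier (L.fibre x),
    ∀ i, L.fibreFrob x (e i) = (p : (wittPDRing p K).carrier) ^ a i • f i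

/-- The slopes of the Newton polygon of the fibre at `x : Spec K ⟶ X` are `l 0, …, l (n - 1)` (in
some order), for `K` algebraically closed: for some `s > 0` there is a basis `e` of the fibre with
`F ^ s (e i) = p ^ (s * l i) • e i` (Dieudonné–Manin). Here `s * l i = c - b` is an integer. -/
def FIsocrystal.HasNewtonSlopes (E : FIsocrystal.{u} p X) (x : Spec (CommRingCat.of K) ⟶ X) {n : ℕ}
    (l : Fin n → ℚ) : Prop :=
  ∃ s : ℕ, 0 < s ∧ ∃ e : Module.Basis (Fin n) (InvP p (wittPDRing p K).carrier) (E.fibre x),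
    ∀ i, ∃ b c : ℕ, s * l i = (c : ℚ) - (b : ℚ) ∧
      (p : InvP p (wittPDRing p K).carrier) ^ b • (E.fibreFrob x)^[s] (e i) =
        (p : InvP p (wittPDRing p K).carrier) ^ c • e i

variable {E : FIsocrystal.{u} p X}

/-- `L₁` and `L₂` agree at the point `x`: their fibres are the same `W(K)`-lattice in the fibre
of `E`. -/
def SubFCrystal.AgreeAt (L₁ L₂ : SubFCrystal E) (x : Spec (CommRingCat.of K) ⟶ X) : Prop :=
  Set.range (L₁.ι (wittPDRing p K) (wittPoint x)) = Set.range (L₂.ι (wittPDRing p K) (wittPoint x))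

/-- The `F`-crystal `L` with `L[1/p] = E` is ordinary: at all geometric points the Hodge polygon of
`L` and the Newton polygon of `E` coincide, and they do not depend on the point. (Their slopes are
integers, as the slopes of a Hodge polygon are.) -/
def SubFCrystal.IsOrdinary (L : SubFCrystal E) : Prop :=
  ∃ (n : ℕ) (a : Fin n → ℕ), ∀ (K : Type u) [Field K] [IsAlgClosed K] [CharP K p]
    [PerfectRing K p] (x : Spec (CommRingCat.of K) ⟶ X),
    L.HasHodgeSlopes x a ∧ E.HasNewtonSlopes x (fun i => (a i : ℚ))

end Fibre

end FCrys

end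

/-!
Two ordinary `F`-crystals inside the same `F`-isocrystal that agree at one point are equal. The
proof first moves the agreement from one point to all points, and then from points to crystals.

**From one point to all points.** Let `O` be a perfect valuation ring with algebraically closed
residue field and fraction field, and `Spec O ⟶ C` a morphism. The values of the two crystals at
`W(O)` are lattices with Frobenius. As the Hodge polygons at the two points of `Spec O` are equal,
the Frobenius matrix of each crystal has the form `D * U` in a suitable basis over `W(O)`, with
`D = diag (p ^ a)` and `U` invertible (`exists_hasSplitBasis`). As the Newton polygon is the Hodge
polygon, the principal blocks of `U` that belong to the slopes `≤ c` are invertible at the closed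
point (`not_dvd_det_principalBlock`). Hence a morphism of Frobenius modules that vanishes modulo `p`
at the closed point vanishes modulo `p` over `O` (`map_eq_zero_of_residue`): divided by an entry of
least valuation, it would give over the residue field a nonzero strictly triangular solution of an
equation that only has the solution zero (`eq_zero_of_triangular`). Multiplying the inclusion of one
lattice in the isocrystal by a power of `p` gives such a morphism, and the denominators can be
removed one at a time. So the two crystals agree at both points of `Spec O` or at neither. Valuation
rings realize all specializations, so the set of points where the crystals agree is stable under
specialization and generization; it is everything since `C` is Noetherian and connected
(`SubFCrystal.IsOrdinary.agreeAt_of_agreeAt`).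

**From points to lifts of charts.** Let `Spec A` be an affine open of `C`. Write `A` as a quotient
of a polynomial ring `P` over `W(k)` and let `P^` be the completion of `P` along the kernel. It is
`p`-torsion-free, has a lift of Frobenius, and is reduced modulo `p`, because the Frobenius of a
polynomial ring over `k` is split. As `A` is formally smooth, `P^ / p` is an `A`-algebra, so `P^` is
an object of the crystalline site of `C`. The lift of Frobenius gives maps `P^ → W(P^ / p) → W(K)`
for the geometric points of `P^ / p`, which together detect divisibility by `p`. Therefore agreement
at all points implies agreement at `P^` (`SubFCrystal.agreeOn_completionPDRing`).

**From charts to all objects.** An arbitrary object `B` of the site may have torsion, so the values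
of the crystals need not embed in the isocrystal. Every object over `Spec A` receives a homomorphism
from `P^`, because `B` is `p`-complete and has divided powers, and the isomorphism over `P^` induces
one over `B`. It does not depend on the homomorphism: two lifts of the same point factor, after a
change of the first, through a completed divided power polynomial ring over `P^`, which is
`p`-torsion-free, so that over it there is only one isomorphism compatible with the inclusions
(`SubFCrystal.Compares.of_liftsPoint`). Comparing charts on their affine intersections shows that it
does not depend on the chart either, and these isomorphisms form an isomorphism of `F`-crystals
(`SubFCrystal.AgreeEverywhere.eqInside`).
-/

noncomputable section

namespace FCrys

section

variable {p : ℕ}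

/-! ### Torsion-free divided power rings -/

section TorsionFree

variable [Fact p.Prime] {B : Type*} [CommRing B]

theorem isUnit_natCast_of_isAdicComplete (h : IsAdicComplete (Ideal.span {(p : B)}) B) {n : ℕ}
    (hn : ¬ p ∣ n) : IsUnit (n : B) := by
  have hc : IsCoprime (n : ℤ) (p : ℤ) :=
    Nat.isCoprime_iff_coprime.2 (((Fact.out : p.Prime).coprime_iff_not_dvd.2 hn).symm)
  obtain ⟨a, b, hab⟩ := hc
  have hj := IsAdicComplete.le_jacobson_bot (Ideal.span {(p : B)})
    (Ideal.mem_span_singleton_self (p : B))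
  have hu := Ideal.mem_jacobson_bot.1 hj (-(b : B))
  have e : (p : B) * -(b : B) + 1 = (a : B) * n := by
    have := congrArg (Int.cast : ℤ → B) hab
    push_cast at this
    rw [← this]
    ring
  rw [e] at hu
  exact isUnit_of_mul_isUnit_right hu

theorem natCast_mul_cancel (h : IsAdicComplete (Ideal.span {(p : B)}) B)
    (htf : ∀ b : B, (p : B) * b = 0 → b = 0) {n : ℕ} (hn : n ≠ 0) {b : B}
    (hb : (n : B) * b = 0) : b = 0 := by
  obtain ⟨v, m, hm, rfl⟩ := Nat.exists_eq_pow_mul_and_not_dvd hn p (Fact.out : p.Prime).ne_one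
  obtain ⟨w, hw⟩ := isUnit_natCast_of_isAdicComplete h hm
  have : ∀ v : ℕ, (p : B) ^ v * ((m : B) * b) = 0 → (m : B) * b = 0 := by
    intro v
    induction v with
    | zero => simp
    | succ v ih =>
      intro h
      exact ih (htf _ (by rw [← h]; ring))
  have h2 : (m : B) * b = 0 := this v (by rw [← hb]; push_cast; ring)
  rw [← hw] at h2
  simpa using h2

theorem natCast_mem_nonZeroDivisors (h : IsAdicComplete (Ideal.span {(p : B)}) B)
    (htf : ∀ b : B, (p : B) * b = 0 → b = 0) {n : ℕ} (hn : n ≠ 0) :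
    (n : B) ∈ nonZeroDivisors B :=
  mem_nonZeroDivisors_iff_right.2 fun b hb =>
    natCast_mul_cancel h htf hn (b := b) (by rw [mul_comm]; exact hb)

theorem isUnit_natCast_fractionRing (h : IsAdicComplete (Ideal.span {(p : B)}) B)
    (htf : ∀ b : B, (p : B) * b = 0 → b = 0) {n : ℕ} (hn : n ≠ 0) :
    IsUnit (n : FractionRing B) := by
  rw [← map_natCast (algebraMap B (FractionRing B))]
  exact IsLocalization.map_units (FractionRing B)
    (⟨n, natCast_mem_nonZeroDivisors h htf hn⟩ : nonZeroDivisors B)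

/-- The total ring of fractions of a `p`-torsion-free `p`-complete ring contains `ℚ`. -/
@[reducible] def ratAlgebraFractionRing (h : IsAdicComplete (Ideal.span {(p : B)}) B)
    (htf : ∀ b : B, (p : B) * b = 0 → b = 0) : Algebra ℚ (FractionRing B) :=
  (IsLocalization.lift (M := nonZeroDivisors ℤ) (S := ℚ) (g := Int.castRingHom (FractionRing B))
    (by
      rintro ⟨z, hz⟩
      have hz0 : z ≠ 0 := nonZeroDivisors.ne_zero hz
      have := isUnit_natCast_fractionRing h htf (n := z.natAbs) (by simpa using hz0)
      rcases Int.natAbs_eq z with hh | hh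
      · simp only
        rw [hh]
        simpa using this
      · simp only
        rw [hh]
        simpa using this)).toAlgebra

open Classical in
/-- If, in a `p`-torsion-free `p`-complete ring, the powers `x ^ n` of the elements of an ideal are
divisible by `n!` within the ideal, then the ideal has (unique) divided powers. -/
def dividedPowersOfTorsionFree (h : IsAdicComplete (Ideal.span {(p : B)}) B)
    (htf : ∀ b : B, (p : B) * b = 0 → b = 0) (J : Ideal B) (hp : (p : B) ∈ J)
    (hJ : ∀ x ∈ J, ∀ n : ℕ, n ≠ 0 → ∃ y ∈ J, (n.factorial : B) * y = x ^ n) :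
    DividedPowers J :=
  letI : Algebra ℚ (FractionRing B) := ratAlgebraFractionRing h htf
  DividedPowers.ofInjective J ⊤ (algebraMap B (FractionRing B)) (IsFractionRing.injective _ _)
    (DividedPowers.RatAlgebra.dividedPowers (⊤ : Ideal (FractionRing B)))
    (Ideal.eq_top_of_isUnit_mem _ (Ideal.mem_map_of_mem _ hp) (by
      rw [map_natCast]
      exact isUnit_natCast_fractionRing h htf (Fact.out : p.Prime).ne_zero))
    (fun n x hx => by
      obtain ⟨y, hy, e⟩ : ∃ y : B, (n ≠ 0 → y ∈ J) ∧ (n.factorial : B) * y = x ^ n := by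
        rcases eq_or_ne n 0 with rfl | hn
        · exact ⟨1, fun h => (h rfl).elim, by simp⟩
        · obtain ⟨y, hy, e⟩ := hJ x hx n hn
          exact ⟨y, fun _ => hy, e⟩
      refine ⟨y, hy, ?_⟩
      have h0 := isUnit_natCast_fractionRing h htf n.factorial_ne_zero
      have h1 := congrArg (algebraMap B (FractionRing B)) e
      rw [map_mul, map_pow, map_natCast] at h1
      rw [DividedPowers.RatAlgebra.dpow_apply, if_pos Submodule.mem_top, ← h1,
        Ring.inverse_mul_cancel_left _ _ h0])

end TorsionFree

namespace PDRing

variable [Fact p.Prime]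

/-- A divided power ring is `p`-torsion-free. -/
def TorsionFree (R : PDRing.{u} p) : Prop := ∀ b : R.carrier, (p : R.carrier) * b = 0 → b = 0

/-- The divided power ring given by an ideal of a `p`-torsion-free, `p`-complete ring. -/
@[reducible] def ofTorsionFree (B : Type u) [CommRing B]
    (h : IsAdicComplete (Ideal.span {(p : B)}) B)
    (htf : ∀ b : B, (p : B) * b = 0 → b = 0) (J : Ideal B) (hp : (p : B) ∈ J)
    (hJ : ∀ x ∈ J, ∀ n : ℕ, n ≠ 0 → ∃ y ∈ J, (n.factorial : B) * y = x ^ n) : PDRing.{u} p where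
  carrier := B
  complete := h
  ideal := J
  γ := dividedPowersOfTorsionFree h htf J hp hJ
  p_mem := hp
  dpow_p n a b _ e := by
    refine sub_eq_zero.1 (natCast_mul_cancel h htf n.factorial_ne_zero ?_)
    rw [mul_sub, mul_left_comm, DividedPowers.factorial_mul_dpow_eq_pow _ hp]
    have h1 := congrArg (Nat.cast : ℕ → B) e
    push_cast at h1
    rw [h1]
    ring

/-- For some `b` prime to `p`, `b * p ^ n` is an integral multiple of `n!`. -/
theorem exists_mul_pow_eq_mul_factorial (n : ℕ) :
    ∃ a b : ℕ, ¬ p ∣ b ∧ b * p ^ n = a * n.factorial ∧ (n ≠ 0 → p ∣ a) := by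
  obtain ⟨v, m, hm, e⟩ := Nat.exists_eq_pow_mul_and_not_dvd n.factorial_ne_zero p
    (Fact.out : p.Prime).ne_one
  rcases eq_or_ne n 0 with rfl | hn
  · exact ⟨1, 1, (Fact.out : p.Prime).not_dvd_one, by simp, fun h => (h rfl).elim⟩
  have hv : v < n := by
    have h1 : padicValNat p n.factorial < n := padicValNat_factorial_lt_of_ne_zero p hn
    have h2 : v ≤ padicValNat p n.factorial :=
      (padicValNat_dvd_iff_le n.factorial_ne_zero).1 ⟨m, e⟩
    omega
  obtain ⟨d, rfl⟩ := Nat.exists_eq_add_of_lt hv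
  refine ⟨p ^ (d + 1), m, hm, ?_, fun _ => dvd_pow_self _ (by omega)⟩
  rw [e]
  ring

/-- The divided powers on the ideal `(p)` of a `p`-torsion-free, `p`-complete ring. -/
@[reducible] def ofP (B : Type u) [CommRing B] (h : IsAdicComplete (Ideal.span {(p : B)}) B)
    (htf : ∀ b : B, (p : B) * b = 0 → b = 0) : PDRing.{u} p :=
  ofTorsionFree B h htf (Ideal.span {(p : B)}) (Ideal.mem_span_singleton_self _) (by
    intro x hx n hn
    obtain ⟨y, rfl⟩ := Ideal.mem_span_singleton'.1 hx
    obtain ⟨a, b, hb, e, ha⟩ := exists_mul_pow_eq_mul_factorial (p := p) n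
    obtain ⟨c, rfl⟩ := ha hn
    obtain ⟨w, hw⟩ := isUnit_natCast_of_isAdicComplete h hb
    refine ⟨↑w⁻¹ * (p * c) * y ^ n, Ideal.mem_span_singleton'.2 ⟨↑w⁻¹ * c * y ^ n, by ring⟩, ?_⟩
    have h1 := congrArg (Nat.cast : ℕ → B) e
    push_cast at h1
    have h2 : (↑w⁻¹ : B) * w = 1 := w.inv_mul
    calc (n.factorial : B) * (↑w⁻¹ * (p * c) * y ^ n)
        = ↑w⁻¹ * (p * c * n.factorial) * y ^ n := by ring
      _ = (↑w⁻¹ * b) * (y ^ n * p ^ n) := by rw [← h1]; ring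
      _ = (y * p) ^ n := by rw [← hw, h2, one_mul, mul_pow])

/-- A ring homomorphism respecting the ideals is a divided power homomorphism if the target is
`p`-torsion-free. -/
def Hom.ofTorsionFree {R S : PDRing.{u} p} (hS : S.TorsionFree) (f : R.carrier →+* S.carrier)
    (h : ∀ x ∈ R.ideal, f x ∈ S.ideal) : R.Hom S where
  toRingHom := f
  isDP := by
    refine ⟨Ideal.map_le_iff_le_comap.2 h, fun {n} a ha => ?_⟩
    refine sub_eq_zero.1 (natCast_mul_cancel S.complete hS n.factorial_ne_zero ?_)
    rw [mul_sub, DividedPowers.factorial_mul_dpow_eq_pow _ (h a ha), ← map_natCast f, ← map_mul,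
      DividedPowers.factorial_mul_dpow_eq_pow _ ha, map_pow, sub_self]

/-- The divided powers of `p` are those of `ℤ_(p)`, hence preserved by all ring homomorphisms. -/
theorem map_dpow_p {R S : PDRing.{u} p} (f : R.carrier →+* S.carrier) (n : ℕ) :
    S.γ.dpow n (f p) = f (R.γ.dpow n p) := by
  obtain ⟨a, b, hb, e, -⟩ := exists_mul_pow_eq_mul_factorial (p := p) n
  have h1 := S.dpow_p n a b hb e
  have h2 := congrArg f (R.dpow_p n a b hb e)
  rw [map_mul, map_natCast, map_natCast] at h2
  obtain ⟨w, hw⟩ := isUnit_natCast_of_isAdicComplete S.complete hb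
  rw [map_natCast]
  rw [← hw] at h1 h2
  exact w.mul_right_inj.1 (h1.trans h2.symm)

/-- A ring homomorphism that is compatible with divided powers on generators of the ideal. -/
def Hom.ofSpan {R S : PDRing.{u} p} {T : Set R.carrier} (hR : R.ideal = Ideal.span T)
    (f : R.carrier →+* S.carrier) (h : ∀ t ∈ T, f t ∈ S.ideal)
    (hd : ∀ (n : ℕ), ∀ t ∈ T, S.γ.dpow n (f t) = f (R.γ.dpow n t)) : R.Hom S where
  toRingHom := f
  isDP := DividedPowers.IsDPMorphism.on_span _ _ hR h (fun {n} t ht => (hd n t ht).symm)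

/-- Every ring homomorphism out of a divided power ring with ideal `(p)` is a divided power
homomorphism. -/
def Hom.ofIdealP {R S : PDRing.{u} p} (hR : R.ideal = Ideal.span {(p : R.carrier)})
    (f : R.carrier →+* S.carrier) : R.Hom S :=
  Hom.ofSpan hR f (by rintro _ rfl; rw [map_natCast]; exact S.p_mem)
    (by rintro n _ rfl; exact map_dpow_p f n)

/-- In a divided power ring, `x ^ p` is divisible by `p` if `x` is in the ideal. -/
theorem p_dvd_pow {R : PDRing.{u} p} {x : R.carrier} (hx : x ∈ R.ideal) :
    (p : R.carrier) ∣ x ^ p := by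
  rw [← DividedPowers.factorial_mul_dpow_eq_pow R.γ hx]
  refine Dvd.dvd.mul_right ?_ _
  exact_mod_cast (Nat.cast_dvd_cast (α := R.carrier)
    (Nat.dvd_factorial (Fact.out : p.Prime).pos le_rfl))

end PDRing

end

section

variable {p : ℕ}

/-! ### Base change along a ring homomorphism -/

section BaseChange

variable {A B M N : Type*} [CommRing A] [CommRing B] [AddCommGroup M] [AddCommGroup N]
  [Module A M] [Module B N] {φ : A →+* B} {f : M →ₛₗ[φ] N}

theorem IsBaseChangeAlong.span_range (h : IsBaseChangeAlong φ f) :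
    Submodule.span B (Set.range f) = ⊤ := by
  let : Algebra A B := φ.toAlgebra
  let : Module A N := Module.compHom N φ
  have : IsScalarTower A B N := ⟨fun a b n => by
    change (φ a * b) • n = φ a • b • n
    rw [mul_smul]⟩
  refine Submodule.eq_top_iff'.2 fun n => ?_
  exact IsBaseChange.inductionOn h n _ (Submodule.zero_mem _)
    (fun m => Submodule.subset_span ⟨m, rfl⟩) (fun b n hn => Submodule.smul_mem _ b hn)
    (fun n₁ n₂ h₁ h₂ => Submodule.add_mem _ h₁ h₂)

theorem IsBaseChangeAlong.exists_lift (h : IsBaseChangeAlong φ f) {Q : Type*} [AddCommGroup Q]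
    [Module B Q] (g : M →ₛₗ[φ] Q) : ∃ k : N →ₗ[B] Q, ∀ m, k (f m) = g m := by
  let : Algebra A B := φ.toAlgebra
  let : Module A N := Module.compHom N φ
  have : IsScalarTower A B N := ⟨fun a b n => by
    change (φ a * b) • n = φ a • b • n
    rw [mul_smul]⟩
  let : Module A Q := Module.compHom Q φ
  have : IsScalarTower A B Q := ⟨fun a b n => by
    change (φ a * b) • n = φ a • b • n
    rw [mul_smul]⟩
  let g' : M →ₗ[A] Q := { toFun := g, map_add' := map_add g, map_smul' := map_smulₛₗ g }
  exact ⟨IsBaseChange.lift h g', fun m => IsBaseChange.lift_eq h g' m⟩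

theorem IsBaseChangeAlong.exists_dual (h : IsBaseChangeAlong φ f) (c : M →ₗ[A] A) :
    ∃ k : N →ₗ[B] B, ∀ m, k (f m) = φ (c m) :=
  h.exists_lift
    { toFun := fun m => φ (c m)
      map_add' := fun a b => by rw [map_add, map_add]
      map_smul' := fun a b => by rw [map_smul, smul_eq_mul, map_mul, smul_eq_mul] }

theorem IsBaseChangeAlong.hom_ext (h : IsBaseChangeAlong φ f) {Q : Type*} [AddCommGroup Q]
    [Module B Q] {k l : N →ₗ[B] Q} (e : ∀ m, k (f m) = l (f m)) : k = l :=
  LinearMap.ext_on_range h.span_range e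

/-- An isomorphism `M ≃ M'` of `A`-modules induces an isomorphism of their base changes. -/
theorem IsBaseChangeAlong.exists_equiv {M' N' : Type*} [AddCommGroup M'] [AddCommGroup N']
    [Module A M'] [Module B N'] {f' : M' →ₛₗ[φ] N'} (h : IsBaseChangeAlong φ f)
    (h' : IsBaseChangeAlong φ f') (e : M ≃ₗ[A] M') :
    ∃ k : N ≃ₗ[B] N', ∀ m, k (f m) = f' (e m) := by
  obtain ⟨k, hk⟩ := h.exists_lift (f'.comp e.toLinearMap)
  obtain ⟨l, hl⟩ := h'.exists_lift (f.comp e.symm.toLinearMap)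
  refine ⟨LinearEquiv.ofLinearMap k l (h'.hom_ext fun m => ?_) (h.hom_ext fun m => ?_), hk⟩
  · simp [hk, hl]
  · simp [hk, hl]

end BaseChange

/-- An element of a finite projective module is divisible by `a` if all its coordinates are. -/
theorem exists_eq_smul_of_forall_dual {A M : Type*} [CommRing A] [AddCommGroup M] [Module A M]
    [Module.Finite A M] [Module.Projective A M] (a : A) (m : M)
    (h : ∀ c : M →ₗ[A] A, a ∣ c m) : ∃ m', m = a • m' := by
  obtain ⟨n, f, g, -, -, hfg⟩ := Module.Finite.exists_comp_eq_id_of_projective A M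
  choose b hb using fun i => h ((LinearMap.proj i).comp g)
  refine ⟨f b, ?_⟩
  rw [← map_smul]
  have : g m = a • b := funext fun i => hb i
  rw [← this]
  exact (LinearMap.congr_fun hfg m).symm

theorem isUnit_p_invP (B : Type u) [CommRing B] : IsUnit (p : InvP p B) := by
  simpa using IsLocalization.Away.algebraMap_isUnit (S := InvP p B) (p : B)

section InvP

variable {B : Type u} [CommRing B] {M V : Type*} [AddCommGroup M] [AddCommGroup V] [Module B M]
  [Module (InvP p B) V] {ι : M →ₛₗ[algebraMap B (InvP p B)] V}

theorem IsBaseChangeAlong.exists_pow_smul (h : IsBaseChangeAlong (algebraMap B (InvP p B)) ι)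
    (v : V) : ∃ (m : ℕ) (w : M), (p : InvP p B) ^ m • v = ι w := by
  have hv : v ∈ Submodule.span (InvP p B) (Set.range ι) := h.span_range ▸ Submodule.mem_top
  induction hv using Submodule.span_induction with
  | mem x hx =>
    obtain ⟨w, rfl⟩ := hx
    exact ⟨0, w, by simp⟩
  | zero => exact ⟨0, 0, by simp⟩
  | add x y _ _ hx hy =>
    obtain ⟨m, w, hw⟩ := hx
    obtain ⟨m', w', hw'⟩ := hy
    refine ⟨m + m', (p : B) ^ m' • w + (p : B) ^ m • w', ?_⟩
    rw [map_add, map_smulₛₗ, map_smulₛₗ, ← hw, ← hw', map_pow, map_pow, map_natCast, smul_smul,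
      smul_smul, ← pow_add, ← pow_add, smul_add, add_comm m' m]
  | smul a x _ hx =>
    obtain ⟨m, w, hw⟩ := hx
    obtain ⟨⟨b, ⟨_, k, rfl⟩⟩, hb⟩ := IsLocalization.surj (Submonoid.powers (p : B)) a
    refine ⟨m + k, b • w, ?_⟩
    simp only [map_pow, map_natCast] at hb
    rw [map_smulₛₗ, ← hw, ← hb, smul_smul, smul_smul, pow_add]
    congr 1
    ring

theorem IsBaseChangeAlong.injective_of_torsionFree [Module.Finite B M] [Module.Projective B M]
    (h : IsBaseChangeAlong (algebraMap B (InvP p B)) ι)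
    (htf : ∀ b : B, (p : B) * b = 0 → b = 0) : Function.Injective ι := by
  have hinj : Function.Injective (algebraMap B (InvP p B)) :=
    IsLocalization.injective _ (Submonoid.powers_le.2
      (mem_nonZeroDivisors_iff_right.2 fun b hb => htf b (by rw [mul_comm]; exact hb)))
  refine (injective_iff_map_eq_zero ι).2 fun m hm => ?_
  obtain ⟨m', hm'⟩ := exists_eq_smul_of_forall_dual (0 : B) m (fun c => by
    obtain ⟨k, hk⟩ := h.exists_dual c
    have h1 : k (ι m) = algebraMap B (InvP p B) (c m) := hk m
    rw [hm, map_zero] at h1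
    rw [hinj (h1.symm.trans (map_zero _).symm)])
  rw [hm', zero_smul]

end InvP

/-! ### Crystals inside an isocrystal, object by object -/

/-- Divisibility by powers of `p` is detected by a family of homomorphisms to torsion-free rings
that detects divisibility by `p`. -/
theorem PDRing.pow_dvd_of_forall_pow_dvd {R : PDRing.{u} p} {I : Type*} {S : I → PDRing.{u} p}
    (hS : ∀ i, ∀ b : (S i).carrier, (p : (S i).carrier) * b = 0 → b = 0) {f : ∀ i, R.Hom (S i)}
    (hf : ∀ r : R.carrier, (∀ i, (p : (S i).carrier) ∣ (f i).toRingHom r) → (p : R.carrier) ∣ r)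
    (m : ℕ) (r : R.carrier) (h : ∀ i, (p : (S i).carrier) ^ m ∣ (f i).toRingHom r) :
    (p : R.carrier) ^ m ∣ r := by
  induction m generalizing r with
  | zero => simp
  | succ m ih =>
    obtain ⟨r', rfl⟩ := hf r fun i => (dvd_pow_self _ m.succ_ne_zero).trans (h i)
    rw [pow_succ']
    refine mul_dvd_mul_left _ (ih r' fun i => ?_)
    obtain ⟨c, hc⟩ := h i
    refine ⟨c, sub_eq_zero.1 (hS i _ ?_)⟩
    rw [map_mul, map_natCast] at hc
    rw [mul_sub, hc]
    ring

variable [Fact p.Prime] {X : Scheme.{u}} {E : FIsocrystal.{u} p X}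

namespace SubFCrystal

variable (L L₁ L₂ : SubFCrystal E) {R S : PDRing.{u} p}

attribute [instance] Crystal.finite Crystal.projective

/-- The value of `L₁` at an object of the site is contained in that of `L₂` (inside `E`). -/
def LeOn (R : PDRing.{u} p) (x : R.Point X) : Prop := ∀ v, ∃ w, L₂.ι R x w = L₁.ι R x v

/-- The values of `L₁` and `L₂` at an object of the site are the same inside `E`. -/
def AgreeOn (R : PDRing.{u} p) (x : R.Point X) : Prop := L₁.LeOn L₂ R x ∧ L₂.LeOn L₁ R x

variable {L₁ L₂}

/-- Torsion-freeness matters: at a general object the map to `E` need not be injective. -/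
theorem ι_injective (hR : R.TorsionFree) (x : R.Point X) : Function.Injective (L.ι R x) :=
  (L.ι_isBaseChange R x).injective_of_torsionFree hR

theorem LeOn.map {f : R.Hom S} {x : R.Point X} {y : S.Point X} (h : f.Over x y)
    (hL : L₁.LeOn L₂ R x) : L₁.LeOn L₂ S y := by
  intro v
  have hv : v ∈ Submodule.span S.carrier (Set.range (L₁.map f h)) :=
    (L₁.isBaseChange f h).span_range ▸ Submodule.mem_top
  induction hv using Submodule.span_induction with
  | mem v hv =>
    obtain ⟨m, rfl⟩ := hv
    obtain ⟨w, hw⟩ := hL m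
    exact ⟨L₂.map f h w, by rw [ι_map, ι_map, hw]⟩
  | zero => exact ⟨0, by rw [map_zero, map_zero]⟩
  | add x y _ _ hx hy =>
    obtain ⟨w, hw⟩ := hx
    obtain ⟨w', hw'⟩ := hy
    exact ⟨w + w', by rw [map_add, map_add, hw, hw']⟩
  | smul a x _ hx =>
    obtain ⟨w, hw⟩ := hx
    exact ⟨a • w, by rw [map_smulₛₗ, map_smulₛₗ, hw]⟩

theorem AgreeOn.map {f : R.Hom S} {x : R.Point X} {y : S.Point X} (h : f.Over x y)
    (hL : L₁.AgreeOn L₂ R x) : L₁.AgreeOn L₂ S y := ⟨hL.1.map h, hL.2.map h⟩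

/-- Inclusions descend along families of homomorphisms to `p`-torsion-free objects that jointly
detect divisibility by `p`. -/
theorem LeOn.of_forall {I : Type*} {S : I → PDRing.{u} p}
    (hS : ∀ i, (S i).TorsionFree) {f : ∀ i, R.Hom (S i)}
    (hf : ∀ r : R.carrier, (∀ i, (p : (S i).carrier) ∣ (f i).toRingHom r) → (p : R.carrier) ∣ r)
    {x : R.Point X} {y : ∀ i, (S i).Point X} (h : ∀ i, (f i).Over x (y i))
    (hL : ∀ i, L₁.LeOn L₂ (S i) (y i)) : L₁.LeOn L₂ R x := by
  intro v
  obtain ⟨m, w, hw⟩ := (L₂.ι_isBaseChange R x).exists_pow_smul (L₁.ι R x v)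
  obtain ⟨w', rfl⟩ := exists_eq_smul_of_forall_dual ((p : R.carrier) ^ m) w (fun c => by
    refine PDRing.pow_dvd_of_forall_pow_dvd hS hf m _ fun i => ?_
    obtain ⟨w', hw'⟩ := hL i (L₁.map (f i) (h i) v)
    have e : L₂.map (f i) (h i) w = (p : (S i).carrier) ^ m • w' := by
      apply L₂.ι_injective (hS i)
      rw [ι_map, ← hw, map_smulₛₗ, map_smulₛₗ, hw', ι_map]
      simp
    obtain ⟨k, hk⟩ := (L₂.isBaseChange (f i) (h i)).exists_dual c
    have h1 : k (L₂.map (f i) (h i) w) = (f i).toRingHom (c w) := hk w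
    rw [← h1, e, map_smul]
    exact ⟨_, rfl⟩)
  refine ⟨w', ?_⟩
  rw [map_smulₛₗ, map_pow, map_natCast] at hw
  exact ((isUnit_p_invP R.carrier).pow m).smul_left_cancel.1 hw.symm

theorem AgreeOn.of_forall {I : Type*} {S : I → PDRing.{u} p}
    (hS : ∀ i, (S i).TorsionFree) {f : ∀ i, R.Hom (S i)}
    (hf : ∀ r : R.carrier, (∀ i, (p : (S i).carrier) ∣ (f i).toRingHom r) → (p : R.carrier) ∣ r)
    {x : R.Point X} {y : ∀ i, (S i).Point X} (h : ∀ i, (f i).Over x (y i))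
    (hL : ∀ i, L₁.AgreeOn L₂ (S i) (y i)) : L₁.AgreeOn L₂ R x :=
  ⟨LeOn.of_forall hS hf h fun i => (hL i).1, LeOn.of_forall hS hf h fun i => (hL i).2⟩

/-- On a `p`-torsion-free object, agreement inside `E` is the same as an isomorphism compatible
with the inclusions into `E`. -/
theorem AgreeOn.exists_equiv (hR : R.TorsionFree) {x : R.Point X} (h : L₁.AgreeOn L₂ R x) :
    ∃ e : L₁.obj R x ≃ₗ[R.carrier] L₂.obj R x, ∀ m, L₂.ι R x (e m) = L₁.ι R x m := by
  choose e he using h.1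
  choose e' he' using h.2
  have i₁ := L₁.ι_injective hR x
  have i₂ := L₂.ι_injective hR x
  exact ⟨{ toFun := e
           invFun := e'
           map_add' := fun a b => i₂ (by rw [he, map_add, map_add, he, he])
           map_smul' := fun a b => i₂ (by
            rw [he, map_smulₛₗ, RingHom.id_apply, map_smulₛₗ, he])
           left_inv := fun m => i₁ (by rw [he', he])
           right_inv := fun m => i₂ (by rw [he, he']) }, he⟩

end SubFCrystal

end

section

/-! ### Linear algebra of Frobenius matrices -/

theorem sum_eq_sum_subtype {R ι : Type*} [AddCommMonoid R] [Fintype ι] {P : ι → Prop}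
    [DecidablePred P] (f : ι → R) (h : ∀ i, ¬ P i → f i = 0) :
    ∑ i, f i = ∑ i : {i // P i}, f i := by
  rw [← Fintype.sum_subtype_add_sum_subtype P f,
    Finset.sum_eq_zero (s := Finset.univ) (f := fun i : {i // ¬ P i} => f i)
      (fun i _ => h i i.2), add_zero]

theorem pow_mul_cancel {p : ℕ} {W : Type*} [CommRing W] (htf : ∀ w : W, (p : W) * w = 0 → w = 0)
    {m : ℕ} {w w' : W} (h : (p : W) ^ m * w = (p : W) ^ m * w') : w = w' := by
  have : ∀ (m : ℕ) (w : W), (p : W) ^ m * w = 0 → w = 0 := by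
    intro m
    induction m with
    | zero => simp
    | succ m ih => exact fun w hw => htf _ (ih _ (by rw [← hw]; ring))
  exact sub_eq_zero.1 (this m _ (by rw [mul_sub, h, sub_self]))

/-- The principal block `(U i j)`, `a i ≤ c`, `a j ≤ c`, of a square matrix. -/
abbrev principalBlock {R ι : Type*} (a : ι → ℕ) (U : Matrix ι ι R) (c : ℕ) :
    Matrix {i // a i ≤ c} {i // a i ≤ c} R :=
  U.submatrix Subtype.val Subtype.val

/-- The rows `a i ≤ c` of a matrix. -/
abbrev principalRows {R ι κ : Type*} (a : ι → ℕ) (U : Matrix ι κ R) (c : ℕ) :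
    Matrix {i // a i ≤ c} κ R :=
  U.submatrix Subtype.val id

/-- The columns `a j ≤ c` of a matrix. -/
abbrev principalCols {R ι κ : Type*} (a : ι → ℕ) (U : Matrix κ ι R) (c : ℕ) :
    Matrix κ {i // a i ≤ c} R :=
  U.submatrix id Subtype.val

section Triangular

variable {k ι₁ ι₂ : Type*} [Field k] [Fintype ι₁] [Fintype ι₂] [DecidableEq ι₁] [DecidableEq ι₂]

theorem eq_zero_of_vecMul_principalBlock {a : ι₁ → ℕ}
    {U : Matrix ι₁ ι₁ k} {c : ℕ} (hU : (principalBlock a U c).det ≠ 0) {y : ι₁ → k}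
    (hy : ∀ i, c < a i → y i = 0) (h : ∀ j, a j ≤ c → ∑ i, y i * U i j = 0) : y = 0 := by
  have h1 : Matrix.vecMul (fun i : {i // a i ≤ c} => y i) (principalBlock a U c) = 0 := by
    refine funext fun j => ?_
    have := h j j.2
    rw [sum_eq_sum_subtype (P := fun i => a i ≤ c) _
      (fun i hi => by rw [hy i (not_le.1 hi), zero_mul])] at this
    exact this
  have h2 := Matrix.eq_zero_of_vecMul_eq_zero hU h1
  refine funext fun i => ?_
  rcases le_or_gt (a i) c with hi | hi
  · exact congrFun h2 ⟨i, hi⟩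
  · exact hy i hi

theorem eq_zero_of_mulVec_principalBlock {a : ι₁ → ℕ}
    {U : Matrix ι₁ ι₁ k} {c : ℕ} (hU : (principalBlock a U c).det ≠ 0) {x : ι₁ → k}
    (hx : ∀ i, c < a i → x i = 0) (h : ∀ i, a i ≤ c → ∑ j, U i j * x j = 0) : x = 0 := by
  have hU' : (principalBlock a U.transpose c).det ≠ 0 := by
    rwa [← Matrix.det_transpose]
  refine eq_zero_of_vecMul_principalBlock hU' hx fun i hi => ?_
  rw [← h i hi]
  exact Finset.sum_congr rfl fun j _ => mul_comm _ _

/-- If `γ * U₁ = U₂ * β` with `γ` block lower triangular, `β` strictly block upper triangular and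
all principal blocks of `U₁` and `U₂` invertible, then `β = 0`. -/
theorem eq_zero_of_triangular {a₁ : ι₁ → ℕ} {a₂ : ι₂ → ℕ} {U₁ : Matrix ι₁ ι₁ k}
    {U₂ : Matrix ι₂ ι₂ k} (hU₁ : ∀ c, (principalBlock a₁ U₁ c).det ≠ 0)
    (hU₂ : ∀ c, (principalBlock a₂ U₂ c).det ≠ 0) {β γ : Matrix ι₂ ι₁ k}
    (hβ : ∀ i j, a₁ j ≤ a₂ i → β i j = 0) (hγ : ∀ i j, a₂ i < a₁ j → γ i j = 0)
    (h : γ * U₁ = U₂ * β) : β = 0 := by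
  have key : ∀ c : ℕ, (∀ i j, a₂ i < c → γ i j = 0) ∧ (∀ i j, a₁ j ≤ c → β i j = 0) := by
    intro c
    induction c with
    | zero =>
      exact ⟨fun i j hi => (Nat.not_lt_zero _ hi).elim,
        fun i j hj => hβ i j (hj.trans (Nat.zero_le _))⟩
    | succ c ih =>
      have h1 : ∀ i j, a₂ i < c + 1 → γ i j = 0 := by
        intro i j hi
        refine congrFun (eq_zero_of_vecMul_principalBlock (hU₁ c) (y := γ i)
          (fun j hj => hγ i j (by omega)) fun j hj => ?_) j
        have h2 := congrFun (congrFun h i) j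
        rw [Matrix.mul_apply, Matrix.mul_apply] at h2
        rw [h2]
        exact Finset.sum_eq_zero fun l _ => by rw [ih.2 l j hj, mul_zero]
      refine ⟨h1, fun i j hj => ?_⟩
      refine congrFun (eq_zero_of_mulVec_principalBlock (hU₂ c) (x := fun i => β i j)
          (fun i hi => hβ i j (by omega)) fun i hi => ?_) i
      have h2 := congrFun (congrFun h i) j
      rw [Matrix.mul_apply, Matrix.mul_apply] at h2
      rw [← h2]
      exact Finset.sum_eq_zero fun l _ => by rw [h1 i l (by omega), zero_mul]
  ext i j
  exact (key (a₁ j)).2 i j le_rfl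

end Triangular

theorem exists_forall_dvd {O ι : Type*} [CommRing O] [IsDomain O] [ValuationRing O]
    (s : Finset ι) (hs : s.Nonempty) (f : ι → O) : ∃ i ∈ s, ∀ j ∈ s, f i ∣ f j := by
  induction hs using Finset.Nonempty.cons_induction with
  | singleton a => exact ⟨a, by simp⟩
  | cons a s h hs ih =>
    obtain ⟨i, hi, hd⟩ := ih
    rcases ValuationRing.dvd_total (f i) (f a) with h | h
    · exact ⟨i, by simp [hi], by simpa [h] using hd⟩
    · exact ⟨a, by simp, by simpa using fun j hj => h.trans (hd j hj)⟩

/-- Let `W` be a `p`-torsion-free ring with a lift `φ` of the Frobenius of `W / p = O`, a valuation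
ring of characteristic `p` with residue field `k`. A homomorphism `β` between two Frobenius
modules with matrices `p ^ a₁ * U₁` and `p ^ a₂ * U₂`, such that all principal blocks of `U₁` and
`U₂` are invertible over `k`, vanishes modulo `p` if it vanishes in the residue field. -/
theorem map_eq_zero_of_residue {p : ℕ} [Fact p.Prime] {W O k ι₁ ι₂ : Type*} [CommRing W]
    [CommRing O] [IsDomain O] [ValuationRing O] [Field k] [Fintype ι₁] [Fintype ι₂]
    [DecidableEq ι₁] [DecidableEq ι₂] (htf : ∀ w : W, (p : W) * w = 0 → w = 0)
    (φ : W →+* W) (r : W →+* O) (hr : (p : O) = 0) (hφ : ∀ w, r (φ w) = r w ^ p)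
    (π : O →+* k) {a₁ : ι₁ → ℕ} {a₂ : ι₂ → ℕ} {U₁ V₁ : Matrix ι₁ ι₁ W} {U₂ : Matrix ι₂ ι₂ W}
    (hV : U₁ * V₁ = 1)
    (hV' : V₁ * U₁ = 1) (hU₁ : ∀ c, (principalBlock a₁ (U₁.map (π.comp r)) c).det ≠ 0)
    (hU₂ : ∀ c, (principalBlock a₂ (U₂.map (π.comp r)) c).det ≠ 0) {β : Matrix ι₂ ι₁ W}
    (h : Matrix.diagonal (fun i => (p : W) ^ a₂ i) * U₂ * β.map φ =
      β * (Matrix.diagonal (fun j => (p : W) ^ a₁ j) * U₁))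
    (h0 : ∀ i j, π (r (β i j)) = 0) (i : ι₂) (j : ι₁) : r (β i j) = 0 := by
  have hp : p.Prime := Fact.out
  have htf' := fun m w w' => pow_mul_cancel (W := W) htf (m := m) (w := w) (w' := w')
  let γ : Matrix ι₂ ι₁ W := U₂ * β.map φ * V₁
  have hγ : ∀ i j, (p : W) ^ a₂ i * γ i j = β i j * (p : W) ^ a₁ j := by
    intro i j
    have e : Matrix.diagonal (fun i => (p : W) ^ a₂ i) * γ =
        β * Matrix.diagonal (fun j => (p : W) ^ a₁ j) := by
      have : Matrix.diagonal (fun i => (p : W) ^ a₂ i) * γ =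
        (Matrix.diagonal (fun i => (p : W) ^ a₂ i) * U₂ * β.map φ) * V₁ := by
        simp only [γ, Matrix.mul_assoc]
      rw [this, h, Matrix.mul_assoc, Matrix.mul_assoc, hV, Matrix.mul_one]
    have e' := congrFun (congrFun e i) j
    rwa [Matrix.diagonal_mul, Matrix.mul_diagonal] at e'
  have g1 : ∀ i j, a₂ i < a₁ j → r (γ i j) = 0 := by
    intro i j hij
    obtain ⟨d, hd⟩ := Nat.exists_eq_add_of_lt hij
    have e : γ i j = p * (p ^ d * β i j) := htf' (a₂ i) _ _ (by rw [hγ, hd]; ring)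
    rw [e, map_mul, map_natCast, hr, zero_mul]
  have b1 : ∀ i j, a₁ j < a₂ i → r (β i j) = 0 := by
    intro i j hij
    obtain ⟨d, hd⟩ := Nat.exists_eq_add_of_lt hij
    have e : β i j = p * (p ^ d * γ i j) :=
      htf' (a₁ j) _ _ (by rw [mul_comm, ← hγ, hd]; ring)
    rw [e, map_mul, map_natCast, hr, zero_mul]
  have b2 : ∀ i j, a₁ j = a₂ i → r (β i j) = r (γ i j) := by
    intro i j hij
    rw [htf' (a₁ j) (β i j) (γ i j) (by rw [mul_comm, ← hγ, hij])]
  by_contra hne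
  -- Let `b` be an entry of `β` modulo `p` of minimal valuation. As `γ = U₂ * φ β * V₁` is divisible
  -- by `b ^ p`, the entries of `β` in the diagonal blocks, where `β = γ`, are divisible by `b ^ p`.
  -- So `β / b` is strictly block triangular over `k`, whereas the entry at `b` is `1`.
  obtain ⟨⟨i₀, j₀⟩, -, hdvd⟩ := exists_forall_dvd (Finset.univ : Finset (ι₂ × ι₁)) ⟨(i, j), by simp⟩
    (fun ij => r (β ij.1 ij.2))
  have hb0 : r (β i₀ j₀) ≠ 0 := fun h => hne (by
    have := hdvd (i, j) (by simp)
    simp only [h, zero_dvd_iff] at this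
    exact this)
  choose t ht using fun i j => hdvd (i, j) (by simp)
  simp only at ht
  set b := r (β i₀ j₀) with hb
  let T : Matrix ι₂ ι₁ O := fun i j => t i j ^ p
  let g : Matrix ι₂ ι₁ O := U₂.map r * T * V₁.map r
  have hg : ∀ i j, r (γ i j) = b ^ p * g i j := by
    intro i j
    have e : γ.map r = (b ^ p) • g := by
      have e1 : (β.map φ).map r = (b ^ p) • T := by
        ext i j
        rw [Matrix.map_apply, Matrix.map_apply, hφ, ht i j, mul_pow]
        rfl
      simp only [γ, Matrix.map_mul, e1, g, Matrix.mul_smul, Matrix.smul_mul]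
    exact congrFun (congrFun e i) j
  have hgU : g.map π * U₁.map (π.comp r) = U₂.map (π.comp r) * T.map π := by
    have e : g * U₁.map r = U₂.map r * T := by
      simp only [g]
      rw [Matrix.mul_assoc, ← Matrix.map_mul, hV', Matrix.map_one _ (map_zero r) (map_one r),
        Matrix.mul_one]
    have e' := congrArg (fun M => M.map π) e
    simp only [Matrix.map_mul] at e'
    exact e'
  have hT : T.map π = 0 := by
    refine eq_zero_of_triangular hU₁ hU₂ (fun i j hij => ?_) (fun i j hij => ?_) hgU
    · have : π (t i j) = 0 := by
        rcases hij.lt_or_eq with hij | hij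
        · have e := ht i j
          rw [b1 i j hij] at e
          rw [(mul_eq_zero.1 e.symm).resolve_left hb0, map_zero]
        · have e := b2 i j hij
          rw [ht i j, hg i j, ← Nat.succ_pred_eq_of_pos hp.pos, pow_succ', mul_assoc] at e
          rw [mul_left_cancel₀ hb0 e, map_mul, map_pow, hb, h0,
            zero_pow (by have := hp.two_le; simp only [Nat.pred_eq_sub_one]; omega), zero_mul]
      change π (t i j ^ p) = 0
      rw [map_pow, this, zero_pow hp.ne_zero]
    · have e := g1 i j hij
      rw [hg i j] at e
      change π (g i j) = 0
      rw [(mul_eq_zero.1 e).resolve_left (pow_ne_zero _ hb0), map_zero]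
  have h1 : t i₀ j₀ = 1 := by
    have := ht i₀ j₀
    rw [← hb] at this
    exact (mul_left_cancel₀ hb0 (by rw [← this, mul_one])).symm
  have h2 := congrFun (congrFun hT i₀) j₀
  have h3 : π (t i₀ j₀ ^ p) = 0 := h2
  rw [h1, one_pow, map_one] at h3
  exact one_ne_zero h3

end

section

/-! ### Splitting off elementary divisors -/

section Hodge

variable {p : ℕ} {W Wk K ι : Type*} [CommRing W] [CommRing Wk] [Field K]
  [Fintype ι] [DecidableEq ι]

/-- Let `Ȳ = H * Q` over a field, with `H` supported in the columns `a j ≤ c`, and let the principal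
block of `Ȳ` be invertible. Then the rows of `Ȳ` are determined by the rows `a i ≤ c`. -/
theorem eq_mul_of_supported_columns {a : ι → ℕ} {c : ℕ} {Y H Q : Matrix ι ι K} (h : Y = H * Q)
    (hH : ∀ i j, c < a j → H i j = 0) (hY : (principalBlock a Y c).det ≠ 0)
    (T : Matrix ι {i // a i ≤ c} K)
    (hT : T * principalBlock a Y c = principalCols a Y c) :
    Y = T * principalRows a Y c := by
  let H' : Matrix ι {i // a i ≤ c} K := principalCols a H c
  let Q' : Matrix {i // a i ≤ c} ι K := principalRows a Q c
  have e : Y = H' * Q' := by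
    rw [h]
    ext i j
    rw [Matrix.mul_apply, Matrix.mul_apply, sum_eq_sum_subtype (P := fun i => a i ≤ c) _
      (fun l hl => by rw [hH i l (not_le.1 hl), zero_mul])]
    rfl
  have e1 : principalBlock a Y c =
      principalRows a H' c * principalCols a Q' c := by
    ext i j
    exact congrFun (congrFun e i) j
  have hQ : IsUnit (principalCols a Q' c).det := by
    rw [e1, Matrix.det_mul] at hY
    exact isUnit_iff_ne_zero.2 (right_ne_zero_of_mul hY)
  have e2 : (H' - T * principalRows a H' c) * principalCols a Q' c = 0 := by
    rw [Matrix.sub_mul, Matrix.mul_assoc, ← e1, hT, sub_eq_zero]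
    ext i j
    exact (congrFun (congrFun e i) j).symm
  have e3 : H' - T * principalRows a H' c = 0 := by
    have := congrArg (fun M => M * (principalCols a Q' c)⁻¹) e2
    simpa only [Matrix.mul_assoc, Matrix.mul_nonsing_inv _ hQ, Matrix.mul_one,
      Matrix.zero_mul] using this
  have e4 : principalRows a Y c =
      principalRows a H' c * Q' := by
    ext i j
    exact congrFun (congrFun e i) j
  rw [e4, ← Matrix.mul_assoc, ← sub_eq_zero.1 e3]
  exact e

variable {WK : Type*} [CommRing WK]

/-- Let `A` be a matrix over `W` that becomes `D * U₀` over `Wk`, `D = diag (p ^ a)`, with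
invertible principal blocks of `U₀`, and that has elementary divisors `p ^ a` over `WK`. Then
`A = L * D * Y` with `L` an invertible matrix that becomes trivial over `Wk`. The powers of `p` are
split off one at a time: this is the statement with `min (a i) c` in place of `a i`. -/
theorem exists_eq_mul_diagonal_mul (htf : ∀ w : Wk, (p : Wk) * w = 0 → w = 0)
    (htfK : ∀ w : WK, (p : WK) * w = 0 → w = 0)
    (θ : W →+* Wk) [IsLocalHom θ] (hθ : Function.Surjective θ) (ψ : W →+* WK) (ρ : WK →+* K)
    (hρ : ρ p = 0) (hψ : ∀ w, ρ (ψ w) = 0 → (p : W) ∣ w)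
    {a : ι → ℕ} {A : Matrix ι ι W} {U₀ : Matrix ι ι Wk}
    (hA : A.map θ = Matrix.diagonal (fun i => (p : Wk) ^ a i) * U₀)
    (hU₀ : ∀ c, IsUnit (principalBlock a U₀ c).det) {P Q Q' : Matrix ι ι WK} (hQ : Q * Q' = 1)
    (hPQ : A.map ψ = P * Matrix.diagonal (fun i => (p : WK) ^ a i) * Q) (c : ℕ) :
    ∃ L L' Y : Matrix ι ι W, L * L' = 1 ∧ L' * L = 1 ∧ L.map θ = 1 ∧
      A = L * (Matrix.diagonal (fun i => (p : W) ^ min (a i) c) * Y) := by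
  induction c with
  | zero => exact ⟨1, 1, A, by simp, by simp, by simp, by simp⟩
  | succ c ih =>
    obtain ⟨L, L', Y, hL, hL', hLθ, hLY⟩ := ih
    -- The matrix `Y` over `Wk`.
    have hYθ : ∀ i j, θ (Y i j) = (p : Wk) ^ (a i - min (a i) c) * U₀ i j := by
      intro i j
      have e := congrArg (fun M => M.map θ) hLY
      simp only [Matrix.map_mul, hLθ, Matrix.one_mul, hA] at e
      have e' := congrFun (congrFun e i) j
      rw [Matrix.diagonal_mul, Matrix.diagonal_map (map_zero θ), Matrix.diagonal_mul] at e'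
      simp only [map_pow, map_natCast, Matrix.map_apply] at e'
      refine pow_mul_cancel htf (m := min (a i) c) ?_
      rw [← e', ← mul_assoc, ← pow_add, Nat.add_sub_cancel' (min_le_left _ _)]
    have hYJ : (principalBlock a Y c).map θ = principalBlock a U₀ c := by
      ext i j
      have := hYθ i j
      rw [min_eq_left i.2, Nat.sub_self, pow_zero, one_mul] at this
      exact this
    have hdet : IsUnit (principalBlock a Y c).det := by
      refine isUnit_of_map_unit θ _ ?_
      rw [RingHom.map_det]
      change IsUnit ((principalBlock a Y c).map θ).det
      rw [hYJ]
      exact hU₀ c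
    -- The matrix `Y` over `K`.
    have hYK : Y.map (ρ.comp ψ) = (Y.map ψ * Q').map ρ * Q.map ρ := by
      rw [← Matrix.map_mul, Matrix.mul_assoc, mul_eq_one_comm.1 hQ, Matrix.mul_one]
      rfl
    have hcol : ∀ i j, c < a j → (Y.map ψ * Q').map ρ i j = 0 := by
      intro i j hj
      have e : Matrix.diagonal (fun i => (p : WK) ^ min (a i) c) * (Y.map ψ * Q') =
          (L'.map ψ * P) * Matrix.diagonal (fun i => (p : WK) ^ a i) := by
        have e1 : Matrix.diagonal (fun i => (p : W) ^ min (a i) c) * Y = L' * A := by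
          rw [hLY, ← Matrix.mul_assoc L' L, hL', Matrix.one_mul]
        have e2 := congrArg (fun M => M.map ψ) e1
        simp only [Matrix.map_mul, hPQ, Matrix.diagonal_map (map_zero ψ), map_pow,
          map_natCast] at e2
        have e3 := congrArg (fun M => M * Q') e2
        simp only [Matrix.mul_assoc, hQ, Matrix.mul_one] at e3
        rw [Matrix.mul_assoc]
        exact e3
      have e' := congrFun (congrFun e i) j
      rw [Matrix.diagonal_mul, Matrix.mul_diagonal] at e'
      obtain ⟨d, hd⟩ := Nat.exists_eq_add_of_lt (lt_of_le_of_lt (min_le_right (a i) c) hj)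
      have : (Y.map ψ * Q') i j = p * (p ^ d * (L'.map ψ * P) i j) :=
        pow_mul_cancel htfK (m := min (a i) c) (by rw [e', hd]; ring)
      rw [Matrix.map_apply, this, map_mul, hρ, zero_mul]
    -- The rows `c < a i` of `Y` are combinations of the others modulo `p`.
    let T₀ : Matrix ι {i // a i ≤ c} W :=
      principalCols a Y c * (principalBlock a Y c)⁻¹
    have hT₀ : T₀ * principalBlock a Y c = principalCols a Y c := by
      simp only [T₀]
      rw [Matrix.mul_assoc, Matrix.nonsing_inv_mul _ hdet, Matrix.mul_one]
    have hZ : ∀ i j, (p : W) ∣ Y i j - ∑ l : {i // a i ≤ c}, T₀ i l * Y l j := by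
      intro i j
      apply hψ
      have e := eq_mul_of_supported_columns hYK hcol (by
        have : principalBlock a (Y.map (ρ.comp ψ)) c =
          (principalBlock a Y c).map (ρ.comp ψ) := rfl
        rw [this]
        have h2 := RingHom.map_det (ρ.comp ψ) (principalBlock a Y c)
        rw [RingHom.mapMatrix_apply] at h2
        rw [← h2]
        exact (hdet.map (ρ.comp ψ)).ne_zero) (T₀.map (ρ.comp ψ)) (by
          have := congrArg (fun M => M.map (ρ.comp ψ)) hT₀
          simp only [Matrix.map_mul] at this
          exact this)
      have e' := congrFun (congrFun e i) j
      rw [Matrix.mul_apply] at e'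
      rw [map_sub, map_sub, sub_eq_zero, map_sum, map_sum]
      refine e'.trans (Finset.sum_congr rfl fun l _ => ?_)
      rw [map_mul, map_mul]
      rfl
    have hT : ∀ i l, ∃ t : W, c < a i → θ t = 0 ∧ (p : W) ∣ T₀ i l - t := by
      intro i l
      by_cases hi : c < a i
      swap
      · exact ⟨0, fun h => (hi h).elim⟩
      have hd : (p : Wk) ∣ θ (T₀ i l) := by
        simp only [T₀]
        rw [Matrix.mul_apply, map_sum]
        refine Finset.dvd_sum fun j _ => ?_
        rw [map_mul]
        refine Dvd.dvd.mul_right ?_ _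
        change (p : Wk) ∣ θ (Y i j)
        rw [hYθ]
        exact Dvd.dvd.mul_right (dvd_pow_self _ (by omega)) _
      obtain ⟨s, hs⟩ := hd
      obtain ⟨s', rfl⟩ := hθ s
      refine ⟨T₀ i l - p * s', fun _ => ⟨?_, ⟨s', by ring⟩⟩⟩
      rw [map_sub, hs, map_mul, map_natCast, sub_self]
    choose T hT using hT
    have hY₁ : ∀ i j, ∃ y : W, c < a i →
        (p : W) * y = Y i j - ∑ l : {i // a i ≤ c}, T i l * Y l j := by
      intro i j
      by_cases hi : c < a i
      swap
      · exact ⟨0, fun h => (hi h).elim⟩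
      have : (p : W) ∣ Y i j - ∑ l : {i // a i ≤ c}, T i l * Y l j := by
        have e : Y i j - ∑ l : {i // a i ≤ c}, T i l * Y l j =
            (Y i j - ∑ l : {i // a i ≤ c}, T₀ i l * Y l j) +
              ∑ l : {i // a i ≤ c}, (T₀ i l - T i l) * Y l j := by
          simp only [sub_mul, Finset.sum_sub_distrib]
          ring
        rw [e]
        exact dvd_add (hZ i j) (Finset.dvd_sum fun l _ => Dvd.dvd.mul_right ((hT i l hi).2) _)
      obtain ⟨y, hy⟩ := this
      exact ⟨y, fun _ => hy.symm⟩
    choose y hy using hY₁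
    -- The row operation that makes the rows `c < a i` divisible by `p`; it is trivial over `Wk`.
    let N : Matrix ι ι W := fun i j =>
      if h : a j ≤ c ∧ c < a i then T i ⟨j, h.1⟩ * p ^ (c - a j) else 0
    have hN0 : N * N = 0 := by
      ext i j
      rw [Matrix.mul_apply]
      refine Finset.sum_eq_zero fun l _ => ?_
      simp only [N]
      rcases le_or_gt (a l) c with hl | hl
      · rw [dif_neg (c := a j ≤ c ∧ c < a l) (by omega), mul_zero]
      · rw [dif_neg (c := a l ≤ c ∧ c < a i) (by omega), zero_mul]
    have hNθ : N.map θ = 0 := by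
      ext i j
      rw [Matrix.map_apply, Matrix.zero_apply]
      simp only [N]
      split_ifs with h
      · rw [map_mul, (hT i ⟨j, h.1⟩ h.2).1, zero_mul]
      · exact map_zero θ
    let Y₁ : Matrix ι ι W := fun i j => if c < a i then y i j else Y i j
    have hrow : Matrix.diagonal (fun i => (p : W) ^ min (a i) (c + 1)) * Y₁ =
        (1 - N) * (Matrix.diagonal (fun i => (p : W) ^ min (a i) c) * Y) := by
      ext i j
      rw [Matrix.diagonal_mul, Matrix.sub_mul, Matrix.one_mul, Matrix.sub_apply,
        Matrix.diagonal_mul, Matrix.mul_apply]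
      simp only [Matrix.diagonal_mul, Y₁]
      split_ifs with hi
      · rw [min_eq_right hi.le, min_eq_right (by omega : c + 1 ≤ a i), pow_succ, mul_assoc,
          hy i j hi, mul_sub, sum_eq_sum_subtype (P := fun i => a i ≤ c), Finset.mul_sum]
        · congr 1
          refine Finset.sum_congr rfl fun l _ => ?_
          simp only [N]
          rw [dif_pos ⟨l.2, hi⟩, min_eq_left l.2]
          have : (p : W) ^ c = p ^ (c - a l) * p ^ a l := by
            rw [← pow_add, Nat.sub_add_cancel l.2]
          rw [this]
          ring
        · intro l hl
          simp only [N]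
          rw [dif_neg (by omega), zero_mul]
      · rw [Finset.sum_eq_zero, sub_zero, min_eq_left (by omega : a i ≤ c + 1),
          min_eq_left (by omega : a i ≤ c)]
        intro l _
        simp only [N]
        rw [dif_neg (by omega), zero_mul]
    have h1 : (1 + N) * (1 - N) = 1 := by
      rw [Matrix.add_mul, Matrix.one_mul, Matrix.mul_sub, Matrix.mul_one, hN0]
      abel
    have h2 : (1 - N) * (1 + N) = 1 := by
      rw [Matrix.sub_mul, Matrix.one_mul, Matrix.mul_add, Matrix.mul_one, hN0]
      abel
    refine ⟨L * (1 + N), (1 - N) * L', Y₁, ?_, ?_, ?_, ?_⟩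
    · rw [Matrix.mul_assoc, ← Matrix.mul_assoc (1 + N), h1, Matrix.one_mul, hL]
    · rw [Matrix.mul_assoc, ← Matrix.mul_assoc L', hL', Matrix.one_mul, h2]
    · rw [Matrix.map_mul, hLθ, Matrix.one_mul, Matrix.map_add _ (map_add θ), hNθ, add_zero,
        Matrix.map_one _ (map_zero θ) (map_one θ)]
    · rw [hrow, Matrix.mul_assoc, ← Matrix.mul_assoc (1 + N), h1, Matrix.one_mul]
      exact hLY

end Hodge

end

section

/-! ### Minors of the iterates of Frobenius -/

section Newton

/-- The Cauchy–Binet formula, before collecting equal minors. -/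
theorem det_mul_eq_sum_functions {R J ι : Type*} [CommRing R] [Fintype J] [DecidableEq J]
    [Fintype ι] (Q : Matrix J ι R) (V : Matrix ι J R) :
    (Q * V).det = ∑ K : J → ι, (∏ l, Q l (K l)) * (V.submatrix K id).det := by
  classical
  have e : (Q * V) = fun l => ∑ i, Q l i • V i := by
    ext l m
    simp [Matrix.mul_apply]
  have h1 : (Q * V).det = Matrix.detRowAlternating (fun l => ∑ i, Q l i • V i) := by
    rw [e]
    rfl
  rw [h1, ← AlternatingMap.coe_multilinearMap, MultilinearMap.map_sum]
  refine Finset.sum_congr rfl fun K _ => ?_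
  rw [MultilinearMap.map_smul_univ]
  rfl

variable {ι : Type*} [Fintype ι] [DecidableEq ι]

/-- The indices `a i ≤ c` have the least sum of values of `a` among all sets of the same size. -/
theorem sum_principal_le (a : ι → ℕ) (c : ℕ) (I : {i // a i ≤ c} → ι)
    (hI : Function.Injective I) : ∑ l : {i // a i ≤ c}, a l ≤ ∑ l, a (I l) ∧
      (∀ l, c < a (I l) → ∑ l : {i // a i ≤ c}, a l < ∑ l, a (I l)) := by
  classical
  let J : Finset ι := Finset.univ.filter fun i => a i ≤ c
  let T : Finset ι := Finset.univ.image I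
  have hT : ∑ l, a (I l) = ∑ i ∈ T, a i := (Finset.sum_image (fun _ _ _ _ h => hI h)).symm
  have hJ : ∑ l : {i // a i ≤ c}, a l = ∑ i ∈ J, a i :=
    Finset.sum_subtype_of_mem (p := fun i => a i ≤ c) a (s := J) (by simp [J]) ▸ (by
      refine Finset.sum_congr ?_ fun _ _ => rfl
      ext i
      simp [J, i.2])
  have hcard : T.card = J.card := by
    rw [Finset.card_image_of_injective _ hI, Finset.card_univ, Fintype.card_subtype]
  have h1 : ∑ i ∈ T, a i = ∑ i ∈ T \ J, a i + ∑ i ∈ T ∩ J, a i := by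
    rw [add_comm, Finset.sum_inter_add_sum_sdiff]
  have h2 : ∑ i ∈ J, a i = ∑ i ∈ J \ T, a i + ∑ i ∈ T ∩ J, a i := by
    rw [add_comm, Finset.inter_comm, Finset.sum_inter_add_sum_sdiff]
  have h3 : (T \ J).card * (c + 1) ≤ ∑ i ∈ T \ J, a i := by
    rw [← smul_eq_mul]
    refine Finset.card_nsmul_le_sum _ _ _ fun i hi => ?_
    have := (Finset.mem_sdiff.1 hi).2
    simp only [J, Finset.mem_filter, Finset.mem_univ, true_and] at this
    omega
  have h4 : ∑ i ∈ J \ T, a i ≤ (J \ T).card * c := by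
    rw [← smul_eq_mul]
    refine Finset.sum_le_card_nsmul _ _ _ fun i hi => ?_
    have := (Finset.mem_sdiff.1 hi).1
    simpa [J] using this
  have h5 : (T \ J).card = (J \ T).card := Finset.card_sdiff_comm hcard
  rw [hT, hJ, h1, h2]
  rw [← h5] at h4
  have h6 : (T \ J).card * (c + 1) = (T \ J).card * c + (T \ J).card := by ring
  refine ⟨by omega, fun l hl => ?_⟩
  have : 0 < (T \ J).card := Finset.card_pos.2 ⟨I l, by simp [T, J, hl]⟩
  omega

variable {p : ℕ} {W : Type*} [CommRing W]

/-- The minors (indexed by functions) of the columns `a j ≤ c`. -/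
def principalMinors (a : ι → ℕ) (c : ℕ) (V : Matrix ι ι W) (K : {i // a i ≤ c} → ι) : W :=
  (V.submatrix K Subtype.val).det

theorem principalMinors_eq_zero (a : ι → ℕ) (c : ℕ) (V : Matrix ι ι W) {K : {i // a i ≤ c} → ι}
    (hK : ¬ Function.Injective K) : principalMinors a c V K = 0 := by
  simp only [Function.Injective, not_forall] at hK
  obtain ⟨i, j, hij, hne⟩ := hK
  exact Matrix.det_zero_of_row_eq hne (by ext l; simp [hij])

theorem principalMinors_diagonal_mul (φ : W →+* W) (a : ι → ℕ) (c : ℕ) (U V : Matrix ι ι W)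
    (I : {i // a i ≤ c} → ι) :
    principalMinors a c (Matrix.diagonal (fun i => (p : W) ^ a i) * U * V.map φ) I =
      (p : W) ^ (∑ l, a (I l)) *
        ∑ K : {i // a i ≤ c} → ι, (∏ l, U (I l) (K l)) * φ (principalMinors a c V K) := by
  have e : (Matrix.diagonal (fun i => (p : W) ^ a i) * U * V.map φ).submatrix I
      (Subtype.val : {i // a i ≤ c} → ι) = Matrix.diagonal (fun l => (p : W) ^ a (I l)) *
        (U.submatrix I id * (V.map φ).submatrix id Subtype.val) := by
    ext l m
    rw [Matrix.diagonal_mul, Matrix.submatrix_apply, Matrix.mul_assoc, Matrix.diagonal_mul]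
    rfl
  rw [principalMinors, e, Matrix.det_mul, Matrix.det_diagonal, Finset.prod_pow_eq_pow_sum,
    det_mul_eq_sum_functions]
  congr 1
  refine Finset.sum_congr rfl fun K _ => ?_
  congr 1
  rw [principalMinors, RingHom.map_det]
  rfl

/-- Each application of `F = D * U * φ` adds at least `∑ a` to the order of the minors, and more
for those not supported on the rows `a i ≤ c`. -/
theorem pow_dvd_principalMinors_mul (φ : W →+* W) (a : ι → ℕ) (c : ℕ)
    (U V : Matrix ι ι W) (μ : ℕ) (hV : ∀ K, (p : W) ^ μ ∣ principalMinors a c V K)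
    (I : {i // a i ≤ c} → ι) :
    (p : W) ^ (μ + ∑ l : {i // a i ≤ c}, a l) ∣
        principalMinors a c (Matrix.diagonal (fun i => (p : W) ^ a i) * U * V.map φ) I ∧
      ∀ l, c < a (I l) → (p : W) ^ (μ + ∑ l : {i // a i ≤ c}, a l + 1) ∣
        principalMinors a c (Matrix.diagonal (fun i => (p : W) ^ a i) * U * V.map φ) I := by
  by_cases hI : Function.Injective I
  swap
  · rw [principalMinors_eq_zero a c _ hI]
    exact ⟨dvd_zero _, fun _ _ => dvd_zero _⟩
  have h1 : (p : W) ^ (μ + ∑ l, a (I l)) ∣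
      principalMinors a c (Matrix.diagonal (fun i => (p : W) ^ a i) * U * V.map φ) I := by
    rw [principalMinors_diagonal_mul, add_comm, pow_add]
    refine mul_dvd_mul_left _ (Finset.dvd_sum fun K _ => Dvd.dvd.mul_left ?_ _)
    have := map_dvd φ (hV K)
    rwa [map_pow, map_natCast] at this
  have h2 := sum_principal_le a c I hI
  exact ⟨(pow_dvd_pow _ (by omega)).trans h1, fun l hl =>
    (pow_dvd_pow _ (by have := h2.2 l hl; omega)).trans h1⟩

/-- If the principal block of `U` is singular modulo `p`, a further application of `F` adds
strictly more than `∑ a` to the order of the minors. -/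
theorem pow_succ_dvd_principalMinors_mul (φ : W →+* W) (a : ι → ℕ) (c : ℕ)
    (U V : Matrix ι ι W) (hU : (p : W) ∣ (principalBlock a U c).det) (μ : ℕ)
    (hV : ∀ K, (p : W) ^ μ ∣ principalMinors a c V K)
    (hV' : ∀ K l, c < a (K l) → (p : W) ^ (μ + 1) ∣ principalMinors a c V K)
    (I : {i // a i ≤ c} → ι) :
    (p : W) ^ (μ + ∑ l : {i // a i ≤ c}, a l + 1) ∣
      principalMinors a c (Matrix.diagonal (fun i => (p : W) ^ a i) * U * V.map φ) I := by
  classical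
  by_cases hI : Function.Injective I
  swap
  · rw [principalMinors_eq_zero a c _ hI]
    exact dvd_zero _
  by_cases hl : ∃ l, c < a (I l)
  · obtain ⟨l, hl⟩ := hl
    exact (pow_dvd_principalMinors_mul φ a c U V μ hV I).2 l hl
  push Not at hl
  -- `I` is a permutation of the set `a i ≤ c`.
  let σ' : {i // a i ≤ c} → {i // a i ≤ c} := fun l => ⟨I l, hl l⟩
  have hσ' : Function.Injective σ' := fun l m h => hI (congrArg Subtype.val h)
  let σ : Equiv.Perm {i // a i ≤ c} := Equiv.ofBijective σ' (Finite.injective_iff_bijective.1 hσ')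
  have hsum : ∑ l, a (I l) = ∑ l : {i // a i ≤ c}, a l := Equiv.sum_comp σ (fun l => a l)
  rw [principalMinors_diagonal_mul, hsum, add_right_comm, add_comm, pow_add]
  refine mul_dvd_mul_left _ ?_
  -- The terms of the sum with values in `a i ≤ c` form the determinant of a product.
  have hsplit : ∑ K : {i // a i ≤ c} → ι, (∏ l, U (I l) (K l)) * φ (principalMinors a c V K) =
      (∑ K : {i // a i ≤ c} → {i // a i ≤ c},
        (∏ l, U (I l) (K l)) * φ (principalMinors a c V fun l => K l)) +
      ∑ K ∈ (Finset.univ : Finset ({i // a i ≤ c} → ι)).filter (fun K => ∃ l, c < a (K l)),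
        (∏ l, U (I l) (K l)) * φ (principalMinors a c V K) := by
    rw [add_comm, ← Finset.sum_filter_add_sum_filter_not Finset.univ (fun K => ∃ l, c < a (K l))]
    congr 1
    symm
    refine Finset.sum_bij (fun K _ l => (K l : ι)) (fun K _ => ?_) (fun K _ K' _ h => ?_)
      (fun K hK => ?_) (fun _ _ => rfl)
    · simp only [Finset.mem_filter, Finset.mem_univ, true_and, not_exists, not_lt]
      exact fun l => (K l).2
    · exact funext fun l => Subtype.ext (congrFun h l)
    · simp only [Finset.mem_filter, Finset.mem_univ, true_and, not_exists, not_lt] at hK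
      exact ⟨fun l => ⟨K l, hK l⟩, Finset.mem_univ _, rfl⟩
  rw [hsplit]
  refine dvd_add ?_ (Finset.dvd_sum fun K hK => ?_)
  · have e : (∑ K : {i // a i ≤ c} → {i // a i ≤ c},
        (∏ l, U (I l) (K l)) * φ (principalMinors a c V fun l => K l)) =
          (((principalBlock a U c).submatrix σ id) *
            (principalBlock a V c).map φ).det := by
      rw [det_mul_eq_sum_functions]
      refine Finset.sum_congr rfl fun K _ => ?_
      congr 1
      rw [principalMinors, RingHom.map_det]
      rfl
    rw [e, Matrix.det_mul, Matrix.det_permute, pow_succ']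
    refine mul_dvd_mul (Dvd.dvd.mul_left hU _) ?_
    have := map_dvd φ (hV Subtype.val)
    rwa [map_pow, map_natCast, principalMinors, RingHom.map_det] at this
  · obtain ⟨l, hl⟩ := (Finset.mem_filter.1 hK).2
    have := map_dvd φ (hV' K l hl)
    rw [map_pow, map_natCast] at this
    exact Dvd.dvd.mul_left this _

/-- If the slopes `a` of the Newton polygon of the Frobenius module with matrix `D * U`,
`D = diag (p ^ a)`, are those of its Hodge polygon, the principal blocks of `U` are invertible
modulo `p`. Here `V t` is the matrix of the images under `F ^ t` of a basis of eigenvectors of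
`F ^ s` (up to isogeny). If a block were singular, two applications of `F` would increase the order
of the minors of its columns by more than twice the sum `S` of its slopes, whereas `F ^ s` increases it
by exactly `s * S`. -/
theorem not_dvd_det_principalBlock [IsDomain W] (hp : (p : W) ≠ 0)
    (hsep : ∀ w : W, (∀ n : ℕ, (p : W) ^ n ∣ w) → w = 0)
    (φ : W →+* W) (a : ι → ℕ) (U : Matrix ι ι W) (V : ℕ → Matrix ι ι W)
    (hV : ∀ t, V (t + 1) = Matrix.diagonal (fun i => (p : W) ^ a i) * U * (V t).map φ)
    (hdet : (V 0).det ≠ 0) {s : ℕ} (hs : 0 < s)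
    (hVs : V s = V 0 * Matrix.diagonal (fun j => (p : W) ^ (s * a j))) (c : ℕ) :
    ¬ (p : W) ∣ (principalBlock a U c).det := by
  classical
  intro hU
  set S := ∑ l : {i // a i ≤ c}, a l with hS
  -- Some minor does not vanish.
  have hne : ∃ K, principalMinors a c (V 0) K ≠ 0 := by
    by_contra hall
    push Not at hall
    have e : ((V 0).adjugate.submatrix (Subtype.val : {i // a i ≤ c} → ι) id *
        (V 0).submatrix id Subtype.val).det = (V 0).det ^ Fintype.card {i // a i ≤ c} := by
      have : (V 0).adjugate.submatrix (Subtype.val : {i // a i ≤ c} → ι) id *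
          (V 0).submatrix id Subtype.val = Matrix.diagonal fun _ => (V 0).det := by
        ext i j
        have h := congrFun (congrFun (V 0).adjugate_mul i) j
        refine Eq.trans ?_ (h.trans ?_)
        · rfl
        · rw [Matrix.smul_apply, Matrix.one_apply, Matrix.diagonal_apply]
          simp [Subtype.ext_iff]
      rw [this, Matrix.det_diagonal, Finset.prod_const, Finset.card_univ]
    rw [det_mul_eq_sum_functions, Finset.sum_eq_zero] at e
    · exact pow_ne_zero _ hdet e.symm
    · intro K _
      have := hall K
      rw [principalMinors] at this
      rw [Matrix.submatrix_submatrix]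
      change _ * ((V 0).submatrix K Subtype.val).det = 0
      rw [this, mul_zero]
  obtain ⟨K₀, hK₀⟩ := hne
  have hex : ∃ n, ¬ ∀ K, (p : W) ^ n ∣ principalMinors a c (V 0) K := by
    by_contra h
    push Not at h
    exact hK₀ (hsep _ fun n => h n K₀)
  -- The order `μ` of the minors of `V 0`.
  obtain ⟨μ, hμ, hμ'⟩ : ∃ μ, (∀ K, (p : W) ^ μ ∣ principalMinors a c (V 0) K) ∧
      ¬ ∀ K, (p : W) ^ (μ + 1) ∣ principalMinors a c (V 0) K := by
    have h0 : Nat.find hex ≠ 0 := fun h => by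
      have := Nat.find_spec hex
      rw [h] at this
      exact this fun K => by simp
    obtain ⟨μ, hμ⟩ := Nat.exists_eq_succ_of_ne_zero h0
    exact ⟨μ, not_not.1 (Nat.find_min hex (by omega)), by
      have := Nat.find_spec hex
      rwa [hμ] at this⟩
  have hlow : ∀ t, ∀ K, (p : W) ^ (μ + (t + 2) * S + 1) ∣ principalMinors a c (V (t + 2)) K := by
    intro t
    induction t with
    | zero =>
      intro K
      have h1 := pow_dvd_principalMinors_mul φ a c U (V 0) μ hμ
      rw [← hV] at h1
      have h2 := pow_succ_dvd_principalMinors_mul φ a c U (V 1) hU _ (fun K => (h1 K).1)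
        (fun K l hl => (h1 K).2 l hl) K
      rw [← hV] at h2
      convert h2 using 2
      rw [← hS]
      ring
    | succ t ih =>
      intro K
      have h1 := (pow_dvd_principalMinors_mul φ a c U (V (t + 2)) _ ih K).1
      rw [← hV] at h1
      convert h1 using 2
      rw [← hS]
      ring
  -- The iterates are periodic up to powers of `p`.
  have hper : ∀ t, V (t + s) = V t * Matrix.diagonal (fun j => (p : W) ^ (s * a j)) := by
    intro t
    induction t with
    | zero => rw [zero_add, hVs]
    | succ t ih =>
      rw [add_right_comm, hV, ih, Matrix.map_mul, Matrix.diagonal_map (map_zero φ), hV t,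
        Matrix.mul_assoc, Matrix.mul_assoc, Matrix.mul_assoc]
      simp only [map_pow, map_natCast]
  have hmin : ∀ t K, principalMinors a c (V (t + s)) K =
      (p : W) ^ (s * S) * principalMinors a c (V t) K := by
    intro t K
    have e : (V (t + s)).submatrix K (Subtype.val : {i // a i ≤ c} → ι) =
        (V t).submatrix K Subtype.val *
          Matrix.diagonal (fun j : {i // a i ≤ c} => (p : W) ^ (s * a j)) := by
      ext i j
      rw [hper, Matrix.submatrix_apply, Matrix.mul_diagonal, Matrix.mul_diagonal]
      rfl
    rw [principalMinors, e, Matrix.det_mul, Matrix.det_diagonal, Finset.prod_pow_eq_pow_sum,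
      ← Finset.mul_sum, ← hS, mul_comm]
    rfl
  -- Applying `F ^ s` twice involves at least two applications of `F`.
  refine hμ' fun K => ?_
  have h1 := hlow (s - 1 + (s - 1)) K
  have e1 : s - 1 + (s - 1) + 2 = 0 + s + s := by omega
  rw [e1, hmin, hmin, ← mul_assoc, ← pow_add] at h1
  have e2 : μ + (0 + s + s) * S + 1 = (s * S + s * S) + (μ + 1) := by ring
  rw [e2, pow_add] at h1
  exact (mul_dvd_mul_iff_left (pow_ne_zero _ hp)).1 h1

end Newton

end

section

/-! ### Semilinear maps, bases and matrices -/

variable {p : ℕ}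

theorem toMatrix_comp_semilinear {A B M N ι κ ν : Type*} [CommRing A] [CommRing B]
    [AddCommGroup M] [AddCommGroup N] [Module A M] [Module B N] [Fintype ι] {φ : A →+* B}
    (f : M →ₛₗ[φ] N) (b : Module.Basis ι A M) (c : Module.Basis κ B N) (v : ν → M) :
    c.toMatrix (f ∘ v) = c.toMatrix (f ∘ b) * (b.toMatrix v).map φ := by
  ext i j
  rw [Matrix.mul_apply, Module.Basis.toMatrix_apply, Function.comp_apply]
  conv_lhs => rw [← b.sum_repr (v j), map_sum, map_sum, Finsupp.finsetSum_apply]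
  refine Finset.sum_congr rfl fun l _ => ?_
  rw [map_smulₛₗ, map_smul, Finsupp.smul_apply, smul_eq_mul, mul_comm]
  rfl

theorem toMatrix_comp_of_basis {A B M N ι ν : Type*} [CommRing A] [CommRing B]
    [AddCommGroup M] [AddCommGroup N] [Module A M] [Module B N] [Fintype ι] [DecidableEq ι]
    {φ : A →+* B} (f : M →ₛₗ[φ] N) (b : Module.Basis ι A M) (c : Module.Basis ι B N)
    (h : ∀ i, c i = f (b i)) (v : ν → M) : c.toMatrix (f ∘ v) = (b.toMatrix v).map φ := by
  have e : (f ∘ b : ι → N) = c := funext fun i => (h i).symm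
  rw [toMatrix_comp_semilinear f b c v, e, Module.Basis.toMatrix_self, Matrix.one_mul]

theorem IsBaseChangeAlong.exists_basis {A B M N ι : Type*} [CommRing A] [CommRing B]
    [AddCommGroup M] [AddCommGroup N] [Module A M] [Module B N] {φ : A →+* B} {f : M →ₛₗ[φ] N}
    (h : IsBaseChangeAlong φ f) (b : Module.Basis ι A M) :
    ∃ c : Module.Basis ι B N, ∀ i, c i = f (b i) := by
  let : Algebra A B := φ.toAlgebra
  let : Module A N := Module.compHom N φ
  have : IsScalarTower A B N := ⟨fun a b n => by
    change (φ a * b) • n = φ a • b • n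
    rw [mul_smul]⟩
  exact ⟨IsBaseChange.basis b h, fun i => IsBaseChange.basis_apply b h i⟩

/-- Any family of vectors whose matrix in a basis is invertible is a basis. -/
theorem exists_basis_of_isUnit_det {A M ι : Type*} [CommRing A] [AddCommGroup M] [Module A M]
    [Fintype ι] [DecidableEq ι] (b : Module.Basis ι A M) (v : ι → M)
    (h : IsUnit (b.toMatrix v).det) : ∃ c : Module.Basis ι A M, ⇑c = v := by
  obtain ⟨h1, h2⟩ := b.is_basis_iff_det.2 h
  exact ⟨Module.Basis.mk h1 h2.ge, Module.Basis.coe_mk _ _⟩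

theorem exists_inverse_of_isUnit_det {A ι : Type*} [CommRing A] [Fintype ι] [DecidableEq ι]
    {U : Matrix ι ι A} (h : IsUnit U.det) : ∃ V, U * V = 1 ∧ V * U = 1 :=
  ⟨U⁻¹, U.mul_nonsing_inv h, U.nonsing_inv_mul h⟩

theorem isUnit_det_of_mul_eq_one {A ι : Type*} [CommRing A] [Fintype ι] [DecidableEq ι]
    {U V : Matrix ι ι A} (h : U * V = 1) : IsUnit U.det :=
  (Matrix.isUnit_iff_isUnit_det U).1 (IsUnit.of_mul_eq_one V h)

/-- In the basis `m`, the matrix of the semilinear endomorphism `F` is `diag (p ^ a) * U`, with `U`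
invertible. -/
def HasSplitBasis {W M : Type*} [CommRing W] [AddCommGroup M] [Module W M] {φ : W →+* W}
    (p : ℕ) (F : M →ₛₗ[φ] M) {ι : Type*} [Fintype ι] [DecidableEq ι] (a : ι → ℕ)
    (U : Matrix ι ι W) (m : Module.Basis ι W M) : Prop :=
  IsUnit U.det ∧ m.toMatrix (F ∘ m) = Matrix.diagonal (fun i => (p : W) ^ a i) * U

/-- Bases `e`, `f` with `F (e i) = p ^ a i • f i` show that the matrix of `F` is `D * U` in the
basis `f`. -/
theorem hasSplitBasis_of_hodge {W M ι : Type*} [CommRing W] [AddCommGroup M] [Module W M]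
    {φ : W →+* W} {F : M →ₛₗ[φ] M} [Fintype ι] [DecidableEq ι] {a : ι → ℕ}
    (e f : Module.Basis ι W M) (h : ∀ i, F (e i) = (p : W) ^ a i • f i) :
    HasSplitBasis p F a ((e.toMatrix f).map φ) f := by
  refine ⟨?_, ?_⟩
  · have h1 := isUnit_det_of_mul_eq_one (e.toMatrix_mul_toMatrix_flip f)
    rw [show ((e.toMatrix f).map φ).det = φ (e.toMatrix f).det from (RingHom.map_det φ _).symm]
    exact h1.map φ
  · rw [toMatrix_comp_semilinear F e f]
    congr 1
    ext i j
    rw [Module.Basis.toMatrix_apply, Function.comp_apply, h, map_smul, Module.Basis.repr_self,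
      Matrix.diagonal_apply]
    by_cases hij : i = j <;> simp [hij]

/-- The principal blocks of `U` are invertible modulo `p` if the slopes of the isocrystal are also
`a`. -/
theorem HasSplitBasis.not_dvd_det {W : Type u} {M V ι : Type*} [CommRing W] [IsDomain W]
    [AddCommGroup M] [Module W M] [AddCommGroup V] [Module (InvP p W) V] [Module.Finite W M]
    [Module.Projective W M] (hp : (p : W) ≠ 0)
    (hsep : ∀ w : W, (∀ n : ℕ, (p : W) ^ n ∣ w) → w = 0) {φ : W →+* W} {F : M →ₛₗ[φ] M}
    {G : V →ₛₗ[InvP.map p φ] V} {i : M →ₛₗ[algebraMap W (InvP p W)] V}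
    (hi : IsBaseChangeAlong (algebraMap W (InvP p W)) i) (hG : ∀ m, i (F m) = G (i m))
    [Fintype ι] [DecidableEq ι] {a : ι → ℕ} {U : Matrix ι ι W} {m : Module.Basis ι W M}
    (h : HasSplitBasis p F a U m) {s : ℕ} (hs : 0 < s) (ε : Module.Basis ι (InvP p W) V)
    (hε : ∀ j, G^[s] (ε j) = (p : InvP p W) ^ (s * a j) • ε j) (c : ℕ) :
    ¬ (p : W) ∣ (principalBlock a U c).det := by
  have htf : ∀ b : W, (p : W) * b = 0 → b = 0 := fun b hb =>
    (mul_eq_zero.1 hb).resolve_left hp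
  have hinj : Function.Injective i := hi.injective_of_torsionFree htf
  choose k v hv using fun j => hi.exists_pow_smul (ε j)
  have hGs : ∀ (t : ℕ) (w : M), i (F^[t] w) = G^[t] (i w) := by
    intro t
    induction t with
    | zero => intro w; rfl
    | succ t ih => intro w; rw [Function.iterate_succ_apply, Function.iterate_succ_apply, ih, hG]
  have hGp : ∀ (t : ℕ) (l : ℕ) (x : V), G^[t] ((p : InvP p W) ^ l • x) =
      (p : InvP p W) ^ l • G^[t] x := by
    intro t
    induction t with
    | zero => intro l x; rfl
    | succ t ih =>
      intro l x
      rw [Function.iterate_succ_apply, Function.iterate_succ_apply, map_smulₛₗ, map_pow,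
        map_natCast, ih]
  have hFs : ∀ j, F^[s] (v j) = (p : W) ^ (s * a j) • v j := by
    intro j
    apply hinj
    rw [hGs, ← hv, hGp, hε, map_smulₛₗ, ← hv, map_pow, map_natCast, smul_smul, smul_smul, mul_comm]
  have hli : LinearIndependent W v := by
    rw [Fintype.linearIndependent_iff]
    intro g hg j
    have h1 : ∑ j, (algebraMap W (InvP p W) (g j) * (p : InvP p W) ^ k j) • ε j = 0 := by
      rw [← map_zero i, ← hg, map_sum]
      refine Finset.sum_congr rfl fun j _ => ?_
      rw [map_smulₛₗ, ← hv, mul_smul]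
    have h2 := Fintype.linearIndependent_iff.1 ε.linearIndependent _ h1 j
    have h3 := (((isUnit_p_invP (p := p) W).pow (k j)).mul_left_eq_zero).1 h2
    have hi' : Function.Injective (algebraMap W (InvP p W)) :=
      IsLocalization.injective _ (Submonoid.powers_le.2 (mem_nonZeroDivisors_of_ne_zero hp))
    exact hi' (h3.trans (map_zero _).symm)
  refine not_dvd_det_principalBlock hp hsep φ a U (fun t => m.toMatrix (F^[t] ∘ v)) (fun t => ?_)
    ?_ hs ?_ c
  · rw [← h.2]
    have e : (F^[t + 1] ∘ v) = F ∘ (F^[t] ∘ v) := funext fun j =>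
      Function.iterate_succ_apply' F t (v j)
    rw [e, toMatrix_comp_semilinear F m m]
  · have e : LinearIndependent W (m.toMatrix v).col :=
      LinearIndependent.map' hli m.equivFun.toLinearMap m.equivFun.ker
    intro h0
    obtain ⟨x, hx, hx'⟩ := Matrix.exists_mulVec_eq_zero_iff.2 h0
    exact hx (Matrix.mulVec_injective_iff.2 e (hx'.trans (Matrix.mulVec_zero _).symm))
  · ext i j
    rw [Matrix.mul_diagonal]
    simp only [Module.Basis.toMatrix_apply, Function.comp_apply, hFs, map_smul,
      Finsupp.smul_apply, smul_eq_mul, Function.iterate_zero, id]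
    rw [mul_comm]

/-- Specialization and generization of bases adapted to the Hodge filtration: if `F` has the matrix
`D * U₀` over `Wk`, with invertible principal blocks of `U₀`, and elementary divisors `D` over
`WK`, then it has a matrix `D * U` over the local ring `W`, with `U` lifting `U₀`. -/
theorem exists_hasSplitBasis {W Wk WK K M Mk MK ι : Type*} [CommRing W] [IsLocalRing W]
    [CommRing Wk] [Nontrivial Wk] [CommRing WK] [Field K] [AddCommGroup M] [Module W M]
    [Module.Finite W M] [Module.Projective W M] [AddCommGroup Mk] [Module Wk Mk] [AddCommGroup MK]
    [Module WK MK] (htf : ∀ w : Wk, (p : Wk) * w = 0 → w = 0)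
    (htfK : ∀ w : WK, (p : WK) * w = 0 → w = 0)
    {θ : W →+* Wk} [IsLocalHom θ] (hθ : Function.Surjective θ) {ψ : W →+* WK} (ρ : WK →+* K)
    (hρ : ρ p = 0) (hψ : ∀ w, ρ (ψ w) = 0 → (p : W) ∣ w)
    {φ : W →+* W} {φk : Wk →+* Wk} {φK : WK →+* WK} (hφ : ∀ w, θ (φ w) = φk (θ w))
    {F : M →ₛₗ[φ] M} {Fk : Mk →ₛₗ[φk] Mk}
    {FK : MK →ₛₗ[φK] MK} {u : M →ₛₗ[θ] Mk} (hu : IsBaseChangeAlong θ u)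
    (huF : ∀ m, u (F m) = Fk (u m)) {v : M →ₛₗ[ψ] MK} (hv : IsBaseChangeAlong ψ v)
    (hvF : ∀ m, v (F m) = FK (v m)) [Fintype ι] [DecidableEq ι] {a : ι → ℕ} {U₀ : Matrix ι ι Wk}
    {mk : Module.Basis ι Wk Mk} (hmk : HasSplitBasis p Fk a U₀ mk)
    (hU₀ : ∀ c, IsUnit (principalBlock a U₀ c).det) (e f : Module.Basis ι WK MK)
    (hef : ∀ i, FK (e i) = (p : WK) ^ a i • f i) :
    ∃ (m : Module.Basis ι W M) (U : Matrix ι ι W),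
      HasSplitBasis p F a U m ∧ U.map θ = U₀ := by
  have husurj : Function.Surjective u := fun n => by
    have hn : n ∈ Submodule.span Wk (Set.range u) := hu.span_range ▸ Submodule.mem_top
    induction hn using Submodule.span_induction with
    | mem n hn => exact hn
    | zero => exact ⟨0, map_zero u⟩
    | add x y _ _ hx hy =>
      obtain ⟨x, rfl⟩ := hx
      obtain ⟨y, rfl⟩ := hy
      exact ⟨x + y, map_add u x y⟩
    | smul b x _ hx =>
      obtain ⟨x, rfl⟩ := hx
      obtain ⟨b, rfl⟩ := hθ b
      exact ⟨b • x, map_smulₛₗ u b x⟩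
  have : Module.Free W M := Module.free_of_flat_of_isLocalRing
  obtain ⟨bk₀, -⟩ := hu.exists_basis (Module.Free.chooseBasis W M)
  obtain ⟨bk, hbk⟩ := hu.exists_basis
    ((Module.Free.chooseBasis W M).reindex (bk₀.indexEquiv mk))
  generalize (Module.Free.chooseBasis W M).reindex (bk₀.indexEquiv mk) = b at hbk
  choose w hw using fun j => husurj (mk j)
  have hwu : IsUnit (b.toMatrix w).det := by
    refine isUnit_of_map_unit θ _ ?_
    rw [RingHom.map_det]
    have e := toMatrix_comp_of_basis u b bk hbk w
    rw [show u ∘ w = mk from funext hw] at e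
    rw [RingHom.mapMatrix_apply, ← e]
    exact isUnit_det_of_mul_eq_one (bk.toMatrix_mul_toMatrix_flip mk)
  obtain ⟨m, rfl⟩ := exists_basis_of_isUnit_det b w hwu
  have hAk : (m.toMatrix (F ∘ m)).map θ =
      Matrix.diagonal (fun i => (p : Wk) ^ a i) * U₀ := by
    rw [← hmk.2, ← toMatrix_comp_of_basis u m mk (fun i => (hw i).symm)]
    congr 1
    funext i
    simp [huF, hw]
  obtain ⟨mK, hmK⟩ := hv.exists_basis m
  have hAK : (m.toMatrix (F ∘ m)).map ψ = mK.toMatrix f *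
      Matrix.diagonal (fun i => (p : WK) ^ a i) * (e.toMatrix mK).map φK := by
    rw [← toMatrix_comp_of_basis v m mK hmK]
    have e1 : (v ∘ (F ∘ m)) = FK ∘ mK := funext fun i => by simp [hvF, hmK]
    rw [e1, toMatrix_comp_semilinear FK e mK]
    congr 1
    ext i j
    rw [Matrix.mul_diagonal, Module.Basis.toMatrix_apply, Module.Basis.toMatrix_apply,
      Function.comp_apply, hef, map_smul, Finsupp.smul_apply, smul_eq_mul, mul_comm]
  have hQ : (e.toMatrix mK).map φK * (mK.toMatrix e).map φK = 1 := by
    rw [← Matrix.map_mul, e.toMatrix_mul_toMatrix_flip mK]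
    exact Matrix.map_one _ (map_zero φK) (map_one φK)
  obtain ⟨L, L', Y, hL, hL', hL1, hA⟩ := exists_eq_mul_diagonal_mul htf htfK θ hθ ψ ρ hρ hψ hAk
    hU₀ hQ hAK (Finset.univ.sup a)
  have hD : (fun i => (p : W) ^ min (a i) (Finset.univ.sup a)) = fun i => (p : W) ^ a i :=
    funext fun i => by rw [min_eq_left (Finset.le_sup (Finset.mem_univ i))]
  rw [hD] at hA
  have hY : Y.map θ = U₀ := by
    have e1 : Matrix.diagonal (fun i => (p : Wk) ^ a i) * Y.map θ =
        Matrix.diagonal (fun i => (p : Wk) ^ a i) * U₀ := by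
      rw [← hAk, hA, Matrix.map_mul, Matrix.map_mul, hL1, Matrix.one_mul,
        Matrix.diagonal_map (map_zero θ)]
      simp [map_pow]
    ext i j
    have e2 := congrFun (congrFun e1 i) j
    rw [Matrix.diagonal_mul, Matrix.diagonal_mul] at e2
    exact pow_mul_cancel htf e2
  have hLm : m.toMatrix (fun j => ∑ i, L i j • m i) = L := by
    ext i j
    rw [Module.Basis.toMatrix_apply, m.repr_sum_self fun i => L i j]
  obtain ⟨m', hm'⟩ := exists_basis_of_isUnit_det m (fun j => ∑ i, L i j • m i) (by
    rw [hLm]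
    exact isUnit_det_of_mul_eq_one hL)
  rw [← hm'] at hLm
  have hLm' : m'.toMatrix m = L' := by
    calc m'.toMatrix m = m'.toMatrix m * (L * L') := by rw [hL, Matrix.mul_one]
      _ = L' := by rw [← Matrix.mul_assoc, ← hLm, m'.toMatrix_mul_toMatrix_flip m, Matrix.one_mul]
  have hU : (Y * L.map φ).map θ = U₀ := by
    rw [Matrix.map_mul, hY, Matrix.map_map]
    have e1 : (L.map (θ ∘ φ)) = (L.map θ).map φk := by
      rw [Matrix.map_map]
      congr 1
      exact funext hφ
    rw [e1, hL1, Matrix.map_one _ (map_zero φk) (map_one φk), Matrix.mul_one]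
  refine ⟨m', Y * L.map φ, ⟨?_, ?_⟩, hU⟩
  · refine isUnit_of_map_unit θ _ ?_
    rw [RingHom.map_det, RingHom.mapMatrix_apply, hU]
    exact hmk.1
  · rw [← m'.toMatrix_mul_toMatrix m, hLm', toMatrix_comp_semilinear F m m, hLm, hA,
      ← Matrix.mul_assoc, ← Matrix.mul_assoc, hL', Matrix.one_mul, Matrix.mul_assoc]

end

section

/-! ### Witt vectors as objects of the crystalline site -/

variable {p : ℕ}

theorem PDRing.Hom.over_of_comp {R S : PDRing.{u} p} {X : Scheme.{u}} {A A' : Type u} [CommRing A]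
    [CommRing A'] {f : R.Hom S} {c : A →+* R.residue} {c' : A' →+* S.residue} {g : A →+* A'}
    (h : ∀ s, f.residueMap (c s) = c' (g s)) {a : Spec (CommRingCat.of A) ⟶ X} {x : R.Point X}
    {y : S.Point X} (hx : x.hom = Spec.map (CommRingCat.ofHom c) ≫ a)
    (hy : y.hom = Spec.map (CommRingCat.ofHom c') ≫ Spec.map (CommRingCat.ofHom g) ≫ a) :
    f.Over x y := by
  unfold PDRing.Hom.Over
  rw [hx, hy, ← Category.assoc, ← Category.assoc, ← Spec.map_comp, ← Spec.map_comp,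
    ← CommRingCat.ofHom_comp, ← CommRingCat.ofHom_comp]
  congr 3
  exact RingHom.ext h

section Witt

variable (p) [Fact p.Prime] (S : Type u) [CommRing S] [CharP S p] [PerfectRing S p]

/-- The divided power ring `(W(S), (p))`, for a perfect ring `S`. -/
def perfectWitt : PDRing.{u} p :=
  PDRing.ofP (WittVector p S) WittVector.isAdicCompleteIdealSpanP
    (fun b hb => WittVector.eq_zero_of_p_mul_eq_zero b (by rw [mul_comm]; exact hb))

theorem perfectWitt_torsionFree : (perfectWitt p S).TorsionFree := fun b hb =>
  WittVector.eq_zero_of_p_mul_eq_zero (p := p) (k := S) b ((mul_comm _ _).trans hb)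

theorem wittPDRing_torsionFree (K : Type u) [Field K] [CharP K p] [PerfectRing K p] :
    (wittPDRing p K).TorsionFree := fun b hb =>
  WittVector.eq_zero_of_p_mul_eq_zero (p := p) (k := K) b ((mul_comm _ _).trans hb)

/-- The inverse of the isomorphism `W(S) / p ≃ S` given by the zeroth coefficient. -/
def wittResidue : S →+* WittVector p S ⧸ Ideal.span {(p : WittVector p S)} :=
  (WittVector.quotientPEquiv (p := p) (k := S)).symm.toRingHom

variable {p S}

theorem wittResidue_coeff (w : WittVector p S) :
    wittResidue p S (WittVector.constantCoeff w) = Ideal.Quotient.mk _ w :=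
  (RingEquiv.symm_apply_eq _).2 (WittVector.quotientPEquiv_mk w).symm

theorem p_dvd_iff_constantCoeff (w : WittVector p S) :
    (p : WittVector p S) ∣ w ↔ WittVector.constantCoeff w = 0 := by
  rw [← Ideal.mem_span_singleton]
  exact WittVector.mem_span_p_iff_coeff_zero_eq_zero w

/-- The object `(W(S), (p))` given by a morphism `Spec S ⟶ X` into an affine open. -/
def perfectPoint {X : Scheme.{u}} (x : Spec (CommRingCat.of S) ⟶ X)
    (hx : ∃ U : X.Opens, IsAffineOpen U ∧ ∀ t, x t ∈ U) : (perfectWitt p S).Point X where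
  hom := Spec.map (CommRingCat.ofHom (S := (perfectWitt p S).residue) (wittResidue p S)) ≫ x
  small := by
    obtain ⟨U, hU, h⟩ := hx
    exact ⟨U, hU, fun t => h _⟩

variable (p S) in
/-- The Witt vector Frobenius. -/
def perfectFrob : (perfectWitt p S).Hom (perfectWitt p S) :=
  PDRing.Hom.ofIdealP rfl (WittVector.frobenius : WittVector p S →+* WittVector p S)

theorem perfectFrob_over {X : Scheme.{u}} (x : (perfectWitt p S).Point X) :
    (perfectFrob p S).Over x x.frob := by
  have h : (perfectFrob p S).residueMap = (perfectWitt p S).residueFrob := by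
    refine Ideal.Quotient.ringHom_ext (RingHom.ext fun (b : WittVector p S) => ?_)
    refine Ideal.Quotient.eq.2 ?_
    refine (WittVector.mem_span_p_iff_coeff_zero_eq_zero (p := p) (k := S) _).2 ?_
    change WittVector.constantCoeff (WittVector.frobenius (p := p) (R := S) b - b ^ p) = 0
    rw [map_sub, map_pow]
    simp [WittVector.coeff_frobenius_charP]
  unfold PDRing.Hom.Over
  rw [h]
  rfl

variable {K : Type u} [Field K] [CharP K p] [PerfectRing K p]

theorem wittPoint_hom {X : Scheme.{u}} (x : Spec (CommRingCat.of K) ⟶ X) :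
    (wittPoint (p := p) x).hom =
      Spec.map (CommRingCat.ofHom (S := (wittPDRing p K).residue) (wittResidue p K)) ≫ x := rfl

/-- The homomorphism `W(S) → W(K)` induced by a point `S → K`. -/
def perfectToWitt (f : S →+* K) : (perfectWitt p S).Hom (wittPDRing p K) :=
  PDRing.Hom.ofIdealP rfl (WittVector.map f)

theorem perfectToWitt_over (f : S →+* K) {X : Scheme.{u}} (x : Spec (CommRingCat.of S) ⟶ X)
    (hx : ∃ U : X.Opens, IsAffineOpen U ∧ ∀ t, x t ∈ U) :
    (perfectToWitt (p := p) f).Over (perfectPoint x hx)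
      (wittPoint (Spec.map (CommRingCat.ofHom f) ≫ x)) := by
  refine PDRing.Hom.over_of_comp (R := perfectWitt p S) (S := wittPDRing p K)
    (c := wittResidue p S) (c' := wittResidue p K) (g := f) (fun s => ?_) rfl
    (wittPoint_hom _)
  obtain ⟨w, rfl⟩ := WittVector.constantCoeff_surjective p s
  exact (congrArg (PDRing.Hom.residueMap _) (wittResidue_coeff w)).trans
    ((congrArg _ (WittVector.map_coeff f w 0).symm).trans
      (wittResidue_coeff (S := K) (WittVector.map f w))).symm

theorem perfectToWitt_frobenius (f : S →+* K) :
    (wittFrob p K).comp (perfectToWitt f) = (perfectToWitt f).comp (perfectFrob p S) := by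
  have e : ((wittFrob p K).comp (perfectToWitt f)).toRingHom =
      ((perfectToWitt f).comp (perfectFrob p S)).toRingHom := by
    refine RingHom.ext fun (w : WittVector p S) => ?_
    change WittVector.frobenius (WittVector.map f w) = WittVector.map f (WittVector.frobenius w)
    ext n
    rw [WittVector.coeff_frobenius_charP, WittVector.map_coeff, WittVector.map_coeff,
      WittVector.coeff_frobenius_charP, map_pow]
  generalize (wittFrob p K).comp (perfectToWitt f) = g at *
  cases g
  cases e
  rfl

variable {K' : Type u} [Field K'] [CharP K' p] [PerfectRing K' p]

/-- The homomorphism `W(K) → W(K')` induced by a field extension. -/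
def wittToWitt (f : K →+* K') : (wittPDRing p K).Hom (wittPDRing p K') :=
  PDRing.Hom.ofIdealP rfl (WittVector.map f)

theorem wittToWitt_over (f : K →+* K') {X : Scheme.{u}} (x : Spec (CommRingCat.of K) ⟶ X) :
    (wittToWitt (p := p) f).Over (wittPoint x)
      (wittPoint (Spec.map (CommRingCat.ofHom f) ≫ x)) := by
  refine PDRing.Hom.over_of_comp (R := wittPDRing p K) (S := wittPDRing p K')
    (c := wittResidue p K) (c' := wittResidue p K') (g := f) (fun s => ?_)
    (wittPoint_hom _) (wittPoint_hom _)
  obtain ⟨w, rfl⟩ := WittVector.constantCoeff_surjective p s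
  exact (congrArg (PDRing.Hom.residueMap _) (wittResidue_coeff w)).trans
    ((congrArg _ (WittVector.map_coeff f w 0).symm).trans
      (wittResidue_coeff (S := K') (WittVector.map f w))).symm

namespace SubFCrystal

variable {X : Scheme.{u}} {E : FIsocrystal.{u} p X} {L₁ L₂ : SubFCrystal E}

theorem agreeAt_iff (x : Spec (CommRingCat.of K) ⟶ X) :
    L₁.AgreeAt L₂ x ↔ L₁.AgreeOn L₂ (wittPDRing p K) (wittPoint x) := by
  unfold AgreeAt
  rw [Set.Subset.antisymm_iff, Set.range_subset_iff, Set.range_subset_iff]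
  rfl

theorem agreeAt_comp_iff (f : K →+* K') (x : Spec (CommRingCat.of K) ⟶ X) :
    L₁.AgreeAt L₂ (Spec.map (CommRingCat.ofHom f) ≫ x) ↔ L₁.AgreeAt L₂ x := by
  rw [agreeAt_iff, agreeAt_iff]
  refine ⟨fun h => AgreeOn.of_forall (I := Unit) (S := fun _ => wittPDRing p K')
    (fun _ => wittPDRing_torsionFree p K') (f := fun _ => wittToWitt f) (fun r hr => ?_)
    (fun _ => wittToWitt_over f x) (fun _ => h), fun h => h.map (wittToWitt_over f x)⟩
  have h1 := (p_dvd_iff_constantCoeff (S := K') (WittVector.map f r)).1 (hr ())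
  refine (p_dvd_iff_constantCoeff (S := K) r).2 (f.injective ?_)
  rw [map_zero, ← h1]
  rfl

end SubFCrystal

end Witt

end

section

/-! ### Frobenius at Witt vectors, and fibres of ordinary crystals -/

variable {p : ℕ} {X : Scheme.{u}}

theorem Crystal.map_congr (L : Crystal.{u} p X) {R S : PDRing.{u} p} {f g : R.Hom S} (e : f = g)
    {x : R.Point X} {y : S.Point X} (hf : f.Over x y) (hg : g.Over x y) (m : L.obj R x) :
    L.map f hf m = L.map g hg m := by
  subst e
  rfl

theorem PDRing.eq_zero_of_forall_pow_dvd (R : PDRing.{u} p) (b : R.carrier)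
    (h : ∀ n : ℕ, (p : R.carrier) ^ n ∣ b) : b = 0 := by
  refine R.complete.toIsHausdorff.haus b fun n => ?_
  rw [SModEq.zero, smul_eq_mul, Ideal.mul_top, Ideal.span_singleton_pow,
    Ideal.mem_span_singleton]
  exact h n

section Frob

variable [Fact p.Prime]

variable {S : Type u} [CommRing S] [CharP S p] [PerfectRing S p]
  {K : Type u} [Field K] [CharP K p] [PerfectRing K p]

/-- The Frobenius-semilinear endomorphism of the value of an `F`-crystal at `W(S)`. -/
def FCrystal.perfectFrob (L : FCrystal.{u} p X) (x : (perfectWitt p S).Point X) :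
    L.obj _ x →ₛₗ[(FCrys.perfectFrob p S).toRingHom] L.obj _ x :=
  (L.frob _ x).comp (L.map (FCrys.perfectFrob p S) (perfectFrob_over x))

theorem FCrystal.map_perfectFrob (L : FCrystal.{u} p X) (f : S →+* K)
    (x : Spec (CommRingCat.of S) ⟶ X) (hx : ∃ U : X.Opens, IsAffineOpen U ∧ ∀ t, x t ∈ U)
    (m : L.obj _ (perfectPoint (p := p) x hx)) :
    L.map (perfectToWitt f) (perfectToWitt_over f x hx) (L.perfectFrob _ m) =
      L.fibreFrob (Spec.map (CommRingCat.ofHom f) ≫ x)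
        (L.map (perfectToWitt f) (perfectToWitt_over f x hx) m) := by
  have h := perfectToWitt_over (p := p) f x hx
  change L.map (perfectToWitt f) h (L.frob _ _ (L.map _ _ m)) =
    L.frob _ _ (L.map _ _ (L.map _ _ m))
  rw [L.frob_map, ← L.map_comp, ← L.map_comp]
  congr 1
  exact L.map_congr (perfectToWitt_frobenius f).symm _ _ m

variable {E : FIsocrystal.{u} p X} (L : SubFCrystal E)

theorem SubFCrystal.ι_fibreFrob (x : Spec (CommRingCat.of K) ⟶ X) (m : L.fibre x) :
    L.ι _ _ (L.fibreFrob x m) = E.fibreFrob x (L.ι _ _ m) := by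
  change L.ι _ _ (L.frob _ _ (L.map _ _ m)) = E.frob _ _ (E.map _ _ (L.ι _ _ m))
  rw [L.ι_frob, L.ι_map]

theorem SubFCrystal.ι_perfectFrob (x : (perfectWitt p S).Point X) (m : L.obj _ x) :
    L.ι _ _ (L.perfectFrob x m) = E.frob _ x (E.map (FCrys.perfectFrob p S)
      (perfectFrob_over x) (L.ι _ _ m)) := by
  change L.ι _ _ (L.frob _ _ (L.map _ _ m)) = _
  rw [L.ι_frob, L.ι_map]

instance isDomain_wittPDRing : IsDomain (wittPDRing p K).carrier :=
  inferInstanceAs (IsDomain (WittVector p K))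

variable (p K) in
theorem wittPDRing_p_ne_zero : (p : (wittPDRing p K).carrier) ≠ 0 := WittVector.p_nonzero p K

theorem isUnit_of_not_p_dvd (w : (wittPDRing p K).carrier)
    (h : ¬ (p : (wittPDRing p K).carrier) ∣ w) : IsUnit w :=
  WittVector.isUnit_of_coeff_zero_ne_zero (p := p) (k := K) w fun h0 =>
    h ((p_dvd_iff_constantCoeff (p := p) (S := K) w).2 h0)

/-- The fibre of an ordinary crystal at a geometric point has a basis in which the matrix of
Frobenius is `D * U` with invertible principal blocks of `U`. -/
theorem SubFCrystal.exists_hasSplitBasis_fibre {x : Spec (CommRingCat.of K) ⟶ X} {n : ℕ}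
    {a : Fin n → ℕ} (hH : L.HasHodgeSlopes x a) (hN : E.HasNewtonSlopes x (fun i => (a i : ℚ))) :
    ∃ (U : Matrix (Fin n) (Fin n) (wittPDRing p K).carrier)
      (m : Module.Basis (Fin n) (wittPDRing p K).carrier (L.fibre x)),
      HasSplitBasis p (L.fibreFrob x) a U m ∧ ∀ c, IsUnit (principalBlock a U c).det := by
  obtain ⟨e, f, hef⟩ := hH
  obtain ⟨s, hs, ε, hε⟩ := hN
  refine ⟨_, f, hasSplitBasis_of_hodge e f hef, fun c => ?_⟩
  refine isUnit_of_not_p_dvd _ ((hasSplitBasis_of_hodge e f hef).not_dvd_det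
    (wittPDRing_p_ne_zero p K) (PDRing.eq_zero_of_forall_pow_dvd _)
    (L.ι_isBaseChange _ _) (L.ι_fibreFrob x) hs ε (fun j => ?_) c)
  obtain ⟨b, c, hbc, h⟩ := hε j
  have hc : c = b + s * a j := by
    have : (c : ℚ) = ((b + s * a j : ℕ) : ℚ) := by push_cast; linarith
    exact_mod_cast this
  rw [hc, pow_add, mul_smul] at h
  exact ((isUnit_p_invP (p := p) _).pow b).smul_left_cancel.1 h

end Frob

end

section

/-! ### Ordinary crystals over a perfect valuation ring -/

variable {p : ℕ} [Fact p.Prime] {X : Scheme.{u}}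

section Valuation

theorem isUnit_of_isUnit_constantCoeff {S : Type u} [CommRing S] [CharP S p] [PerfectRing S p]
    (w : WittVector p S) (h : IsUnit (WittVector.constantCoeff w)) : IsUnit w := by
  obtain ⟨v, hv⟩ := WittVector.constantCoeff_surjective p (↑h.unit⁻¹ : S)
  have h1 : (p : WittVector p S) ∣ w * v - 1 := by
    rw [p_dvd_iff_constantCoeff, map_sub, map_mul, hv, map_one, sub_eq_zero]
    exact h.mul_val_inv
  obtain ⟨t, ht⟩ := h1
  have hj := IsAdicComplete.le_jacobson_bot (Ideal.span {(p : WittVector p S)})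
    (Ideal.mem_span_singleton_self (p : WittVector p S))
  have hu := Ideal.mem_jacobson_bot.1 hj t
  rw [← ht, sub_add_cancel] at hu
  exact isUnit_of_mul_isUnit_left hu

section

variable {O κ K : Type u} [CommRing O] [CharP O p] [PerfectRing O p]
  [Field κ] [CharP κ p] [PerfectRing κ p] [Field K] [CharP K p] [PerfectRing K p]

instance isLocalHom_perfectToWitt (π : O →+* κ) [IsLocalHom π] :
    IsLocalHom (perfectToWitt (p := p) π).toRingHom := ⟨fun w _ => by
  have h1 : IsUnit (π (WittVector.constantCoeff (p := p) (R := O) w)) := by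
    have := IsUnit.map (WittVector.constantCoeff : WittVector p κ →+* κ) ‹_›
    exact this
  exact isUnit_of_isUnit_constantCoeff (p := p) (S := O) w (isUnit_of_map_unit π _ h1)⟩

theorem perfectToWitt_surjective {π : O →+* κ} (hπ : Function.Surjective π) :
    Function.Surjective (perfectToWitt (p := p) π).toRingHom :=
  WittVector.map_surjective π hπ

theorem perfectToWitt_p_dvd {ψ : O →+* K} (hψ : Function.Injective ψ)
    (w : (perfectWitt p O).carrier)
    (h : (p : (wittPDRing p K).carrier) ∣ (perfectToWitt ψ).toRingHom w) :
    (p : (perfectWitt p O).carrier) ∣ w := by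
  refine (p_dvd_iff_constantCoeff (S := O) w).2 (hψ ?_)
  rw [map_zero]
  exact (p_dvd_iff_constantCoeff (S := K) _).1 h

theorem perfectToWitt_frob_apply (π : O →+* κ) (w : (perfectWitt p O).carrier) :
    (perfectToWitt π).toRingHom ((perfectFrob p O).toRingHom w) =
      (wittFrob p κ).toRingHom ((perfectToWitt π).toRingHom w) :=
  congrArg (fun f => PDRing.Hom.toRingHom f w) (perfectToWitt_frobenius (p := p) π).symm

end

variable {O κ K : Type u} [CommRing O] [IsDomain O] [ValuationRing O] [CharP O p] [PerfectRing O p]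
  [Field κ] [CharP κ p] [PerfectRing κ p] [Field K] [CharP K p] [PerfectRing K p]

instance isLocalRing_perfectWitt : IsLocalRing (perfectWitt p O).carrier :=
  have h : IsLocalHom (WittVector.constantCoeff : WittVector p O →+* O) :=
    ⟨isUnit_of_isUnit_constantCoeff⟩
  @RingHom.domain_isLocalRing (WittVector p O) O _ _ _
    (WittVector.constantCoeff : WittVector p O →+* O) h

variable {E : FIsocrystal.{u} p X}

/-- Over a perfect valuation ring with algebraically closed residue field, an ordinary crystal has a
basis in which the matrix of Frobenius is `D * U`, with principal blocks of `U` that are invertible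
at the closed point. The Newton slopes enter at the closed point and the Hodge slopes at both. -/
theorem SubFCrystal.exists_hasSplitBasis_perfect (L : SubFCrystal E) [IsAlgClosed κ]
    [IsAlgClosed K] {π : O →+* κ} [IsLocalHom π] (hπ : Function.Surjective π) {ψ : O →+* K}
    (hψ : Function.Injective ψ) (hL : L.IsOrdinary) (x : Spec (CommRingCat.of O) ⟶ X)
    (hx : ∃ U : X.Opens, IsAffineOpen U ∧ ∀ t, x t ∈ U) :
    ∃ (n : ℕ) (a : Fin n → ℕ) (m : Module.Basis (Fin n) (perfectWitt p O).carrier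
        (L.obj _ (perfectPoint x hx))) (U : Matrix (Fin n) (Fin n) (perfectWitt p O).carrier),
      HasSplitBasis p (L.perfectFrob (perfectPoint x hx)) a U m ∧
      ∀ c, IsUnit (principalBlock a (U.map (perfectToWitt π).toRingHom) c).det := by
  obtain ⟨n, a, h⟩ := hL
  obtain ⟨hH, hN⟩ := h κ (Spec.map (CommRingCat.ofHom π) ≫ x)
  obtain ⟨⟨e, f, hef⟩, -⟩ := h K (Spec.map (CommRingCat.ofHom ψ) ≫ x)
  obtain ⟨U₀, mk, hmk, hU₀⟩ := L.exists_hasSplitBasis_fibre hH hN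
  obtain ⟨m, U, hm, hU⟩ := exists_hasSplitBasis (K := K) (wittPDRing_torsionFree p κ)
    (wittPDRing_torsionFree p K) (perfectToWitt_surjective hπ)
    (WittVector.constantCoeff : WittVector p K →+* K)
    (by
      change WittVector.constantCoeff (p : WittVector p K) = 0
      rw [map_natCast, CharP.cast_eq_zero])
    (fun w hw => perfectToWitt_p_dvd hψ w ((p_dvd_iff_constantCoeff (S := K) _).2 hw))
    (perfectToWitt_frob_apply π) (L.isBaseChange _ (perfectToWitt_over π x hx))
    (L.map_perfectFrob π x hx) (L.isBaseChange _ (perfectToWitt_over ψ x hx))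
    (L.map_perfectFrob ψ x hx) hmk hU₀ e f hef
  exact ⟨n, a, m, U, hm, fun c => by rw [hU]; exact hU₀ c⟩

variable {L₁ L₂ : SubFCrystal E}

/-- A relation `p ^ l • m₁ = β • m₂` between Frobenius modules inside an isocrystal is compatible
with the matrices of Frobenius. -/
theorem SubFCrystal.mul_map_eq_of_smul_eq {S : Type u} [CommRing S] [CharP S p] [PerfectRing S p]
    {x : (perfectWitt p S).Point X} {ι₁ ι₂ : Type*} [Fintype ι₁] [Fintype ι₂]
    (m₁ : Module.Basis ι₁ _ (L₁.obj _ x)) (m₂ : Module.Basis ι₂ _ (L₂.obj _ x)) (l : ℕ)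
    {β : Matrix ι₂ ι₁ (perfectWitt p S).carrier}
    (h : ∀ j, (p : InvP p (perfectWitt p S).carrier) ^ l • L₁.ι _ x (m₁ j) =
      L₂.ι _ x (∑ i, β i j • m₂ i))
    {A₁ : Matrix ι₁ ι₁ (perfectWitt p S).carrier} (hA₁ : m₁.toMatrix (L₁.perfectFrob x ∘ m₁) = A₁)
    {A₂ : Matrix ι₂ ι₂ (perfectWitt p S).carrier} (hA₂ : m₂.toMatrix (L₂.perfectFrob x ∘ m₂) = A₂) :
    A₂ * β.map (perfectFrob p S).toRingHom = β * A₁ := by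
  have hβ : m₂.toMatrix (fun j => ∑ i, β i j • m₂ i) = β := by
    ext i j
    rw [Module.Basis.toMatrix_apply, m₂.repr_sum_self fun i => β i j]
  have hF : ∀ j, L₂.perfectFrob x (∑ i, β i j • m₂ i) =
      ∑ k, A₁ k j • ∑ i, β i k • m₂ i := by
    intro j
    apply L₂.ι_injective (perfectWitt_torsionFree p S)
    rw [L₂.ι_perfectFrob, ← h, map_smulₛₗ, map_pow, map_natCast, map_smul, ← L₁.ι_perfectFrob,
      map_sum]
    conv_lhs => rw [← m₁.sum_repr (L₁.perfectFrob x (m₁ j)), map_sum, Finset.smul_sum]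
    refine Finset.sum_congr rfl fun k _ => ?_
    rw [map_smulₛₗ, map_smulₛₗ, ← h, smul_comm, ← hA₁]
    rfl
  have e := toMatrix_comp_semilinear (L₂.perfectFrob x) m₂ m₂ fun j => ∑ i, β i j • m₂ i
  rw [hβ, hA₂] at e
  rw [← e]
  ext i j
  rw [Module.Basis.toMatrix_apply, Function.comp_apply, hF, map_sum, Finsupp.finsetSum_apply,
    Matrix.mul_apply]
  refine Finset.sum_congr rfl fun k _ => ?_
  rw [map_smul, Finsupp.smul_apply, smul_eq_mul, m₂.repr_sum_self fun i => β i k, mul_comm]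

/-- If two ordinary crystals agree at the closed point of a perfect valuation ring, the first is
contained in the second over the whole ring. -/
theorem SubFCrystal.IsOrdinary.leOn_perfect [IsAlgClosed κ] [IsAlgClosed K] {π : O →+* κ}
    [IsLocalHom π] (hπ : Function.Surjective π) {ψ : O →+* K} (hψ : Function.Injective ψ)
    (h₁ : L₁.IsOrdinary) (h₂ : L₂.IsOrdinary) (x : Spec (CommRingCat.of O) ⟶ X)
    (hx : ∃ U : X.Opens, IsAffineOpen U ∧ ∀ t, x t ∈ U)
    (h : L₁.LeOn L₂ _ (wittPoint (Spec.map (CommRingCat.ofHom π) ≫ x))) :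
    L₁.LeOn L₂ _ (perfectPoint x hx) := by
  obtain ⟨n₁, a₁, m₁, U₁, ⟨hU₁, hm₁⟩, hb₁⟩ := L₁.exists_hasSplitBasis_perfect hπ hψ h₁ x hx
  obtain ⟨n₂, a₂, m₂, U₂, ⟨hU₂, hm₂⟩, hb₂⟩ := L₂.exists_hasSplitBasis_perfect hπ hψ h₂ x hx
  obtain ⟨V₁, hV, hV'⟩ := exists_inverse_of_isUnit_det hU₁
  have htf := perfectWitt_torsionFree p O
  have hover := perfectToWitt_over (p := p) π x hx
  have hblock : ∀ {n : ℕ} {a : Fin n → ℕ} {U : Matrix (Fin n) (Fin n) (perfectWitt p O).carrier},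
      (∀ c, IsUnit (principalBlock a (U.map (perfectToWitt π).toRingHom) c).det) →
      ∀ c, (principalBlock a (U.map (π.comp
        (WittVector.constantCoeff : WittVector p O →+* O))) c).det ≠ 0 := by
    intro n a U hU c
    have h1 := IsUnit.map (WittVector.constantCoeff : WittVector p κ →+* κ) (hU c)
    have h2 := RingHom.map_det (WittVector.constantCoeff : WittVector p κ →+* κ)
      (principalBlock a (U.map (perfectToWitt π).toRingHom) c)
    exact (h2 ▸ h1).ne_zero
  -- If `L₁ = p ^ (-l - 1) * β * L₂`, then `β` is divisible by `p` at the closed point, as the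
  -- lattices agree there, and hence everywhere. So the denominators can be removed one by one.
  have key : ∀ (l : ℕ) (β : Matrix (Fin n₂) (Fin n₁) (perfectWitt p O).carrier),
      (∀ j, (p : InvP p (perfectWitt p O).carrier) ^ (l + 1) • L₁.ι _ (perfectPoint x hx) (m₁ j) =
        L₂.ι _ _ (∑ i, β i j • m₂ i)) → ∀ i j, (p : (perfectWitt p O).carrier) ∣ β i j := by
    intro l β hβ i j
    have e := SubFCrystal.mul_map_eq_of_smul_eq m₁ m₂ (l + 1) hβ hm₁ hm₂
    refine (p_dvd_iff_constantCoeff (S := O) _).2 ?_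
    refine map_eq_zero_of_residue htf (perfectFrob p O).toRingHom
      (WittVector.constantCoeff : WittVector p O →+* O) (CharP.cast_eq_zero O p)
      (fun w => WittVector.coeff_frobenius_charP p w 0) π hV hV' (hblock hb₁) (hblock hb₂) e
      (fun i j => ?_) i j
    obtain ⟨w, hw⟩ := h (L₁.map _ hover (m₁ j))
    have e1 : L₂.map _ hover (∑ i, β i j • m₂ i) =
        (p : (wittPDRing p κ).carrier) ^ (l + 1) • w := by
      apply L₂.ι_injective (wittPDRing_torsionFree p κ)
      rw [L₂.ι_map, ← hβ, map_smulₛₗ, map_pow, map_natCast, map_smulₛₗ, map_pow, map_natCast, hw,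
        L₁.ι_map]
    obtain ⟨b, hb⟩ := (L₂.isBaseChange _ hover).exists_basis m₂
    have e2 : (perfectToWitt π).toRingHom (β i j) =
        (p : (wittPDRing p κ).carrier) ^ (l + 1) * b.repr w i := by
      rw [← smul_eq_mul, ← Finsupp.smul_apply, ← map_smul, ← e1, map_sum]
      simp_rw [map_smulₛₗ, ← hb]
      rw [b.repr_sum_self fun i => (perfectToWitt π).toRingHom (β i j)]
    rw [pow_succ', mul_assoc] at e2
    exact (p_dvd_iff_constantCoeff (S := κ) _).1 ⟨_, e2⟩
  have main : ∀ (l : ℕ) (β : Matrix (Fin n₂) (Fin n₁) (perfectWitt p O).carrier),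
      (∀ j, (p : InvP p (perfectWitt p O).carrier) ^ l • L₁.ι _ (perfectPoint x hx) (m₁ j) =
        L₂.ι _ _ (∑ i, β i j • m₂ i)) →
      ∃ β : Matrix (Fin n₂) (Fin n₁) (perfectWitt p O).carrier,
        ∀ j, L₁.ι _ _ (m₁ j) = L₂.ι _ _ (∑ i, β i j • m₂ i) := by
    intro l
    induction l with
    | zero => exact fun β hβ => ⟨β, fun j => by rw [← hβ, pow_zero, one_smul]⟩
    | succ l ih =>
      intro β hβ
      choose β' hβ' using key l β hβ
      refine ih β' fun j => ?_
      refine (isUnit_p_invP (p := p) (perfectWitt p O).carrier).smul_left_cancel.1 ?_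
      rw [smul_smul, ← pow_succ', hβ]
      have e : ∑ i, β i j • m₂ i = (p : (perfectWitt p O).carrier) • ∑ i, β' i j • m₂ i := by
        rw [Finset.smul_sum]
        exact Finset.sum_congr rfl fun i _ => by rw [hβ', mul_smul]
      rw [e, map_smulₛₗ, map_natCast]
  choose l w hw using fun j => (L₂.ι_isBaseChange _ _).exists_pow_smul
    (L₁.ι _ (perfectPoint x hx) (m₁ j))
  obtain ⟨β, hβ⟩ := main (Finset.univ.sup l) (fun i j => m₂.repr
      ((p : (perfectWitt p O).carrier) ^ (Finset.univ.sup l - l j) • w j) i) (fun j => by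
    rw [m₂.sum_repr, map_smulₛₗ, ← hw, map_pow, map_natCast, smul_smul, ← pow_add,
      Nat.sub_add_cancel (Finset.le_sup (Finset.mem_univ j))])
  intro v
  refine ⟨∑ j, m₁.repr v j • ∑ i, β i j • m₂ i, ?_⟩
  conv_rhs => rw [← m₁.sum_repr v, map_sum]
  rw [map_sum]
  refine Finset.sum_congr rfl fun j _ => ?_
  rw [map_smulₛₗ, map_smulₛₗ, hβ]

/-- Two ordinary crystals agree at the generic point of a perfect valuation ring if and only if
they agree at the closed point. -/
theorem SubFCrystal.IsOrdinary.agreeAt_iff_agreeAt [IsAlgClosed κ] [IsAlgClosed K] {π : O →+* κ}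
    [IsLocalHom π] (hπ : Function.Surjective π) {ψ : O →+* K} (hψ : Function.Injective ψ)
    (h₁ : L₁.IsOrdinary) (h₂ : L₂.IsOrdinary) (x : Spec (CommRingCat.of O) ⟶ X)
    (hx : ∃ U : X.Opens, IsAffineOpen U ∧ ∀ t, x t ∈ U) :
    L₁.AgreeAt L₂ (Spec.map (CommRingCat.ofHom π) ≫ x) ↔
      L₁.AgreeAt L₂ (Spec.map (CommRingCat.ofHom ψ) ≫ x) := by
  rw [agreeAt_iff, agreeAt_iff]
  constructor
  · intro h
    have h' : L₁.AgreeOn L₂ _ (perfectPoint x hx) :=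
      ⟨h₁.leOn_perfect hπ hψ h₂ x hx h.1, h₂.leOn_perfect hπ hψ h₁ x hx h.2⟩
    exact h'.map (perfectToWitt_over ψ x hx)
  · intro h
    have h' : L₁.AgreeOn L₂ _ (perfectPoint x hx) :=
      AgreeOn.of_forall (I := Unit) (S := fun _ => wittPDRing p K)
        (fun _ => wittPDRing_torsionFree p K) (f := fun _ => perfectToWitt ψ)
        (fun r hr => perfectToWitt_p_dvd hψ r (hr ())) (fun _ => perfectToWitt_over ψ x hx)
        (fun _ => h)
    exact h'.map (perfectToWitt_over π x hx)

end Valuation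

end

section

/-! ### Propagation from one point to all points -/

section Topology

/-- In a space with finitely many irreducible components, all with generic points, sets that are
stable under specialization and generization are closed. -/
theorem isClosed_of_forall_specializes {X : Type*} [TopologicalSpace X] [QuasiSober X]
    (hX : (irreducibleComponents X).Finite) {Z : Set X}
    (hZ : ∀ x y : X, x ⤳ y → (x ∈ Z ↔ y ∈ Z)) : IsClosed Z := by
  have e : Z = ⋃ T ∈ {T ∈ irreducibleComponents X | T ⊆ Z}, T := by
    refine Set.Subset.antisymm (fun z hz => ?_) (Set.iUnion₂_subset fun T hT => hT.2)
    have hT : irreducibleComponent z ∈ irreducibleComponents X :=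
      irreducibleComponent_mem_irreducibleComponents z
    refine Set.mem_iUnion₂.2 ⟨irreducibleComponent z, ⟨hT, fun y hy => ?_⟩,
      mem_irreducibleComponent⟩
    have hg := (isIrreducible_irreducibleComponent (x := z)).isGenericPoint_genericPoint
      isClosed_irreducibleComponent
    exact (hZ _ y (hg.specializes hy)).1
      ((hZ _ z (hg.specializes mem_irreducibleComponent)).2 hz)
  rw [e]
  exact (hX.subset (Set.sep_subset _ _)).isClosed_biUnion fun T hT =>
    isClosed_of_mem_irreducibleComponents T hT.1

theorem eq_univ_of_forall_specializes {X : Type*} [TopologicalSpace X] [QuasiSober X]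
    [ConnectedSpace X] (hX : (irreducibleComponents X).Finite) {Z : Set X}
    (hZ : ∀ x y : X, x ⤳ y → (x ∈ Z ↔ y ∈ Z)) (hne : Z.Nonempty) : Z = Set.univ := by
  refine IsClopen.eq_univ ⟨isClosed_of_forall_specializes hX hZ, ?_⟩ hne
  rw [← isClosed_compl_iff]
  exact isClosed_of_forall_specializes hX fun x y h => not_congr (hZ x y h)

end Topology

section ValuationSubring

variable {K : Type u} [Field K] [IsAlgClosed K]

theorem isAlgClosed_residueField (B : ValuationSubring K) :
    IsAlgClosed (IsLocalRing.ResidueField B) := by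
  refine IsAlgClosed.of_exists_root _ fun q hq hirr => ?_
  obtain ⟨P, rfl, hdeg, hP⟩ := Polynomial.lifts_and_natDegree_eq_and_monic
    (Polynomial.map_surjective (IsLocalRing.residue B) IsLocalRing.residue_surjective q) hq
  obtain ⟨y, hy⟩ := IsAlgClosed.exists_root (P.map (algebraMap B K)) (by
    rw [hP.degree_map]
    intro h0
    have : P.natDegree = 0 := Polynomial.natDegree_eq_of_degree_eq_some h0
    rw [hdeg] at this
    exact hirr.natDegree_pos.ne' this)
  have hint : IsIntegral B y := ⟨P, hP, (Polynomial.eval_map _ _).symm.trans hy⟩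
  obtain ⟨b, rfl⟩ := IsIntegrallyClosed.isIntegral_iff.1 hint
  refine ⟨IsLocalRing.residue B b, ?_⟩
  have h0 : P.eval b = 0 := by
    refine FaithfulSMul.algebraMap_injective B K ?_
    rw [map_zero, ← hy, Polynomial.eval_map_apply]
  rw [Polynomial.eval_map_apply, h0, map_zero]

theorem perfectRing_valuationSubring (p : ℕ) [Fact p.Prime] [CharP K p] (B : ValuationSubring K)
    [CharP B p] : PerfectRing B p := by
  refine ⟨⟨fun a b h => ?_, fun b => ?_⟩⟩
  · exact frobenius_inj B p h
  · obtain ⟨y, hy⟩ := IsAlgClosed.exists_pow_nat_eq (b : K) (Fact.out : p.Prime).pos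
    obtain ⟨c, rfl⟩ := (IsIntegrallyClosed.isIntegral_iff (R := B) (K := K)).1
      (IsIntegral.of_pow (Fact.out : p.Prime).pos (x := y) (hy ▸ isIntegral_algebraMap (x := b)))
    exact ⟨c, Subtype.ext hy⟩

end ValuationSubring

section Points

variable {p : ℕ} [Fact p.Prime] {X : Scheme.{u}} {E : FIsocrystal.{u} p X} {L₁ L₂ : SubFCrystal E}

/-- The closed point of the spectrum of a local ring. -/
def specClosedPoint (R : Type u) [CommRing R] [IsLocalRing R] : Spec (CommRingCat.of R) :=
  IsLocalRing.closedPoint R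

theorem map_specClosedPoint {R S : Type u} [CommRing R] [IsLocalRing R] [CommRing S]
    [IsLocalRing S] (f : R →+* S) [IsLocalHom f] :
    Spec.map (CommRingCat.ofHom f) (specClosedPoint S) = specClosedPoint R :=
  IsLocalRing.comap_closedPoint f

/-- Agreement at a point depends only on the underlying point of the scheme. -/
theorem SubFCrystal.agreeAt_iff_of_eq {K K' : Type u} [Field K] [CharP K p] [PerfectRing K p]
    [Field K'] [CharP K' p] [PerfectRing K' p] (x : Spec (CommRingCat.of K) ⟶ X)
    (x' : Spec (CommRingCat.of K') ⟶ X)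
    (h : x (specClosedPoint K) = x' (specClosedPoint K')) :
    L₁.AgreeAt L₂ x ↔ L₁.AgreeAt L₂ x' := by
  obtain ⟨z, -, -⟩ := Scheme.Pullback.exists_preimage_pullback _ _ h
  let Ω := AlgebraicClosure ((Limits.pullback x x').residueField z)
  let g : Spec (CommRingCat.of Ω) ⟶ Limits.pullback x x' :=
    Spec.map (CommRingCat.ofHom (algebraMap ((Limits.pullback x x').residueField z) Ω)) ≫
      (Limits.pullback x x').fromSpecResidueField z
  obtain ⟨f, hf⟩ := Spec.map_surjective (g ≫ Limits.pullback.fst x x')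
  obtain ⟨f', hf'⟩ := Spec.map_surjective (g ≫ Limits.pullback.snd x x')
  have : CharP Ω p := charP_of_injective_ringHom (f := f.hom) f.hom.injective p
  rw [← agreeAt_comp_iff f.hom, ← agreeAt_comp_iff f'.hom]
  have e : Spec.map f ≫ x = Spec.map f' ≫ x' := by
    clear_value g
    rw [hf, hf', Category.assoc, Category.assoc, Limits.pullback.condition]
  exact iff_of_eq (congrArg (L₁.AgreeAt L₂) e)

/-- Two ordinary crystals agree at a point if and only if they agree at a specialization. -/
theorem SubFCrystal.IsOrdinary.agreeAt_iff_of_specializes (h₁ : L₁.IsOrdinary)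
    (h₂ : L₂.IsOrdinary) {K K' : Type u} [Field K] [CharP K p] [PerfectRing K p]
    [Field K'] [CharP K' p] [PerfectRing K' p] (x : Spec (CommRingCat.of K) ⟶ X)
    (x' : Spec (CommRingCat.of K') ⟶ X)
    (h : x (specClosedPoint K) ⤳ x' (specClosedPoint K')) :
    L₁.AgreeAt L₂ x ↔ L₁.AgreeAt L₂ x' := by
  generalize hc : x (specClosedPoint K) = c at h
  generalize hc' : x' (specClosedPoint K') = c' at h
  let Ω := AlgebraicClosure (X.residueField c)
  let r : X.presheaf.stalk c →+* Ω :=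
    (algebraMap (X.residueField c) Ω).comp (X.residue c).hom
  -- A valuation ring `B` of `Ω` that dominates the image of the local ring at `c'`.
  obtain ⟨B, hB, hloc⟩ := IsLocalRing.exists_factor_valuationRing
    (r.comp (X.presheaf.stalkSpecializes h).hom)
  have hΩ : CharP Ω p := by
    subst hc
    have : CharP (X.residueField (x (specClosedPoint K))) p :=
      (X.descResidueField (Scheme.stalkClosedPointTo x)).hom.charP (RingHom.injective _) p
    exact charP_of_injective_ringHom
      (algebraMap (X.residueField (x (specClosedPoint K))) Ω).injective p
  have hBp : CharP B p := B.subtype.charP B.subtype_injective p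
  have := perfectRing_valuationSubring p B
  have := isAlgClosed_residueField B
  have : CharP (IsLocalRing.ResidueField B) p :=
    (CharP.charP_iff_prime_eq_zero (Fact.out : p.Prime)).2 (by
      rw [← map_natCast (IsLocalRing.residue B), CharP.cast_eq_zero, map_zero])
  let y : Spec (CommRingCat.of B) ⟶ X :=
    Spec.map (CommRingCat.ofHom (RingHom.codRestrict _ B.toSubring hB)) ≫ X.fromSpecStalk c'
  have hy : y (specClosedPoint B) = c' := by
    have e := map_specClosedPoint (S := B) (RingHom.codRestrict _ B.toSubring hB)
    rw [Scheme.Hom.comp_apply]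
    exact (congrArg _ e).trans Scheme.fromSpecStalk_closedPoint
  have hsmall : ∃ U : X.Opens, IsAffineOpen U ∧ ∀ t, y t ∈ U := by
    obtain ⟨U, hU, hc, -⟩ := exists_isAffineOpen_mem_and_subset (x := c') (U := ⊤) trivial
    refine ⟨U, hU, fun t => ?_⟩
    have e : y t ⤳ y (specClosedPoint B) :=
      (IsLocalRing.specializes_closedPoint (R := B) t).map y.continuous
    rw [hy] at e
    exact e.mem_open U.2 hc
  have key := h₁.agreeAt_iff_agreeAt (K := Ω) (IsLocalRing.residue_surjective (R := B))
    B.subtype_injective h₂ y hsmall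
  rw [agreeAt_iff_of_eq x (Spec.map (CommRingCat.ofHom B.subtype) ≫ y), ← key]
  · refine agreeAt_iff_of_eq _ x' ?_
    rw [hc', Scheme.Hom.comp_apply, ← hy]
    exact congrArg _ (map_specClosedPoint (IsLocalRing.residue B))
  · have e : Spec.map (CommRingCat.ofHom B.subtype) ≫ y =
        Spec.map (CommRingCat.ofHom (algebraMap (X.residueField c) Ω)) ≫
          X.fromSpecResidueField c := by
      rw [Scheme.fromSpecResidueField, ← Scheme.SpecMap_stalkSpecializes_fromSpecStalk h,
        ← Category.assoc, ← Category.assoc, ← Category.assoc, ← Spec.map_comp, ← Spec.map_comp,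
        ← Spec.map_comp]
      rfl
    rw [e, hc, Scheme.Hom.comp_apply, Scheme.fromSpecResidueField_apply]

/-- On a connected Noetherian scheme of characteristic `p`, two ordinary crystals that agree at one
point agree at all points. -/
theorem SubFCrystal.IsOrdinary.agreeAt_of_agreeAt [IsNoetherian X] [ConnectedSpace X]
    (hX : ∀ c : X, CharP (X.residueField c) p) (h₁ : L₁.IsOrdinary)
    (h₂ : L₂.IsOrdinary) {K K' : Type u} [Field K] [CharP K p] [PerfectRing K p]
    [Field K'] [CharP K' p] [PerfectRing K' p] (x : Spec (CommRingCat.of K) ⟶ X)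
    (h : L₁.AgreeAt L₂ x) (x' : Spec (CommRingCat.of K') ⟶ X) : L₁.AgreeAt L₂ x' := by
  have hchar : ∀ c : X, CharP (AlgebraicClosure (X.residueField c)) p := fun c =>
    have := hX c
    charP_of_injective_ringHom (algebraMap (X.residueField c) (AlgebraicClosure _)).injective p
  let pt : ∀ c : X, Spec (CommRingCat.of (AlgebraicClosure (X.residueField c))) ⟶ X := fun c =>
    Spec.map (CommRingCat.ofHom (algebraMap (X.residueField c) (AlgebraicClosure _))) ≫
      X.fromSpecResidueField c
  have hpt : ∀ c t, pt c t = c := fun c t => by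
    rw [Scheme.Hom.comp_apply, Scheme.fromSpecResidueField_apply]
  have hZ := eq_univ_of_forall_specializes finite_irreducibleComponents_of_isNoetherian
    (Z := {c : X | L₁.AgreeAt L₂ (pt c)})
    (fun c c' hcc => h₁.agreeAt_iff_of_specializes h₂ (pt c) (pt c') (by
      rw [hpt, hpt]
      exact hcc))
    ⟨x (specClosedPoint K), (agreeAt_iff_of_eq x _ (hpt _ _).symm).1 h⟩
  refine (agreeAt_iff_of_eq x' _ (hpt (x' (specClosedPoint K')) _).symm).2 ?_
  have : x' (specClosedPoint K') ∈ {c : X | L₁.AgreeAt L₂ (pt c)} := hZ ▸ Set.mem_univ _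
  exact this

end Points

end

section

/-! ### Completions of Noetherian rings along ideals containing `p` -/

theorem mem_of_sModEq {A : Type*} [CommRing A] {I : Ideal A} {n : ℕ} {a b : A} :
    a ≡ b [SMOD (I ^ n • ⊤ : Submodule A A)] ↔ a - b ∈ I ^ n := by
  rw [SModEq.sub_mem, smul_eq_mul, Ideal.mul_top]

theorem eq_of_forall_sub_mem {A : Type*} [CommRing A] {I : Ideal A} [IsHausdorff I A] {a b : A}
    (h : ∀ n : ℕ, a - b ∈ I ^ n) : a = b :=
  sub_eq_zero.1 (IsHausdorff.haus ‹_› (a - b) fun n => mem_of_sModEq.2 (by simpa using h n))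

/-- A ring complete for an ideal is complete for each element of the ideal. -/
theorem isAdicComplete_span_singleton {A : Type*} [CommRing A] {I : Ideal A} [IsAdicComplete I A]
    {x : A} (hx : x ∈ I) : IsAdicComplete (Ideal.span {x}) A := by
  refine { haus' := fun a ha => ?_, prec' := fun f hf => ?_ }
  · refine eq_of_forall_sub_mem (I := I) fun n => ?_
    have h := mem_of_sModEq.1 (ha n)
    exact Ideal.pow_right_mono ((Ideal.span_singleton_le_iff_mem _).2 hx) n h
  · have h1 : ∀ n, ∃ g, f (n + 1) - f n = x ^ n * g := fun n => by
      have h := mem_of_sModEq.1 (hf n.le_succ).symm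
      rw [Ideal.span_singleton_pow, Ideal.mem_span_singleton] at h
      exact h
    choose g hg using h1
    have h2 : ∀ m, ∃ s, ∀ N, (∑ j ∈ Finset.range N, x ^ j * g (m + j)) - s ∈ I ^ N := fun m => by
      obtain ⟨s, hs⟩ := IsPrecomplete.prec (I := I) inferInstance
        (f := fun N => ∑ j ∈ Finset.range N, x ^ j * g (m + j)) (fun {a b} hab => by
          rw [mem_of_sModEq, ← Finset.sum_range_add_sum_Ico _ hab, sub_add_cancel_left]
          refine neg_mem (sum_mem fun j hj => Ideal.mul_mem_right _ _ ?_)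
          exact Ideal.pow_le_pow_right (Finset.mem_Ico.1 hj).1 (Ideal.pow_mem_pow hx j))
      exact ⟨s, fun N => mem_of_sModEq.1 (hs N)⟩
    choose s hs using h2
    have h3 : ∀ m, s m = g m + x * s (m + 1) := fun m => by
      refine eq_of_forall_sub_mem (I := I) fun N => ?_
      have e1 := hs m (N + 1)
      have e2 := hs (m + 1) N
      rw [Finset.sum_range_succ'] at e1
      simp only [pow_zero, one_mul, add_zero] at e1
      have e3 : ∑ j ∈ Finset.range N, x ^ (j + 1) * g (m + (j + 1)) =
          x * ∑ j ∈ Finset.range N, x ^ j * g (m + 1 + j) := by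
        rw [Finset.mul_sum]
        refine Finset.sum_congr rfl fun j _ => ?_
        rw [pow_succ', mul_assoc, add_assoc, add_comm 1 j]
      rw [e3] at e1
      have e4 := Ideal.pow_le_pow_right N.le_succ e1
      have e5 := Ideal.mul_mem_left _ x e2
      have e6 := sub_mem e5 e4
      convert e6 using 1
      ring
    refine ⟨f 0 + s 0, fun m => ?_⟩
    have h4 : ∀ m, f m + x ^ m * s m = f 0 + s 0 := by
      intro m
      induction m with
      | zero => simp
      | succ m ih =>
        rw [← ih, h3 m, pow_succ]
        linear_combination hg m
    rw [mem_of_sModEq, ← h4 m, sub_add_cancel_left, Ideal.span_singleton_pow]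
    exact neg_mem (Ideal.mem_span_singleton.2 ⟨_, rfl⟩)

section MulLeft

variable {P : Type u} [CommRing P] {𝔞 : Ideal P}

variable {p : ℕ}

theorem map_mulLeft_p (d : AdicCompletion 𝔞 P) :
    AdicCompletion.map 𝔞 (LinearMap.mulLeft P (p : P)) d = p * d := by
  have h1 : AdicCompletion.map 𝔞 (LinearMap.mulLeft P (p : P)) 1 =
      (p : AdicCompletion 𝔞 P) := by
    refine (AdicCompletion.map_of 𝔞 (LinearMap.mulLeft P (p : P)) 1).trans ?_
    rw [LinearMap.mulLeft_apply, mul_one]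
    exact map_natCast (algebraMap P (AdicCompletion 𝔞 P)) p
  calc _ = AdicCompletion.map 𝔞 (LinearMap.mulLeft P (p : P)) (d • 1) := by
        rw [smul_eq_mul, mul_one]
    _ = p * d := by rw [map_smul, h1, smul_eq_mul, mul_comm]

end MulLeft

section Completion

instance fact_fg_of_isNoetherianRing {P : Type u} [CommRing P] [IsNoetherianRing P] (𝔞 : Ideal P) :
    Fact 𝔞.FG := ⟨IsNoetherian.noetherian 𝔞⟩

variable {P : Type u} [CommRing P] (𝔞 : Ideal P)

/-- The ideal of the completion generated by `𝔞`. -/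
abbrev completionIdeal : Ideal (AdicCompletion 𝔞 P) := 𝔞.map (algebraMap P (AdicCompletion 𝔞 P))

variable {𝔞} [Fact 𝔞.FG]

theorem mem_completionIdeal_pow_iff (d : AdicCompletion 𝔞 P) (n : ℕ) :
    d ∈ completionIdeal 𝔞 ^ n ↔ AdicCompletion.evalₐ 𝔞 n d = 0 := by
  have h := AdicCompletion.pow_smul_top_eq_ker_eval (I := 𝔞) (M := P) (n := n)
    Fact.out
  rw [Ideal.smul_top_eq_map, Ideal.map_pow] at h
  have h1 : d ∈ completionIdeal 𝔞 ^ n ↔ d ∈ (AdicCompletion.eval 𝔞 P n).ker := by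
    rw [← h]
    rfl
  rw [h1, LinearMap.mem_ker]
  have e : 𝔞 ^ n • ⊤ = 𝔞 ^ n := by rw [smul_eq_mul, Ideal.mul_top]
  rw [← AdicCompletion.factor_eval_eq_evalₐ 𝔞 d e.le]
  obtain ⟨a, ha⟩ := Submodule.Quotient.mk_surjective _ (AdicCompletion.eval 𝔞 P n d)
  rw [← ha, Submodule.Quotient.mk_eq_zero]
  exact (SetLike.ext_iff.1 e a).trans Ideal.Quotient.eq_zero_iff_mem.symm

instance isAdicComplete_completionIdeal :
    IsAdicComplete (completionIdeal 𝔞) (AdicCompletion 𝔞 P) :=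
  (IsAdicComplete.map_algebraMap_iff 𝔞 _).2 (AdicCompletion.isAdicComplete
    Fact.out)

theorem exists_sub_mem_completionIdeal_pow (d : AdicCompletion 𝔞 P) (n : ℕ) :
    ∃ a : P, d - algebraMap P _ a ∈ completionIdeal 𝔞 ^ n := by
  obtain ⟨a, ha⟩ := Ideal.Quotient.mk_surjective (AdicCompletion.evalₐ 𝔞 n d)
  refine ⟨a, (mem_completionIdeal_pow_iff _ _).2 ?_⟩
  rw [map_sub, ← ha, AlgHom.commutes]
  exact sub_self _

theorem algebraMap_mem_completionIdeal_pow_iff (a : P) (n : ℕ) :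
    algebraMap P (AdicCompletion 𝔞 P) a ∈ completionIdeal 𝔞 ^ n ↔ a ∈ 𝔞 ^ n := by
  rw [mem_completionIdeal_pow_iff, AlgHom.commutes]
  exact Ideal.Quotient.eq_zero_iff_mem

end Completion

section Noetherian

variable {P : Type u} [CommRing P] [IsNoetherianRing P] {𝔞 : Ideal P}

variable {p : ℕ}

theorem completion_torsionFree (htf : ∀ a : P, (p : P) * a = 0 → a = 0)
    (d : AdicCompletion 𝔞 P) (h : (p : AdicCompletion 𝔞 P) * d = 0) : d = 0 := by
  have hinj : Function.Injective (LinearMap.mulLeft P (p : P)) :=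
    (injective_iff_map_eq_zero _).2 htf
  refine (injective_iff_map_eq_zero _).1 (AdicCompletion.map_injective 𝔞 hinj) d ?_
  rw [map_mulLeft_p, h]

/-- The ideal `(p)` is closed in the completion. -/
theorem p_dvd_of_forall_mem_sup (htf : ∀ a : P, (p : P) * a = 0 → a = 0) (d : AdicCompletion 𝔞 P)
    (h : ∀ n, d ∈ Ideal.span {(p : AdicCompletion 𝔞 P)} ⊔ completionIdeal 𝔞 ^ n) :
    (p : AdicCompletion 𝔞 P) ∣ d := by
  have hex : Function.Exact (LinearMap.mulLeft P (p : P))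
      (Submodule.mkQ (Ideal.span {(p : P)})) := fun a => by
    rw [Submodule.mkQ_apply, Submodule.Quotient.mk_eq_zero, Ideal.mem_span_singleton]
    exact ⟨fun ⟨c, hc⟩ => ⟨c, hc.symm⟩, fun ⟨c, hc⟩ => ⟨c, hc.symm⟩⟩
  have hex' := AdicCompletion.map_exact (I := 𝔞) ((injective_iff_map_eq_zero _).2 htf) hex
    (Submodule.mkQ_surjective _)
  set q := AdicCompletion.map 𝔞 (Submodule.mkQ (Ideal.span {(p : P)}))
  have hH : IsHausdorff (completionIdeal 𝔞) (AdicCompletion 𝔞 (P ⧸ Ideal.span {(p : P)})) :=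
    ((IsAdicComplete.map_algebraMap_iff 𝔞 _).2 (AdicCompletion.isAdicComplete
      (IsNoetherian.noetherian 𝔞))).toIsHausdorff
  have hq : q d = 0 := hH.haus _ fun n => by
    obtain ⟨a, ha, b, hb, e⟩ := Submodule.mem_sup.1 (h n)
    obtain ⟨c, rfl⟩ := Ideal.mem_span_singleton.1 ha
    rw [SModEq.zero, ← e, map_add, ← map_mulLeft_p, (hex' _).2 ⟨c, rfl⟩, zero_add]
    have e1 : q b = b • q 1 := by rw [← map_smul, smul_eq_mul, mul_one]
    rw [e1]
    exact Submodule.smul_mem_smul hb trivial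
  obtain ⟨c, hc⟩ := (hex' d).1 hq
  exact ⟨c, by rw [← hc, map_mulLeft_p]⟩

end Noetherian

end

section

/-! ### Homomorphisms out of completions and out of Witt vectors -/

section CompletionLift

variable {P : Type u} [CommRing P] {𝔞 : Ideal P}
variable {T : Type u} [CommRing T]

theorem map_mem_pow_of_mem_completionIdeal {K : Ideal T} (F : AdicCompletion 𝔞 P →+* T) {N : ℕ}
    (hF : ∀ a ∈ 𝔞 ^ N, F (algebraMap P _ a) ∈ K) (n : ℕ) {d : AdicCompletion 𝔞 P}
    (hd : d ∈ completionIdeal 𝔞 ^ (N * n)) : F d ∈ K ^ n := by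
  have h : (completionIdeal 𝔞 ^ N).map F ≤ K := by
    rw [← Ideal.map_pow, Ideal.map_map]
    exact Ideal.map_le_iff_le_comap.2 hF
  rw [pow_mul] at hd
  have h1 := Ideal.mem_map_of_mem F hd
  rw [Ideal.map_pow] at h1
  exact Ideal.pow_right_mono h n h1

variable [Fact 𝔞.FG]

theorem completion_hom_ext (K : Ideal T) [IsHausdorff K T] {F G : AdicCompletion 𝔞 P →+* T} {N : ℕ}
    (hF : ∀ a ∈ 𝔞 ^ N, F (algebraMap P _ a) ∈ K)
    (h : F.comp (algebraMap P _) = G.comp (algebraMap P _)) : F = G := by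
  refine RingHom.ext fun d => eq_of_forall_sub_mem (I := K) fun n => ?_
  obtain ⟨a, ha⟩ := exists_sub_mem_completionIdeal_pow d (N * n)
  have h0 : F (algebraMap P _ a) = G (algebraMap P _ a) := RingHom.congr_fun h a
  have e : F d - G d = F (d - algebraMap P _ a) - G (d - algebraMap P _ a) := by
    rw [map_sub, map_sub, h0]
    ring
  rw [e]
  refine sub_mem (map_mem_pow_of_mem_completionIdeal F hF n ha)
    (map_mem_pow_of_mem_completionIdeal G (fun a ha => ?_) n ha)
  have h0 : F (algebraMap P _ a) = G (algebraMap P _ a) := RingHom.congr_fun h a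
  rw [← h0]
  exact hF a ha

theorem exists_completion_lift (K : Ideal T) [IsAdicComplete K T] (f : P →+* T) {N : ℕ}
    (hf : ∀ a ∈ 𝔞 ^ N, f a ∈ K) :
    ∃ F : AdicCompletion 𝔞 P →+* T, F.comp (algebraMap P _) = f := by
  have hle : ∀ n, 𝔞 ^ (N * n) ≤ (K ^ n).comap f := fun n => by
    rw [pow_mul]
    have h1 : (𝔞 ^ N).map f ≤ K := Ideal.map_le_iff_le_comap.2 hf
    rw [← Ideal.map_le_iff_le_comap, Ideal.map_pow]
    exact Ideal.pow_right_mono h1 n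
  let Φ : ∀ n, AdicCompletion 𝔞 P →+* T ⧸ K ^ n := fun n =>
    (Ideal.quotientMap (K ^ n) f (hle n)).comp (AdicCompletion.evalₐ 𝔞 (N * n)).toRingHom
  have hΦ : ∀ n d a, d - algebraMap P _ a ∈ completionIdeal 𝔞 ^ (N * n) →
      Φ n d = Ideal.Quotient.mk _ (f a) := fun n d a h => by
    rw [mem_completionIdeal_pow_iff, map_sub, sub_eq_zero] at h
    change Ideal.quotientMap (K ^ n) f (hle n) (AdicCompletion.evalₐ 𝔞 (N * n) d) = _
    rw [h, AlgHom.commutes]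
    exact Ideal.quotientMap_mk
  have hcomp : ∀ {m n : ℕ} (hmn : m ≤ n),
      (Ideal.Quotient.factorPow K hmn).comp (Φ n) = Φ m := fun {m n} hmn => by
    refine RingHom.ext fun d => ?_
    obtain ⟨a, ha⟩ := exists_sub_mem_completionIdeal_pow d (N * n)
    rw [RingHom.comp_apply, hΦ n d a ha,
      hΦ m d a (Ideal.pow_le_pow_right (Nat.mul_le_mul_left _ hmn) ha)]
    exact Ideal.Quotient.factor_mk _ _
  refine ⟨IsAdicComplete.liftRingHom K Φ hcomp, RingHom.ext fun a => ?_⟩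
  refine eq_of_forall_sub_mem (I := K) fun n => ?_
  rw [← Ideal.Quotient.eq, RingHom.comp_apply, IsAdicComplete.mk_liftRingHom]
  exact hΦ n _ a (by rw [sub_self]; exact zero_mem _)

end CompletionLift

variable {p : ℕ} [Fact p.Prime]

namespace PDRing

section

variable {P : Type u} [CommRing P] {𝔞 : Ideal P} [Fact 𝔞.FG] (B : PDRing.{u} p)

/-- As `x ^ p` is a multiple of `p` for `x` in the divided power ideal, a finitely generated ideal
that is mapped into the divided power ideal has a power that is mapped into `(p)`. -/
theorem exists_pow_map_mem_span_p (f : P →+* B.carrier) (hf : ∀ a ∈ 𝔞, f a ∈ B.ideal) :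
    ∃ N : ℕ, ∀ a ∈ 𝔞 ^ N, f a ∈ Ideal.span {(p : B.carrier)} := by
  obtain ⟨N, hN⟩ := Ideal.exists_pow_le_of_le_radical_of_fg
    (I := 𝔞) (J := (Ideal.span {(p : B.carrier)}).comap f) (fun a ha => ⟨p, by
      rw [Ideal.mem_comap, map_pow, Ideal.mem_span_singleton]
      exact p_dvd_pow (hf a ha)⟩) Fact.out
  exact ⟨N, fun a ha => hN ha⟩

theorem exists_completion_lift (f : P →+* B.carrier) (hf : ∀ a ∈ 𝔞, f a ∈ B.ideal) :
    ∃ F : AdicCompletion 𝔞 P →+* B.carrier, F.comp (algebraMap P _) = f := by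
  obtain ⟨N, hN⟩ := B.exists_pow_map_mem_span_p f hf
  have := B.complete
  exact FCrys.exists_completion_lift (Ideal.span {(p : B.carrier)}) f hN

variable {B}

theorem completion_hom_ext {F G : AdicCompletion 𝔞 P →+* B.carrier}
    (hF : ∀ a ∈ 𝔞, F (algebraMap P _ a) ∈ B.ideal)
    (h : F.comp (algebraMap P _) = G.comp (algebraMap P _)) : F = G := by
  obtain ⟨N, hN⟩ := B.exists_pow_map_mem_span_p (F.comp (algebraMap P _)) hF
  have := B.complete
  exact FCrys.completion_hom_ext (Ideal.span {(p : B.carrier)}) hN h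

end

section

variable {S : Type u} [CommRing S] [CharP S p] [PerfectRing S p] (B : PDRing.{u} p)

/-- The map `B / I → B / p` that sends `b` to `b ^ p`. -/
def residuePow : B.residue →+* ModP B.carrier p :=
  Ideal.Quotient.lift B.ideal
    { toFun b := Ideal.Quotient.mk (Ideal.span {(p : B.carrier)}) b ^ p
      map_one' := by rw [map_one, one_pow]
      map_zero' := by rw [map_zero, zero_pow (Fact.out : p.Prime).ne_zero]
      map_mul' a b := by rw [map_mul, mul_pow]
      map_add' a b := by
        obtain ⟨r, hr⟩ := exists_add_pow_prime_eq (Fact.out : p.Prime) a b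
        have h0 : Ideal.Quotient.mk (Ideal.span {(p : B.carrier)}) (p : B.carrier) = 0 :=
          Ideal.Quotient.eq_zero_iff_mem.2 (Ideal.mem_span_singleton_self _)
        rw [← map_pow, hr, map_add, map_add, map_mul, map_mul, map_mul, h0, map_pow, map_pow]
        ring }
    (fun b hb => by
      change Ideal.Quotient.mk (Ideal.span {(p : B.carrier)}) b ^ p = 0
      rw [← map_pow, Ideal.Quotient.eq_zero_iff_mem, Ideal.mem_span_singleton]
      exact p_dvd_pow hb)

theorem residuePow_mk (b : B.carrier) : B.residuePow (Ideal.Quotient.mk _ b) =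
    Ideal.Quotient.mk (Ideal.span {(p : B.carrier)}) b ^ p := rfl

variable {B}

/-- For a perfect ring `S`, a map `S → B / I` lifts to `W(S) → B`. -/
theorem exists_witt_lift (f : S →+* B.residue) : ∃ F : WittVector p S →+* B.carrier,
    ∀ w, Ideal.Quotient.mk B.ideal (F w) = f (WittVector.constantCoeff w) := by
  by_cases hp : IsUnit (p : B.carrier)
  · -- here `p` is a unit in the ideal, so that `B / I` is trivial
    have h1 : B.ideal = ⊤ := Ideal.eq_top_of_isUnit_mem _ B.p_mem hp
    have hsub : Subsingleton B.residue := Ideal.Quotient.subsingleton_iff.2 h1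
    have h2 : Subsingleton B.carrier := by
      have := B.complete
      refine ⟨fun a b => eq_of_forall_sub_mem (I := Ideal.span {(p : B.carrier)}) fun n => ?_⟩
      rw [Ideal.span_singleton_eq_top.2 hp, Ideal.top_pow]
      trivial
    exact ⟨⟨⟨⟨fun _ => 0, Subsingleton.elim _ _⟩, fun _ _ => Subsingleton.elim _ _⟩,
      Subsingleton.elim _ _, fun _ _ => Subsingleton.elim _ _⟩, fun _ => Subsingleton.elim _ _⟩
  · have : Fact (¬ IsUnit (p : B.carrier)) := ⟨hp⟩
    have := B.complete
    let g : S →+* PreTilt B.carrier p := Perfection.lift p S (ModP B.carrier p)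
      ((B.residuePow.comp f).comp (frobeniusEquiv S p).symm.toRingHom)
    refine ⟨(WittVector.fontaineTheta B.carrier p).comp (WittVector.map g), fun w => ?_⟩
    have h1 := WittVector.mk_fontaineTheta (R := B.carrier) (p := p) (WittVector.map g w)
    have h2 : PreTilt.coeff 0 ((WittVector.map g w).coeff 0) =
        B.residuePow (f ((frobeniusEquiv S p).symm (w.coeff 0))) := by
      rw [WittVector.map_coeff]
      rfl
    rw [h2] at h1
    obtain ⟨b, hb⟩ := Ideal.Quotient.mk_surjective (f ((frobeniusEquiv S p).symm (w.coeff 0)))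
    rw [← hb, residuePow_mk, ← map_pow, Ideal.Quotient.eq] at h1
    have h3 : Ideal.span {(p : B.carrier)} ≤ B.ideal :=
      (Ideal.span_singleton_le_iff_mem _).2 B.p_mem
    have h4 := Ideal.Quotient.eq.2 (h3 h1)
    rw [RingHom.comp_apply, h4, map_pow, hb, ← map_pow, frobeniusEquiv_symm_pow_p]
    rfl

theorem dvd_sub_of_mem {a b : B.carrier} (h : a - b ∈ B.ideal) (n : ℕ) :
    (p : B.carrier) ^ (n + 1) ∣ a ^ p ^ (n + 1) - b ^ p ^ (n + 1) := by
  have h1 : (p : B.carrier) ∣ a ^ p - b ^ p := by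
    have h2 := B.residuePow_mk a
    rw [Ideal.Quotient.eq.2 h, residuePow_mk, ← map_pow, ← map_pow] at h2
    exact Ideal.mem_span_singleton.1 (Ideal.Quotient.eq.1 h2.symm)
  have h2 := dvd_sub_pow_of_dvd_sub h1 n
  rwa [← pow_mul, ← pow_mul, ← pow_succ'] at h2

/-- For a perfect ring `S`, the lift of a map `S → B / I` to `W(S) → B` is unique. -/
theorem witt_hom_ext {F G : WittVector p S →+* B.carrier} (h : ∀ w, F w - G w ∈ B.ideal) :
    F = G := by
  have := B.complete
  refine RingHom.ext fun w => eq_of_forall_sub_mem (I := Ideal.span {(p : B.carrier)}) fun n => ?_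
  rw [← Ideal.Quotient.eq]
  refine RingHom.congr_fun (WittVector.eq_of_apply_teichmuller_eq
    ((Ideal.Quotient.mk (Ideal.span {(p : B.carrier)} ^ n)).comp F)
    ((Ideal.Quotient.mk (Ideal.span {(p : B.carrier)} ^ n)).comp G) ⟨n, ?_⟩ fun x => ?_) w
  · rw [← map_natCast (Ideal.Quotient.mk _), ← map_pow, Ideal.Quotient.eq_zero_iff_mem]
    exact Ideal.pow_mem_pow (Ideal.mem_span_singleton_self _) n
  · let y : S := (frobeniusEquiv S p).symm^[n + 1] x
    have hy : y ^ p ^ (n + 1) = x := by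
      rw [← iterate_frobenius]
      exact Function.LeftInverse.iterate (f := (frobeniusEquiv S p).symm)
        (g := frobenius S p) (frobenius_apply_frobeniusEquiv_symm S p) (n + 1) x
    have hx : WittVector.teichmuller p x = WittVector.teichmuller p y ^ p ^ (n + 1) := by
      rw [← map_pow, hy]
    rw [RingHom.comp_apply, RingHom.comp_apply, hx, map_pow F, map_pow G, Ideal.Quotient.eq,
      Ideal.span_singleton_pow, Ideal.mem_span_singleton]
    exact (pow_dvd_pow _ n.le_succ).trans (dvd_sub_of_mem (h _) n)

end

end PDRing

end

section

/-! ### Frobenius lifts and Witt vectors -/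

section Dwork

variable {p : ℕ} {D : Type u} [CommRing D]

/-- The Witt coordinates of the Witt vector with ghost components `d, φ d, φ (φ d), …`, for `φ` a
lift of Frobenius. -/
def dworkCoeff (p : ℕ) (φ : D →+* D) (d : D) : ℕ → D
  | n => Classical.epsilon fun x => (p : D) ^ n * x =
      φ^[n] d - ∑ i : Fin n, (p : D) ^ (i : ℕ) * dworkCoeff p φ d i ^ p ^ (n - i)

theorem dvd_pow_sub_pow_of_frobenius_lift [Fact p.Prime] {φ : D →+* D}
    (hφ : ∀ d, (p : D) ∣ φ d - d ^ p) (c : D) {m i : ℕ} (h : i ≤ m) :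
    (p : D) ^ (m + 1) ∣ (p : D) ^ i * φ c ^ p ^ (m - i) - (p : D) ^ i * c ^ p ^ (m + 1 - i) := by
  obtain ⟨j, rfl⟩ := Nat.exists_eq_add_of_le h
  have h1 := dvd_sub_pow_of_dvd_sub (hφ c) j
  rw [← pow_mul, ← pow_succ'] at h1
  rw [← mul_sub, add_tsub_cancel_left, add_assoc, add_tsub_cancel_left, pow_add]
  exact mul_dvd_mul_left _ h1

theorem sum_dworkCoeff [Fact p.Prime] {φ : D →+* D} (hφ : ∀ d, (p : D) ∣ φ d - d ^ p) (d : D)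
    (n : ℕ) : ∑ i ∈ Finset.range (n + 1), (p : D) ^ i * dworkCoeff p φ d i ^ p ^ (n - i) =
      φ^[n] d := by
  induction n using Nat.strong_induction_on with
  | _ n ih =>
    have h : ∃ x, (p : D) ^ n * x =
        φ^[n] d - ∑ i ∈ Finset.range n, (p : D) ^ i * dworkCoeff p φ d i ^ p ^ (n - i) := by
      cases n with
      | zero => exact ⟨d, by simp⟩
      | succ m =>
        rw [Function.iterate_succ_apply', ← ih m m.lt_succ_self, map_sum, ← Finset.sum_sub_distrib]
        refine (Finset.dvd_sum fun i hi => ?_ :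
          (p : D) ^ (m + 1) ∣ _).imp fun x hx => hx.symm
        rw [map_mul, map_pow, map_pow, map_natCast]
        exact dvd_pow_sub_pow_of_frobenius_lift hφ _ (Nat.lt_succ_iff.1 (Finset.mem_range.1 hi))
    simp only [← Fin.sum_univ_eq_sum_range
      (fun i => (p : D) ^ i * dworkCoeff p φ d i ^ p ^ (n - i)) n] at h
    have h1 := Classical.epsilon_spec h
    rw [Finset.sum_range_succ, Nat.sub_self, pow_zero, pow_one,
      ← Fin.sum_univ_eq_sum_range (fun i => (p : D) ^ i * dworkCoeff p φ d i ^ p ^ (n - i)) n]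
    conv_lhs => rw [dworkCoeff.eq_def p φ d n]
    rw [h1]
    ring

theorem ghostComponent_eq_sum [Fact p.Prime] (n : ℕ) (x : WittVector p D) :
    WittVector.ghostComponent n x =
      ∑ i ∈ Finset.range (n + 1), (p : D) ^ i * x.coeff i ^ p ^ (n - i) := by
  rw [WittVector.ghostComponent_apply, aeval_wittPolynomial]

theorem ghostComponent_injective [Fact p.Prime] (htf : ∀ d : D, (p : D) * d = 0 → d = 0)
    {x y : WittVector p D}
    (h : ∀ n, WittVector.ghostComponent n x = WittVector.ghostComponent n y) : x = y := by
  have htf' : ∀ (n : ℕ) (d : D), (p : D) ^ n * d = 0 → d = 0 := fun n => by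
    induction n with
    | zero => intro d hd; simpa using hd
    | succ n ih => intro d hd; exact htf d (ih _ (by rw [← hd]; ring))
  refine WittVector.ext fun n => ?_
  induction n using Nat.strong_induction_on with
  | _ n ih =>
    have h1 := h n
    rw [ghostComponent_eq_sum, ghostComponent_eq_sum, Finset.sum_range_succ,
      Finset.sum_range_succ, Nat.sub_self, pow_zero, pow_one, pow_one,
      Finset.sum_congr rfl fun i hi => by rw [ih i (Finset.mem_range.1 hi)], add_right_inj,
      ← sub_eq_zero, ← mul_sub] at h1
    exact sub_eq_zero.1 (htf' n _ h1)

/-- A `p`-torsion-free ring with a lift `φ` of Frobenius maps to its Witt vectors, such that the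
ghost components of the image of `d` are the `φ ^ n (d)`. -/
def dworkLift [Fact p.Prime] (htf : ∀ d : D, (p : D) * d = 0 → d = 0) (φ : D →+* D)
    (hφ : ∀ d, (p : D) ∣ φ d - d ^ p) : D →+* WittVector p D :=
  have h : ∀ d n, WittVector.ghostComponent n (WittVector.mk p (dworkCoeff p φ d)) = φ^[n] d :=
    fun d n => by rw [ghostComponent_eq_sum]; exact sum_dworkCoeff hφ d n
  { toFun d := WittVector.mk p (dworkCoeff p φ d)
    map_one' := ghostComponent_injective htf fun n => by rw [h, map_one, iterate_map_one]
    map_zero' := ghostComponent_injective htf fun n => by rw [h, map_zero, iterate_map_zero]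
    map_mul' a b := ghostComponent_injective htf fun n => by
      rw [map_mul, h, h, h, iterate_map_mul]
    map_add' a b := ghostComponent_injective htf fun n => by
      rw [map_add, h, h, h, iterate_map_add] }

theorem constantCoeff_dworkLift [Fact p.Prime] (htf : ∀ d : D, (p : D) * d = 0 → d = 0)
    (φ : D →+* D) (hφ : ∀ d, (p : D) ∣ φ d - d ^ p) (d : D) :
    WittVector.constantCoeff (dworkLift htf φ hφ d) = d := by
  have h := sum_dworkCoeff hφ d 0
  rw [zero_add, Finset.sum_range_one, pow_zero, Nat.sub_self, pow_zero, pow_one, one_mul] at h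
  exact h

end Dwork

variable {p : ℕ} [Fact p.Prime] {X : Scheme.{u}} {E : FIsocrystal.{u} p X} {L₁ L₂ : SubFCrystal E}

theorem over_wittPoint {R : PDRing.{u} p} (hI : R.ideal = Ideal.span {(p : R.carrier)})
    {K : Type u} [Field K] [CharP K p] [PerfectRing K p] (F : R.carrier →+* WittVector p K)
    (χ : R.residue →+* K)
    (hF : ∀ d, WittVector.constantCoeff (F d) = χ (Ideal.Quotient.mk _ d)) (x : R.Point X) :
    (PDRing.Hom.ofIdealP (S := wittPDRing p K) hI F).Over x
      (wittPoint (Spec.map (CommRingCat.ofHom χ) ≫ x.hom)) := by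
  have h0 : x.hom = Spec.map (CommRingCat.ofHom (RingHom.id R.residue)) ≫ x.hom := by
    rw [CommRingCat.ofHom_id, Spec.map_id, Category.id_comp]
  refine PDRing.Hom.over_of_comp (S := wittPDRing p K) (c := RingHom.id R.residue)
    (c' := wittResidue p K) (g := χ) (fun s => ?_) (a := x.hom) h0 (wittPoint_hom _)
  obtain ⟨d, rfl⟩ := Ideal.Quotient.mk_surjective s
  have h1 := wittResidue_coeff (F d)
  rw [hF] at h1
  exact h1.symm

/-- On a `p`-torsion-free object that has a lift of Frobenius and is reduced modulo `p`, agreement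
can be tested at geometric points: the lift of Frobenius gives maps `R → W(R / p) → W(K)`, for
`K` the algebraic closures of the residue fields of `R / p`. -/
theorem SubFCrystal.AgreeOn.of_forall_agreeAt {R : PDRing.{u} p} (hR : R.TorsionFree)
    (hI : R.ideal = Ideal.span {(p : R.carrier)}) (hrad : IsRadical (p : R.carrier))
    (φ : R.carrier →+* R.carrier) (hφ : ∀ d, (p : R.carrier) ∣ φ d - d ^ p) (x : R.Point X)
    (h : ∀ (K : Type u) [Field K] [CharP K p] [PerfectRing K p]
      (y : Spec (CommRingCat.of K) ⟶ X), L₁.AgreeAt L₂ y) : L₁.AgreeOn L₂ R x := by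
  let I := {q : Ideal R.carrier // q.IsPrime ∧ (p : R.carrier) ∈ q}
  have (q : I) : q.1.IsPrime := q.2.1
  let K (q : I) : Type u := AlgebraicClosure q.1.ResidueField
  let χ (q : I) : R.carrier →+* K q :=
    (algebraMap q.1.ResidueField (K q)).comp (algebraMap R.carrier q.1.ResidueField)
  have hχ (q : I) (d : R.carrier) : χ q d = 0 ↔ d ∈ q.1 := by
    rw [RingHom.comp_apply, map_eq_zero, Ideal.algebraMap_residueField_eq_zero]
  have (q : I) : CharP (K q) p := by
    refine (CharP.charP_iff_prime_eq_zero (Fact.out : p.Prime)).2 ?_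
    rw [← map_natCast (χ q), hχ]
    exact q.2.2
  have hle (q : I) : R.ideal ≤ q.1 := by
    rw [hI, Ideal.span_singleton_le_iff_mem]
    exact q.2.2
  let χ' (q : I) : R.residue →+* K q :=
    Ideal.Quotient.lift R.ideal (χ q) fun a ha => (hχ q a).2 (hle q ha)
  let F (q : I) : R.carrier →+* WittVector p (K q) :=
    (WittVector.map (χ q)).comp (dworkLift hR φ hφ)
  have hF (q : I) (d : R.carrier) : WittVector.constantCoeff (F q d) = χ q d :=
    (WittVector.map_coeff (χ q) (dworkLift hR φ hφ d) 0).trans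
      (congrArg (χ q) (constantCoeff_dworkLift hR φ hφ d))
  refine AgreeOn.of_forall (S := fun q : I => wittPDRing p (K q))
    (fun q => wittPDRing_torsionFree p (K q))
    (f := fun q => PDRing.Hom.ofIdealP hI (F q)) (fun r hr => ?_)
    (y := fun q => wittPoint (Spec.map (CommRingCat.ofHom (χ' q)) ≫ x.hom))
    (fun q => ?_) (fun q => (agreeAt_iff _).1 (h _ _))
  · have h1 : r ∈ (Ideal.span {(p : R.carrier)}).radical := by
      rw [Ideal.radical_eq_sInf, Ideal.mem_sInf]
      rintro q ⟨hq, hqp⟩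
      let q' : I := ⟨q, hqp, hq (Ideal.mem_span_singleton_self _)⟩
      rw [← hχ q', ← hF q']
      exact (p_dvd_iff_constantCoeff (S := K q') (F q' r)).1 (hr q')
    obtain ⟨n, hn⟩ := h1
    exact hrad n r (Ideal.mem_span_singleton.1 hn)
  · exact over_wittPoint hI (F q) (χ' q) (hF q) x

end

section

/-! ### Frobenius on polynomial rings -/

section Cartier

variable (p : ℕ) [Fact p.Prime] {ι : Type*} {k : Type u} [Field k] [CharP k p] [PerfectRing k p]

theorem smul_injective_finsupp : Function.Injective fun m : ι →₀ ℕ => p • m := fun a b h =>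
  Finsupp.ext fun i => Nat.eq_of_mul_eq_mul_left (Fact.out : p.Prime).pos (by
    simpa using DFunLike.congr_fun h i)

/-- The left inverse `∑ c_m x ^ m ↦ ∑ c_{pm} ^ {1/p} x ^ m` of the Frobenius of a polynomial ring
over a perfect field. -/
def frobeniusRetract (f : MvPolynomial ι k) : MvPolynomial ι k :=
  ∑ m ∈ f.support.preimage (fun m => p • m) (smul_injective_finsupp p).injOn,
    MvPolynomial.monomial m ((frobeniusEquiv k p).symm (f.coeff (p • m)))

theorem coeff_frobeniusRetract (f : MvPolynomial ι k) (m : ι →₀ ℕ) :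
    (frobeniusRetract p f).coeff m = (frobeniusEquiv k p).symm (f.coeff (p • m)) := by
  classical
  rw [frobeniusRetract, MvPolynomial.coeff_sum]
  simp only [MvPolynomial.coeff_monomial]
  rw [Finset.sum_ite_eq']
  split_ifs with h
  · rfl
  · rw [Finset.mem_preimage, MvPolynomial.notMem_support_iff] at h
    rw [h, map_zero]

theorem frobeniusRetract_add (f g : MvPolynomial ι k) :
    frobeniusRetract p (f + g) = frobeniusRetract p f + frobeniusRetract p g := by
  ext m
  simp only [MvPolynomial.coeff_add, coeff_frobeniusRetract, map_add]

theorem frobeniusRetract_zero : frobeniusRetract p (0 : MvPolynomial ι k) = 0 := by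
  ext m
  simp only [MvPolynomial.coeff_zero, coeff_frobeniusRetract, map_zero]

theorem frobeniusRetract_pow_mul (a b : MvPolynomial ι k) :
    frobeniusRetract p (a ^ p * b) = a * frobeniusRetract p b := by
  induction a using MvPolynomial.induction_on' with
  | monomial s c =>
    ext m
    have hle : p • s ≤ p • m ↔ s ≤ m := by
      simp [Finsupp.le_def, (Fact.out : p.Prime).pos]
    rw [MvPolynomial.monomial_pow, coeff_frobeniusRetract, MvPolynomial.coeff_monomial_mul',
      MvPolynomial.coeff_monomial_mul', coeff_frobeniusRetract, apply_ite (frobeniusEquiv k p).symm,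
      map_mul, map_zero, frobeniusEquiv_symm_pow]
    simp only [hle]
    have hsub : p • m - p • s = p • (m - s) := by
      ext i
      simp [Nat.mul_sub]
    rw [hsub]
  | add f g hf hg =>
    rw [add_pow_char, add_mul, frobeniusRetract_add, hf, hg, add_mul]

/-- The Frobenius of a polynomial ring over a perfect field has a linear left inverse, so ideals are
contracted from their extensions. -/
theorem mem_of_pow_mem_map_frobenius {I : Ideal (MvPolynomial ι k)} {a : MvPolynomial ι k}
    (h : a ^ p ∈ I.map (frobenius (MvPolynomial ι k) p)) : a ∈ I := by
  have h1 : ∀ f ∈ I.map (frobenius (MvPolynomial ι k) p), ∀ b, frobeniusRetract p (f * b) ∈ I := by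
    intro f hf
    refine Submodule.span_induction (fun f hf b => ?_) (fun b => ?_)
      (fun f g _ _ hf hg b => ?_) (fun g f _ ih b => ?_) hf
    · obtain ⟨g, hg, rfl⟩ := hf
      rw [frobenius_def, frobeniusRetract_pow_mul]
      exact Ideal.mul_mem_right _ _ hg
    · rw [zero_mul, frobeniusRetract_zero]
      exact zero_mem _
    · rw [add_mul, frobeniusRetract_add]
      exact add_mem (hf b) (hg b)
    · rw [smul_eq_mul, mul_comm g, mul_assoc]
      exact ih _
  have h2 := h1 _ h 1
  have h3 : frobeniusRetract p (1 : MvPolynomial ι k) = 1 := by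
    classical
    ext m
    rw [coeff_frobeniusRetract, MvPolynomial.coeff_one, MvPolynomial.coeff_one, apply_ite
      (frobeniusEquiv k p).symm, map_one, map_zero]
    congr 1
    have := (smul_injective_finsupp p).eq_iff (a := 0) (b := m)
    simpa using this
  rwa [frobeniusRetract_pow_mul, h3, mul_one] at h2

end Cartier

section WittPolynomial

variable {p : ℕ} [Fact p.Prime] {k : Type u} [Field k] [CharP k p] {n : ℕ}

/-- The polynomial ring `W(k)[x_1, …, x_n]`. -/
abbrev WittPoly (p : ℕ) [Fact p.Prime] (k : Type u) [Field k] (n : ℕ) : Type u :=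
  MvPolynomial (Fin n) (WittVector p k)

/-- Reduction modulo `p`. -/
def polyReduce (p : ℕ) [Fact p.Prime] (k : Type u) [Field k] [CharP k p] (n : ℕ) :
    WittPoly p k n →+* MvPolynomial (Fin n) k :=
  MvPolynomial.map WittVector.constantCoeff

theorem polyReduce_surjective : Function.Surjective (polyReduce p k n) :=
  MvPolynomial.map_surjective _ (WittVector.constantCoeff_surjective p)

theorem poly_torsionFree (a : WittPoly p k n)
    (h : (p : WittPoly p k n) * a = 0) : a = 0 := by
  ext1 m
  rw [← map_natCast MvPolynomial.C] at h
  have h1 := congrArg (MvPolynomial.coeff m) h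
  rw [MvPolynomial.coeff_C_mul, MvPolynomial.coeff_zero] at h1
  exact (mul_eq_zero.1 h1).resolve_left (WittVector.p_nonzero p k)

variable [PerfectRing k p]

theorem polyReduce_eq_zero_iff (a : WittPoly p k n) :
    polyReduce p k n a = 0 ↔ (p : WittPoly p k n) ∣ a := by
  rw [← map_natCast MvPolynomial.C, MvPolynomial.C_dvd_iff_dvd_coeff, MvPolynomial.ext_iff]
  simp only [polyReduce, MvPolynomial.coeff_map, MvPolynomial.coeff_zero, p_dvd_iff_constantCoeff]

/-- The lift of Frobenius given by `x_i ↦ x_i ^ p`. -/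
def polyFrob (p : ℕ) [Fact p.Prime] (k : Type u) [Field k] [CharP k p] (n : ℕ) :
    WittPoly p k n →+* WittPoly p k n :=
  MvPolynomial.eval₂Hom (MvPolynomial.C.comp WittVector.frobenius) fun i => MvPolynomial.X i ^ p

theorem p_dvd_polyFrob_sub (a : WittPoly p k n) :
    (p : WittPoly p k n) ∣ polyFrob p k n a - a ^ p := by
  have h : (polyReduce p k n).comp (polyFrob p k n) =
      (frobenius (MvPolynomial (Fin n) k) p).comp (polyReduce p k n) := by
    refine MvPolynomial.ringHom_ext (fun w => ?_) (fun i => ?_)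
    · simp [polyReduce, polyFrob, frobenius_def, WittVector.coeff_frobenius_charP]
    · simp [polyReduce, polyFrob, frobenius_def]
  rw [← polyReduce_eq_zero_iff, map_sub, map_pow, sub_eq_zero]
  exact RingHom.congr_fun h a

variable {𝔞 : Ideal (WittPoly p k n)}

/-- The completion modulo `p` is reduced: if `a ^ p` is in a high power of `𝔞` modulo `p`, it is in
the extension of a power of `𝔞` along Frobenius, and `a` is in that power. -/
theorem isRadical_p_completion :
    IsRadical (p : AdicCompletion 𝔞 (WittPoly p k n)) := by
  refine (isRadical_iff_pow_one_lt p (Fact.out : p.Prime).one_lt).2 fun d hd => ?_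
  refine p_dvd_of_forall_mem_sup poly_torsionFree d fun M => ?_
  set q := polyReduce p k n
  obtain ⟨N', hN'⟩ := Ideal.exists_pow_le_of_le_radical_of_fg (I := 𝔞.map q)
    (J := ((𝔞.map q) ^ M).map (frobenius _ p)) (fun x hx => ⟨M * p, by
      rw [pow_mul]
      exact Ideal.mem_map_of_mem (frobenius _ p) (Ideal.pow_mem_pow hx M)⟩)
    (IsNoetherian.noetherian _)
  set N := max N' M
  obtain ⟨a, ha⟩ := exists_sub_mem_completionIdeal_pow d N
  have h1 : d ^ p - (algebraMap (WittPoly p k n) _ a) ^ p ∈ completionIdeal 𝔞 ^ N :=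
    Ideal.mem_of_dvd _ (sub_dvd_pow_sub_pow _ _ p) ha
  obtain ⟨c, hc⟩ := hd
  obtain ⟨c₀, hc₀⟩ := exists_sub_mem_completionIdeal_pow c N
  have h2 : algebraMap (WittPoly p k n) (AdicCompletion 𝔞 _) (a ^ p - p * c₀) ∈
      completionIdeal 𝔞 ^ N := by
    have e : algebraMap (WittPoly p k n) (AdicCompletion 𝔞 _) (a ^ p - p * c₀) =
        (p : AdicCompletion 𝔞 _) * (c - algebraMap (WittPoly p k n) _ c₀) -
          (d ^ p - (algebraMap (WittPoly p k n) _ a) ^ p) := by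
      rw [hc, map_sub, map_mul, map_pow, map_natCast]
      ring
    rw [e]
    exact sub_mem (Ideal.mul_mem_left _ _ hc₀) h1
  rw [algebraMap_mem_completionIdeal_pow_iff] at h2
  have h3 := Ideal.mem_map_of_mem q h2
  have h4 : q (p * c₀) = 0 := (polyReduce_eq_zero_iff _).2 ⟨c₀, rfl⟩
  rw [map_sub, h4, sub_zero, map_pow, Ideal.map_pow] at h3
  have h5 := mem_of_pow_mem_map_frobenius p (hN' (Ideal.pow_le_pow_right (le_max_left _ _) h3))
  rw [← Ideal.map_pow] at h5
  obtain ⟨b, hb, e⟩ := (Ideal.mem_map_iff_of_surjective q polyReduce_surjective).1 h5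
  rw [← sub_eq_zero, ← map_sub, polyReduce_eq_zero_iff] at e
  obtain ⟨c', hc'⟩ := e
  have e : d = (p : AdicCompletion 𝔞 _) * (-algebraMap (WittPoly p k n) _ c') +
      (algebraMap (WittPoly p k n) _ b + (d - algebraMap (WittPoly p k n) _ a)) := by
    have h6 := congrArg (algebraMap (WittPoly p k n) (AdicCompletion 𝔞 (WittPoly p k n))) hc'
    rw [map_sub, map_mul, map_natCast] at h6
    linear_combination -h6
  rw [e]
  refine Ideal.add_mem _ (Ideal.mem_sup_left (Ideal.mul_mem_right _ _
    (Ideal.mem_span_singleton_self _))) (Ideal.mem_sup_right (add_mem ?_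
      (Ideal.pow_le_pow_right (le_max_right _ _) ha)))
  exact (algebraMap_mem_completionIdeal_pow_iff _ _).2 hb

/-- The lift of Frobenius on polynomials extends to the completion. -/
theorem exists_completion_frob (hp : (p : WittPoly p k n) ∈ 𝔞) :
    ∃ φ : AdicCompletion 𝔞 (WittPoly p k n) →+*
      AdicCompletion 𝔞 (WittPoly p k n), ∀ d, (p : AdicCompletion 𝔞 _) ∣
        φ d - d ^ p := by
  have h0 : ∀ a ∈ 𝔞, polyFrob p k n a ∈ 𝔞 := fun a ha => by
    have h1 := Ideal.mem_of_dvd _ (p_dvd_polyFrob_sub a) hp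
    have h2 := Ideal.pow_mem_of_mem 𝔞 ha p (Fact.out : p.Prime).pos
    simpa using add_mem h1 h2
  obtain ⟨φ, hφ⟩ := exists_completion_lift (N := 1) (completionIdeal 𝔞)
    ((algebraMap (WittPoly p k n) (AdicCompletion 𝔞 _)).comp (polyFrob p k n)) (fun a ha => by
      rw [pow_one] at ha
      exact Ideal.mem_map_of_mem _ (h0 a ha))
  have hφ' : ∀ a,
      φ (algebraMap (WittPoly p k n) _ a) = algebraMap (WittPoly p k n) _ (polyFrob p k n a) :=
    fun a => RingHom.congr_fun hφ a
  refine ⟨φ, fun d => p_dvd_of_forall_mem_sup poly_torsionFree _ fun N => ?_⟩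
  obtain ⟨a, ha⟩ := exists_sub_mem_completionIdeal_pow d N
  have h1 : d ^ p - (algebraMap (WittPoly p k n) _ a) ^ p ∈ completionIdeal 𝔞 ^ N :=
    Ideal.mem_of_dvd _ (sub_dvd_pow_sub_pow _ _ p) ha
  have h2 : φ (d - algebraMap (WittPoly p k n) _ a) ∈ completionIdeal 𝔞 ^ N :=
    map_mem_pow_of_mem_completionIdeal (N := 1) φ (fun a ha => by
      rw [pow_one] at ha
      rw [hφ']
      exact Ideal.mem_map_of_mem _ (h0 a ha)) N (by rwa [one_mul])
  obtain ⟨c, hc⟩ := p_dvd_polyFrob_sub a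
  have e : φ d - d ^ p = (p : AdicCompletion 𝔞 _) * algebraMap (WittPoly p k n) _ c +
      (φ (d - algebraMap (WittPoly p k n) _ a) -
        (d ^ p - (algebraMap (WittPoly p k n) _ a) ^ p)) := by
    have h3 := congrArg (algebraMap (WittPoly p k n) (AdicCompletion 𝔞 (WittPoly p k n))) hc
    rw [map_sub, map_mul, map_natCast, map_pow] at h3
    rw [map_sub, hφ']
    linear_combination h3
  rw [e]
  exact Ideal.add_mem _ (Ideal.mem_sup_left (Ideal.mul_mem_right _ _
    (Ideal.mem_span_singleton_self _))) (Ideal.mem_sup_right (sub_mem h2 h1))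

/-- The completion of a polynomial ring over `W(k)` along an ideal that contains `p`, as a divided
power ring with ideal `(p)`. -/
def completionPDRing (𝔞 : Ideal (WittPoly p k n))
    (hp : (p : WittPoly p k n) ∈ 𝔞) : PDRing.{u} p :=
  PDRing.ofP (AdicCompletion 𝔞 (WittPoly p k n))
    (isAdicComplete_span_singleton (I := completionIdeal 𝔞) (by
      rw [← map_natCast (algebraMap (WittPoly p k n) _)]
      exact Ideal.mem_map_of_mem _ hp))
    (completion_torsionFree poly_torsionFree)

theorem completionPDRing_torsionFree (hp : (p : WittPoly p k n) ∈ 𝔞) :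
    (completionPDRing 𝔞 hp).TorsionFree :=
  completion_torsionFree poly_torsionFree

/-- At the completion of a polynomial ring, agreement can be tested at points with values in perfect
fields. -/
theorem SubFCrystal.agreeOn_completionPDRing
    (hp : (p : WittPoly p k n) ∈ 𝔞) {X : Scheme.{u}}
    {E : FIsocrystal.{u} p X} {L₁ L₂ : SubFCrystal E} (x : (completionPDRing 𝔞 hp).Point X)
    (h : ∀ (K : Type u) [Field K] [CharP K p] [PerfectRing K p]
      (y : Spec (CommRingCat.of K) ⟶ X), L₁.AgreeAt L₂ y) :
    L₁.AgreeOn L₂ (completionPDRing 𝔞 hp) x := by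
  obtain ⟨φ, hφ⟩ := exists_completion_frob hp
  exact AgreeOn.of_forall_agreeAt (completionPDRing_torsionFree hp) rfl
    isRadical_p_completion φ hφ x h

end WittPolynomial

end

section

/-! ### Lifting smooth algebras -/

variable {p : ℕ} [Fact p.Prime] {k : Type u} [Field k] [CharP k p]
variable {A : Type u} [CommRing A] [Algebra k A]

variable (p k A) in
/-- A presentation of the `k`-algebra `A` as a quotient of a polynomial ring over `W(k)` by a
homomorphism `π` that is the given one on `k = W(k) / p`. -/
structure WittPresentation where
  n : ℕ
  π : WittPoly p k n →+* A
  surjective : Function.Surjective π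
  π_C : ∀ w, π (MvPolynomial.C w) = algebraMap k A (WittVector.constantCoeff w)

namespace WittPresentation

variable (p k A) in
theorem nonempty [Algebra.FiniteType k A] : Nonempty (WittPresentation p k A) := by
  obtain ⟨n, f, hf⟩ := Algebra.FiniteType.iff_quotient_mvPolynomial''.1
    (inferInstance : Algebra.FiniteType k A)
  refine ⟨⟨n, f.toRingHom.comp (polyReduce p k n), hf.comp polyReduce_surjective, fun w => ?_⟩⟩
  change f (polyReduce p k n (MvPolynomial.C w)) = _
  rw [polyReduce, MvPolynomial.map_C]
  exact f.commutes _

variable (Q : WittPresentation p k A)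

/-- The kernel of the presentation. -/
abbrev ker : Ideal (WittPoly p k Q.n) := RingHom.ker Q.π

theorem p_mem_ker : (p : WittPoly p k Q.n) ∈ Q.ker := by
  rw [RingHom.mem_ker, map_natCast, ← map_natCast (algebraMap k A), CharP.cast_eq_zero, map_zero]

variable [PerfectRing k p]

/-- The completion of the polynomial ring along the kernel of the presentation. -/
def ring : PDRing.{u} p := completionPDRing Q.ker Q.p_mem_ker

/-- The map from polynomials to the completion. -/
def of : WittPoly p k Q.n →+* Q.ring.carrier :=
  algebraMap (WittPoly p k Q.n) (AdicCompletion Q.ker (WittPoly p k Q.n))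

theorem ring_torsionFree : Q.ring.TorsionFree := completionPDRing_torsionFree Q.p_mem_ker

theorem ring_ideal : Q.ring.ideal = Ideal.span {(p : Q.ring.carrier)} := rfl

variable {Q} in
/-- A homomorphism `G : P^ → B` from the completion lifts the homomorphism `c : A → B / I`, in the
sense that it maps the kernel of the presentation `P → A` into `I` and induces `c`. -/
def Lifts {B : PDRing.{u} p} (G : Q.ring.Hom B) (c : A →+* B.residue) : Prop :=
  ∀ a, Ideal.Quotient.mk B.ideal (G.toRingHom (Q.of a)) = c (Q.π a)

theorem Lifts.of_mem_ker {Q : WittPresentation p k A} {B : PDRing.{u} p} {G : Q.ring.Hom B}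
    {c : A →+* B.residue} (hG : Lifts G c) {a : WittPoly p k Q.n} (ha : a ∈ Q.ker) :
    G.toRingHom (Q.of a) ∈ B.ideal := by
  rw [← Ideal.Quotient.eq_zero_iff_mem, hG, (RingHom.mem_ker).1 ha, map_zero]

theorem Lifts.comp {Q : WittPresentation p k A} {B T : PDRing.{u} p} {G : Q.ring.Hom B}
    {c : A →+* B.residue} (hG : Lifts G c) (h : B.Hom T) :
    Lifts (h.comp G) (h.residueMap.comp c) := fun a => by
  rw [RingHom.comp_apply, ← hG a]
  rfl

/-- A ring homomorphism from polynomials that lifts `c` extends to the completion. -/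
theorem exists_lifts {B : PDRing.{u} p} (c : A →+* B.residue) (f : WittPoly p k Q.n →+* B.carrier)
    (hf : ∀ a, Ideal.Quotient.mk B.ideal (f a) = c (Q.π a)) :
    ∃ G : Q.ring.Hom B, Lifts G c ∧ ∀ a, G.toRingHom (Q.of a) = f a := by
  obtain ⟨F, hF⟩ := B.exists_completion_lift (𝔞 := Q.ker) f (fun a ha => by
    rw [← Ideal.Quotient.eq_zero_iff_mem, hf, (RingHom.mem_ker).1 ha, map_zero])
  have hF' : ∀ a, F (Q.of a) = f a := fun a => RingHom.congr_fun hF a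
  refine ⟨PDRing.Hom.ofIdealP Q.ring_ideal F, fun a => ?_, hF'⟩
  rw [← hf a, ← hF']
  rfl

theorem Lifts.toRingHom_ext {Q : WittPresentation p k A} {B : PDRing.{u} p} {G G' : Q.ring.Hom B}
    {c : A →+* B.residue} (hG : Lifts G c) (hG' : Lifts G' c)
    (h : ∀ i, G.toRingHom (Q.of (MvPolynomial.X i)) = G'.toRingHom (Q.of (MvPolynomial.X i))) :
    G.toRingHom = G'.toRingHom := by
  refine PDRing.completion_hom_ext (𝔞 := Q.ker) (fun a ha => hG.of_mem_ker ha) ?_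
  have hC : (G.toRingHom.comp Q.of).comp MvPolynomial.C =
      (G'.toRingHom.comp Q.of).comp MvPolynomial.C := by
    refine PDRing.witt_hom_ext (S := k) fun w => ?_
    rw [← Ideal.Quotient.eq]
    exact (hG _).trans (hG' _).symm
  exact MvPolynomial.ringHom_ext (fun w => RingHom.congr_fun hC w) h

/-- Every `c : A → B / I` has lifts, with prescribed values of the coordinates. -/
theorem exists_lifts_of_forall {B : PDRing.{u} p} (c : A →+* B.residue) (b : Fin Q.n → B.carrier)
    (hb : ∀ i, Ideal.Quotient.mk B.ideal (b i) = c (Q.π (MvPolynomial.X i))) :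
    ∃ G : Q.ring.Hom B, Lifts G c ∧ ∀ i, G.toRingHom (Q.of (MvPolynomial.X i)) = b i := by
  obtain ⟨F, hF⟩ := PDRing.exists_witt_lift (B := B) (c.comp (algebraMap k A))
  obtain ⟨G, hG, hGf⟩ := Q.exists_lifts c (MvPolynomial.eval₂Hom F b) (fun a => by
    refine RingHom.congr_fun (f := (Ideal.Quotient.mk B.ideal).comp (MvPolynomial.eval₂Hom F b))
      (g := c.comp Q.π) (MvPolynomial.ringHom_ext (fun w => ?_) (fun i => ?_)) a
    · rw [RingHom.comp_apply, RingHom.comp_apply, MvPolynomial.coe_eval₂Hom, MvPolynomial.eval₂_C,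
        hF, Q.π_C]
      rfl
    · rw [RingHom.comp_apply, RingHom.comp_apply, MvPolynomial.coe_eval₂Hom, MvPolynomial.eval₂_X,
        hb])
  exact ⟨G, hG, fun i => by rw [hGf, MvPolynomial.coe_eval₂Hom, MvPolynomial.eval₂_X]⟩

/-- The ideal of the reduction modulo `p` of the completion that is generated by the kernel of the
presentation. -/
def residueIdeal : Ideal Q.ring.residue := Q.ker.map ((Ideal.Quotient.mk Q.ring.ideal).comp Q.of)

theorem isAdicComplete_residueIdeal : IsAdicComplete Q.residueIdeal Q.ring.residue := by
  let D := AdicCompletion Q.ker (WittPoly p k Q.n)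
  let K : Ideal D := Ideal.span {(p : D)}
  have e : Q.residueIdeal = (completionIdeal Q.ker).map (algebraMap D (D ⧸ K)) := by
    rw [completionIdeal, Ideal.map_map]
    rfl
  rw [e]
  have h1 : IsPrecomplete (completionIdeal Q.ker) (D ⧸ K) := by
    rw [← AdicCompletion.of_surjective_iff]
    have h2 := AdicCompletion.map_surjective (completionIdeal Q.ker) K.mkQ_surjective
    have h3 := AdicCompletion.of_surjective (completionIdeal Q.ker) D
    refine Function.Surjective.of_comp (g := K.mkQ) ?_
    have h4 : (AdicCompletion.of (completionIdeal Q.ker) (D ⧸ K)) ∘ K.mkQ =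
        AdicCompletion.map (completionIdeal Q.ker) K.mkQ ∘ AdicCompletion.of _ _ := by
      funext d
      exact (AdicCompletion.map_of (completionIdeal Q.ker) K.mkQ d).symm
    rw [h4]
    exact h2.comp h3
  have h5 : IsHausdorff ((completionIdeal Q.ker).map (algebraMap D (D ⧸ K))) (D ⧸ K) := by
    refine ⟨fun x hx => ?_⟩
    obtain ⟨d, rfl⟩ := Ideal.Quotient.mk_surjective x
    rw [Ideal.Quotient.eq_zero_iff_mem, Ideal.mem_span_singleton]
    refine p_dvd_of_forall_mem_sup poly_torsionFree d fun n => ?_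
    have h6 := mem_of_sModEq.1 (hx n)
    rw [sub_zero, ← Ideal.map_pow] at h6
    obtain ⟨b, hb, e⟩ := (Ideal.mem_map_iff_of_surjective _ Ideal.Quotient.mk_surjective).1 h6
    have h7 : d - b ∈ K := Ideal.Quotient.eq.1 e.symm
    rw [← sub_add_cancel d b]
    exact Ideal.add_mem _ (Ideal.mem_sup_left h7) (Ideal.mem_sup_right hb)
  have h8 : IsPrecomplete ((completionIdeal Q.ker).map (algebraMap D (D ⧸ K))) (D ⧸ K) :=
    IsPrecomplete.map_algebraMap_iff.2 h1
  exact { toIsHausdorff := h5, toIsPrecomplete := h8 }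

/-- As `A` is formally smooth, the reduction modulo `p` of the completion is an `A`-algebra. -/
theorem exists_section [Algebra.FormallySmooth k A] : ∃ σ : A →+* Q.ring.residue,
    ∀ a, Ideal.Quotient.mk Q.residueIdeal (σ (Q.π a)) =
      Ideal.Quotient.mk Q.residueIdeal (Ideal.Quotient.mk Q.ring.ideal (Q.of a)) := by
  let τ₀ : WittVector p k →+* Q.ring.residue :=
    ((Ideal.Quotient.mk Q.ring.ideal).comp Q.of).comp MvPolynomial.C
  have hτ₀ : ∀ w, WittVector.constantCoeff w = 0 → τ₀ w = 0 := fun w hw => by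
    obtain ⟨v, rfl⟩ := (p_dvd_iff_constantCoeff w).2 hw
    rw [map_mul, map_natCast, Q.ring.residue_p, zero_mul]
  let τ : k →+* Q.ring.residue := RingHom.liftOfSurjective WittVector.constantCoeff
    (WittVector.constantCoeff_surjective p) ⟨τ₀, fun w hw => hτ₀ w hw⟩
  have hτ : ∀ w, τ (WittVector.constantCoeff w) = τ₀ w := fun w =>
    RingHom.liftOfRightInverse_comp_apply _ _ _ _ _
  let _ : Algebra k Q.ring.residue := τ.toAlgebra
  let f₀ : A →+* Q.ring.residue ⧸ Q.residueIdeal := RingHom.liftOfSurjective Q.π Q.surjective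
    ⟨((Ideal.Quotient.mk Q.residueIdeal).comp (Ideal.Quotient.mk Q.ring.ideal)).comp Q.of,
      fun a ha => Ideal.Quotient.eq_zero_iff_mem.2 (Ideal.mem_map_of_mem _ ha)⟩
  have hf₀ : ∀ a, f₀ (Q.π a) =
      Ideal.Quotient.mk Q.residueIdeal (Ideal.Quotient.mk Q.ring.ideal (Q.of a)) := fun a =>
    RingHom.liftOfRightInverse_comp_apply _ _ _ _ _
  let f : A →ₐ[k] Q.ring.residue ⧸ Q.residueIdeal :=
    { f₀ with
      commutes' := fun c => by
        obtain ⟨w, rfl⟩ := WittVector.constantCoeff_surjective p c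
        change f₀ (algebraMap k A _) = Ideal.Quotient.mk Q.residueIdeal (τ _)
        rw [hτ, ← Q.π_C, hf₀]
        rfl }
  have := Q.isAdicComplete_residueIdeal
  obtain ⟨g, hg⟩ := Algebra.FormallySmooth.exists_mkₐ_comp_eq_of_isAdicComplete f
  exact ⟨g.toRingHom, fun a => (AlgHom.congr_fun hg (Q.π a)).trans (hf₀ a)⟩

section Section

variable [Algebra.FormallySmooth k A]

/-- A homomorphism from `A` to the reduction modulo `p` of the completion, which is a section of
the canonical map in the other direction. -/
def sect : A →+* Q.ring.residue := Q.exists_section.choose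

theorem Lifts.residueMap_sect {Q : WittPresentation p k A} {B : PDRing.{u} p} {G : Q.ring.Hom B}
    {c : A →+* B.residue} (hG : Lifts G c) (a : A) : G.residueMap (Q.sect a) = c a := by
  obtain ⟨b, rfl⟩ := Q.surjective a
  have h1 : Q.sect (Q.π b) - Ideal.Quotient.mk Q.ring.ideal (Q.of b) ∈ Q.residueIdeal :=
    Ideal.Quotient.eq.1 (Q.exists_section.choose_spec b)
  have h2 : Q.residueIdeal ≤ RingHom.ker G.residueMap := by
    refine Ideal.map_le_iff_le_comap.2 fun a ha => ?_
    exact Ideal.Quotient.eq_zero_iff_mem.2 (hG.of_mem_ker ha)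
  have h3 := (RingHom.mem_ker).1 (h2 h1)
  rw [map_sub, sub_eq_zero] at h3
  rw [h3, ← hG b]
  rfl

end Section

end WittPresentation

end

section

/-! ### Divided power algebras over torsion-free rings -/

variable {p : ℕ} [Fact p.Prime]

/-- Divisibility of `x ^ n` by `n!` within an ideal can be tested on generators. -/
theorem exists_factorial_mul_eq_pow {T : Type*} [CommRing T] {S : Set T}
    (hS : ∀ x ∈ S, ∀ n : ℕ, n ≠ 0 → ∃ y ∈ Ideal.span S, (n.factorial : T) * y = x ^ n) :
    ∀ x ∈ Ideal.span S, ∀ n : ℕ, n ≠ 0 → ∃ y ∈ Ideal.span S, (n.factorial : T) * y = x ^ n := by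
  intro x hx
  refine Submodule.span_induction hS (fun n hn => ⟨0, zero_mem _, by simp [hn]⟩)
    (fun x y _ _ hx hy n hn => ?_) (fun a x _ hx n hn => ?_) hx
  · have hx' : ∀ n, ∃ z, (n ≠ 0 → z ∈ Ideal.span S) ∧ (n.factorial : T) * z = x ^ n := fun n => by
      rcases eq_or_ne n 0 with rfl | hn
      · exact ⟨1, fun h => (h rfl).elim, by simp⟩
      · obtain ⟨z, hz, e⟩ := hx n hn
        exact ⟨z, fun _ => hz, e⟩
    have hy' : ∀ n, ∃ z, (n ≠ 0 → z ∈ Ideal.span S) ∧ (n.factorial : T) * z = y ^ n := fun n => by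
      rcases eq_or_ne n 0 with rfl | hn
      · exact ⟨1, fun h => (h rfl).elim, by simp⟩
      · obtain ⟨z, hz, e⟩ := hy n hn
        exact ⟨z, fun _ => hz, e⟩
    choose u hu eu using hx'
    choose v hv ev using hy'
    refine ⟨∑ i ∈ Finset.range (n + 1), u i * v (n - i), sum_mem fun i _ => ?_, ?_⟩
    · rcases eq_or_ne i 0 with rfl | hi
      · exact Ideal.mul_mem_left _ _ (hv _ (by simpa using hn))
      · exact Ideal.mul_mem_right _ _ (hu i hi)
    · rw [add_pow, Finset.mul_sum]
      refine Finset.sum_congr rfl fun i hi => ?_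
      rw [← eu, ← ev, ← Nat.choose_mul_factorial_mul_factorial
        (Nat.lt_succ_iff.1 (Finset.mem_range.1 hi))]
      push_cast
      ring
  · obtain ⟨z, hz, e⟩ := hx n hn
    refine ⟨a ^ n * z, Ideal.mul_mem_left _ _ hz, ?_⟩
    rw [smul_eq_mul, mul_pow, ← e]
    ring

section DPA

open DividedPowerAlgebra

variable {R : Type u} [CommRing R]

theorem exists_eq_sum_dp (f : DividedPowerAlgebra R R) :
    ∃ c : ℕ →₀ R, (c.sum fun m a => a • dp R m (1 : R)) = f := by
  have h := submodule_span_prod_dp_eq_top (R := R) (M := R) (v := fun _ : Unit => (1 : R))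
    (by rw [Set.range_const]; exact Ideal.span_singleton_one)
  have h1 : f ∈ Submodule.span R (Set.range fun m : ℕ => dp R m (1 : R)) := by
    have h2 : f ∈ (⊤ : Submodule R (DividedPowerAlgebra R R)) := trivial
    rw [← h] at h2
    refine Submodule.span_mono ?_ h2
    rintro _ ⟨n, rfl⟩
    exact ⟨n (), by simp [Finsupp.prod_fintype, dp_zero]⟩
  exact Finsupp.mem_span_range_iff_exists_finsupp.1 h1

theorem dp_pow_eq (m n : ℕ) (hm : m ≠ 0) : (dp R m (1 : R)) ^ n =
    (n.factorial : DividedPowerAlgebra R R) * (n.uniformBell m * dp R (n * m) (1 : R)) := by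
  rw [pow_dp, Multiset.multinomial_nsmul_singleton, ← mul_assoc, ← Nat.cast_mul]
  congr 2
  have h1 := Nat.multinomial_spec (Finset.range n) (fun _ => m)
  have h2 := Nat.uniformBell_mul_eq n hm
  rw [Finset.prod_const, Finset.sum_const, Finset.card_range, smul_eq_mul] at h1
  refine Nat.eq_of_mul_eq_mul_left (pow_pos m.factorial_pos n) ?_
  rw [h1, ← h2]
  ring

/-- The divided power algebra of `R` on one generator embeds into polynomials with denominators. -/
theorem dividedPowerAlgebra_torsionFree (h : IsAdicComplete (Ideal.span {(p : R)}) R)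
    (htf : ∀ b : R, (p : R) * b = 0 → b = 0) (f : DividedPowerAlgebra R R)
    (hf : (p : DividedPowerAlgebra R R) * f = 0) : f = 0 := by
  classical
  let _ : Algebra ℚ (FractionRing R) := ratAlgebraFractionRing h htf
  -- The homomorphism to polynomials over the total ring of fractions
  let φ : DividedPowerAlgebra R R →ₐ[R] Polynomial (FractionRing R) :=
    DividedPowerAlgebra.lift (DividedPowers.RatAlgebra.dividedPowers ⊤)
      (LinearMap.toSpanSingleton R _ Polynomial.X) (fun _ => trivial)
  have hφ : ∀ n, Polynomial.C (n.factorial : FractionRing R) * φ (dp R n (1 : R)) =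
      Polynomial.X ^ n := fun n => by
    have h1 := congrArg φ (natFactorial_mul_dp_eq (R := R) n (1 : R))
    rw [map_mul, map_natCast, map_pow] at h1
    have h2 : φ (dp R 1 (1 : R)) = Polynomial.X := by
      refine (lift_apply_dp _ _ _ _).trans ?_
      rw [DividedPowers.dpow_one _ (Submodule.mem_top), LinearMap.toSpanSingleton_apply, one_smul]
    rw [map_natCast, h1, h2]
  have hφ' : ∀ n m, (n.factorial : FractionRing R) * (φ (dp R n (1 : R))).coeff m =
      if m = n then 1 else 0 := fun n m => by
    rw [← Polynomial.coeff_C_mul, hφ, Polynomial.coeff_X_pow]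
  obtain ⟨c, rfl⟩ := exists_eq_sum_dp f
  have hc : ∀ m, c m = 0 := fun m => by
    have h1 := congrArg (fun q => (φ q).coeff m) hf
    simp only [map_mul, map_natCast, map_zero, Polynomial.coeff_zero] at h1
    rw [Finsupp.sum, map_sum, ← map_natCast Polynomial.C, Polynomial.coeff_C_mul,
      Polynomial.finsetSum_coeff, Finset.sum_eq_single m (fun j _ hj => by
        rw [map_smul, Polynomial.coeff_smul]
        have h2 := hφ' j m
        rw [if_neg (Ne.symm hj)] at h2
        rw [(isUnit_natCast_fractionRing h htf j.factorial_ne_zero).mul_right_eq_zero.1 h2,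
          smul_zero]) (fun hm => by rw [Finsupp.notMem_support_iff.1 hm, zero_smul, map_zero,
            Polynomial.coeff_zero]), map_smul, Polynomial.coeff_smul, Algebra.smul_def,
      mul_left_comm] at h1
    have h3 := congrArg (fun q => (m.factorial : FractionRing R) * q) h1
    have h4 := hφ' m m
    rw [if_pos rfl] at h4
    simp only [mul_zero] at h3
    rw [mul_left_comm, mul_left_comm (m.factorial : FractionRing R), h4, mul_one,
      ← map_natCast (algebraMap R (FractionRing R)), ← map_mul] at h3
    refine htf _ ((IsFractionRing.injective R (FractionRing R)) ?_)
    rw [mul_comm]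
    exact h3.trans (map_zero _).symm
  exact Finset.sum_eq_zero fun m _ => by
    change c m • _ = _
    rw [hc, zero_smul]

end DPA

end

section

/-! ### Completed divided power polynomial rings -/

variable {p : ℕ}

section Complete

variable {G : Type u} [CommRing G]

instance fact_fg_span_singleton (x : G) : Fact (Ideal.span {x}).FG := ⟨⟨{x}, by simp⟩⟩

variable (p G) in
/-- The `p`-adic completion. -/
abbrev PCompletion : Type u := AdicCompletion (Ideal.span {(p : G)}) G

theorem completionIdeal_span_p : completionIdeal (Ideal.span {(p : G)}) =
    Ideal.span {(p : PCompletion p G)} := by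
  rw [completionIdeal, Ideal.map_span, Set.image_singleton, map_natCast]

theorem isAdicComplete_pCompletion :
    IsAdicComplete (Ideal.span {(p : PCompletion p G)}) (PCompletion p G) := by
  rw [← completionIdeal_span_p]
  exact isAdicComplete_completionIdeal

theorem pCompletion_torsionFree (htf : ∀ g : G, (p : G) * g = 0 → g = 0) (d : PCompletion p G)
    (hd : (p : PCompletion p G) * d = 0) : d = 0 := by
  have := isAdicComplete_completionIdeal (𝔞 := Ideal.span {(p : G)})
  refine eq_of_forall_sub_mem (I := completionIdeal (Ideal.span {(p : G)})) fun n => ?_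
  rw [sub_zero]
  obtain ⟨a, ha⟩ := exists_sub_mem_completionIdeal_pow d (n + 1)
  have h1 : algebraMap G (PCompletion p G) (p * a) ∈
      completionIdeal (Ideal.span {(p : G)}) ^ (n + 1) := by
    have e : algebraMap G (PCompletion p G) (p * a) =
        -((p : PCompletion p G) * (d - algebraMap G _ a)) := by
      rw [map_mul, map_natCast, mul_sub, hd, zero_sub, neg_neg]
    rw [e]
    exact neg_mem (Ideal.mul_mem_left _ _ ha)
  rw [algebraMap_mem_completionIdeal_pow_iff, Ideal.span_singleton_pow,
    Ideal.mem_span_singleton] at h1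
  obtain ⟨c, hc⟩ := h1
  have h2 : a = p ^ n * c := sub_eq_zero.1 (htf _ (by
    rw [mul_sub, hc]
    ring))
  have h3 : algebraMap G (PCompletion p G) a ∈ completionIdeal (Ideal.span {(p : G)}) ^ n := by
    rw [algebraMap_mem_completionIdeal_pow_iff, Ideal.span_singleton_pow, Ideal.mem_span_singleton]
    exact ⟨c, h2⟩
  rw [← sub_add_cancel d (algebraMap G _ a)]
  exact add_mem (Ideal.pow_le_pow_right n.le_succ ha) h3

end Complete

variable [Fact p.Prime]

open DividedPowerAlgebra

/-- For a `p`-torsion-free divided power ring `R`, the `p`-completed divided power polynomial ring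
`R⟨s⟩` is again `p`-torsion-free, and one can choose the image of `s` in the divided power ideal
when extending a homomorphism `R → B` to `R⟨s⟩ → B`. -/
theorem exists_adjoin {R B : PDRing.{u} p} (hR : R.TorsionFree) (h₀ : R.Hom B) {ε : B.carrier}
    (hε : ε ∈ B.ideal) :
    ∃ (T : PDRing.{u} p) (a : R.Hom T) (h : T.Hom B) (s : T.carrier), T.TorsionFree ∧
      s ∈ T.ideal ∧ (∀ r, h.toRingHom (a.toRingHom r) = h₀.toRingHom r) ∧ h.toRingHom s = ε := by
  let Γ := DividedPowerAlgebra R.carrier R.carrier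
  let C := PCompletion p Γ
  let i : Γ →+* C := algebraMap Γ C
  let j : R.carrier →+* C := i.comp (algebraMap R.carrier Γ)
  let s : ℕ → C := fun m => i (dp R.carrier m (1 : R.carrier))
  have hs : ∀ m n, m ≠ 0 → s m ^ n = (n.factorial : C) * (n.uniformBell m * s (n * m)) :=
    fun m n hm => by
      have h1 := congrArg i (dp_pow_eq (R := R.carrier) m n hm)
      rw [map_pow, map_mul, map_mul] at h1
      exact h1.trans (congrArg₂ _ (map_natCast i _) (congrArg₂ _ (map_natCast i _) rfl))
  let S : Set C := j '' R.ideal ∪ s '' {m | m ≠ 0}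
  have hjS : ∀ r ∈ R.ideal, j r ∈ Ideal.span S := fun r hr =>
    Ideal.subset_span (Or.inl ⟨r, hr, rfl⟩)
  have hsS : ∀ m, m ≠ 0 → s m ∈ Ideal.span S := fun m hm =>
    Ideal.subset_span (Or.inr ⟨m, hm, rfl⟩)
  have hC : ∀ d : C, (p : C) * d = 0 → d = 0 :=
    pCompletion_torsionFree (dividedPowerAlgebra_torsionFree R.complete hR)
  let T : PDRing.{u} p := PDRing.ofTorsionFree C isAdicComplete_pCompletion hC (Ideal.span S)
    (by rw [← map_natCast j]; exact hjS _ R.p_mem)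
    (exists_factorial_mul_eq_pow (by
      rintro _ (⟨r, hr, rfl⟩ | ⟨m, hm, rfl⟩) n hn
      · refine ⟨j (R.γ.dpow n r), hjS _ (R.γ.dpow_mem hn hr), ?_⟩
        rw [← map_natCast j, ← map_mul, DividedPowers.factorial_mul_dpow_eq_pow _ hr, map_pow]
      · exact ⟨_, Ideal.mul_mem_left _ _ (hsS _ (mul_ne_zero hn hm)), (hs m n hm).symm⟩))
  have hT : T.TorsionFree := hC
  let a : R.Hom T := PDRing.Hom.ofTorsionFree hT j hjS
  let _ : Algebra R.carrier B.carrier := h₀.toRingHom.toAlgebra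
  let f : Γ →ₐ[R.carrier] B.carrier := DividedPowerAlgebra.lift B.γ
    (LinearMap.toSpanSingleton R.carrier B.carrier ε) (fun r => by
      rw [LinearMap.toSpanSingleton_apply, Algebra.smul_def]
      exact Ideal.mul_mem_left _ _ hε)
  have hf : ∀ m, f (dp R.carrier m (1 : R.carrier)) = B.γ.dpow m ε := fun m => by
    refine (lift_apply_dp _ _ _ _).trans ?_
    rw [LinearMap.toSpanSingleton_apply, one_smul]
  have := B.complete
  obtain ⟨F, hF⟩ := exists_completion_lift (N := 1) (Ideal.span {(p : B.carrier)}) f.toRingHom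
    (𝔞 := Ideal.span {(p : Γ)}) (fun g hg => by
      rw [pow_one] at hg
      obtain ⟨c, rfl⟩ := Ideal.mem_span_singleton.1 hg
      rw [map_mul, map_natCast]
      exact Ideal.mul_mem_right _ _ (Ideal.mem_span_singleton_self _))
  have hFs : ∀ m, F (s m) = B.γ.dpow m ε := fun m => (RingHom.congr_fun hF _).trans (hf m)
  have hFj : ∀ r, F (j r) = h₀.toRingHom r := fun r =>
    (RingHom.congr_fun hF _).trans (f.commutes r)
  let h : T.Hom B := PDRing.Hom.ofSpan (T := S) rfl F (by
      rintro _ (⟨r, hr, rfl⟩ | ⟨m, hm, rfl⟩)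
      · rw [hFj]
        exact Ideal.map_le_iff_le_comap.1 h₀.isDP.ideal_comp hr
      · rw [hFs]
        exact B.γ.dpow_mem hm hε) (by
      rintro n _ (⟨r, hr, rfl⟩ | ⟨m, hm, rfl⟩)
      · have h1 : T.γ.dpow n (j r) = j (R.γ.dpow n r) := a.isDP.dpow_comp _ hr
        rw [h1, hFj, hFj]
        exact h₀.isDP.dpow_comp _ hr
      · have h1 : T.γ.dpow n (s m) = n.uniformBell m * s (n * m) := by
          refine sub_eq_zero.1 (natCast_mul_cancel T.complete hT n.factorial_ne_zero ?_)
          rw [mul_sub, DividedPowers.factorial_mul_dpow_eq_pow _ (hsS m hm), sub_eq_zero]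
          exact hs m n hm
        rw [h1, map_mul, map_natCast, hFs, hFs]
        exact B.γ.dpow_comp hm hε)
  refine ⟨T, a, h, s 1, hT, hsS 1 one_ne_zero, hFj, (hFs 1).trans (B.γ.dpow_one hε)⟩

/-- Several divided power variables. -/
theorem exists_adjoin_fin {R B : PDRing.{u} p} (hR : R.TorsionFree) (h₀ : R.Hom B) (n : ℕ)
    (ε : Fin n → B.carrier) (hε : ∀ i, ε i ∈ B.ideal) :
    ∃ (T : PDRing.{u} p) (a : R.Hom T) (h : T.Hom B) (s : Fin n → T.carrier), T.TorsionFree ∧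
      (∀ i, s i ∈ T.ideal) ∧ (∀ r, h.toRingHom (a.toRingHom r) = h₀.toRingHom r) ∧
      ∀ i, h.toRingHom (s i) = ε i := by
  induction n with
  | zero => exact ⟨R, PDRing.Hom.id R, h₀, fun i => i.elim0, hR, fun i => i.elim0, fun _ => rfl,
      fun i => i.elim0⟩
  | succ n ih =>
    obtain ⟨T, a, h, s, hT, hs, ha, hsε⟩ := ih (fun i => ε i.castSucc) (fun i => hε _)
    obtain ⟨T', a', h', s', hT', hs', ha', hsε'⟩ := exists_adjoin hT h (hε (Fin.last n))
    refine ⟨T', a'.comp a, h', Fin.snoc (α := fun _ => T'.carrier) (fun i => a'.toRingHom (s i)) s',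
      hT', fun i => ?_, fun r => ?_, fun i => ?_⟩
    · induction i using Fin.lastCases with
      | last => rw [Fin.snoc_last]; exact hs'
      | cast i =>
        rw [Fin.snoc_castSucc]
        exact Ideal.map_le_iff_le_comap.1 a'.isDP.ideal_comp (hs i)
    · rw [← ha r]
      exact ha' _
    · induction i using Fin.lastCases with
      | last => rw [Fin.snoc_last]; exact hsε'
      | cast i =>
        rw [Fin.snoc_castSucc, ha']
        exact hsε i

end

section

/-! ### Comparison isomorphisms -/

variable {p : ℕ}

theorem PDRing.Hom.ext_toRingHom {R S : PDRing.{u} p} {f g : R.Hom S}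
    (h : f.toRingHom = g.toRingHom) : f = g := by
  cases f
  cases g
  cases h
  rfl

variable [Fact p.Prime] {X : Scheme.{u}} {E : FIsocrystal.{u} p X}

namespace SubFCrystal

variable {L₁ L₂ : SubFCrystal E} {R S T : PDRing.{u} p} {x : R.Point X} {y : S.Point X}
  {z : T.Point X}

variable (L₁ L₂) in
/-- The isomorphism `e` of the values of `L₁` and `L₂` at `(S, y)` is induced, along
`f : (R, x) → (S, y)`, by the equality of elements of `L₁` and `L₂` inside `E` at `(R, x)`. -/
def Compares (f : R.Hom S) (hf : f.Over x y) (e : L₁.obj S y ≃ₗ[S.carrier] L₂.obj S y) : Prop :=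
  ∀ m m', L₂.ι R x m' = L₁.ι R x m → e (L₁.map f hf m) = L₂.map f hf m'

theorem map_induction (L : SubFCrystal E) {f : R.Hom S} (hf : f.Over x y)
    {P : L.obj S y → Prop} (h : ∀ m, P (L.map f hf m)) (zero : P 0)
    (add : ∀ m n, P m → P n → P (m + n)) (smul : ∀ (s : S.carrier) m, P m → P (s • m)) (m) :
    P m := by
  have hm : m ∈ Submodule.span S.carrier (Set.range (L.map f hf)) :=
    (L.isBaseChange f hf).span_range ▸ Submodule.mem_top
  exact Submodule.span_induction (p := fun m _ => P m) (by rintro _ ⟨m, rfl⟩; exact h m) zero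
    (fun m n _ _ => add m n) (fun s m _ => smul s m) hm

theorem Compares.exists (hR : R.TorsionFree) (hx : L₁.AgreeOn L₂ R x) (f : R.Hom S)
    (hf : f.Over x y) : ∃ e, L₁.Compares L₂ f hf e := by
  obtain ⟨e₀, he₀⟩ := hx.exists_equiv hR
  obtain ⟨e, he⟩ := (L₁.isBaseChange f hf).exists_equiv (L₂.isBaseChange f hf) e₀
  refine ⟨e, fun m m' h => ?_⟩
  rw [he, L₂.ι_injective hR x ((he₀ m).trans h.symm)]

theorem Compares.unique (hx : L₁.AgreeOn L₂ R x) {f : R.Hom S} {hf : f.Over x y}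
    {e e' : L₁.obj S y ≃ₗ[S.carrier] L₂.obj S y} (h : L₁.Compares L₂ f hf e)
    (h' : L₁.Compares L₂ f hf e') : e = e' := by
  refine LinearEquiv.ext fun m => ?_
  induction m using L₁.map_induction hf with
  | h m =>
    obtain ⟨m', hm'⟩ := hx.1 m
    rw [h m m' hm', h' m m' hm']
  | zero => rw [map_zero, map_zero]
  | add m n hm hn => rw [map_add, map_add, hm, hn]
  | smul s m hm => rw [map_smul, map_smul, hm]

theorem Compares.congr {f f' : R.Hom S} {hf : f.Over x y} {hf' : f'.Over x y}
    (h : f.toRingHom = f'.toRingHom) {e : L₁.obj S y ≃ₗ[S.carrier] L₂.obj S y}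
    (he : L₁.Compares L₂ f hf e) : L₁.Compares L₂ f' hf' e := by
  obtain rfl := PDRing.Hom.ext_toRingHom h
  exact he

theorem Compares.precomp {g : S.Hom T} {hg : g.Over y z} {e : L₁.obj T z ≃ₗ[T.carrier] L₂.obj T z}
    (he : L₁.Compares L₂ g hg e) (f : R.Hom S) (hf : f.Over x y) :
    L₁.Compares L₂ (g.comp f) (hg.comp hf) e := fun m m' h => by
  have h1 : L₂.ι S y (L₂.map f hf m') = L₁.ι S y (L₁.map f hf m) := by
    rw [ι_map, ι_map, h]
  exact (congrArg e (L₁.map_comp g f hg hf m)).trans ((he _ _ h1).trans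
    (L₂.map_comp g f hg hf m').symm)

/-- The comparison along `S → T` is determined by its restriction along any `R → S`. -/
theorem Compares.of_precomp (hS : S.TorsionFree) (hx : L₁.AgreeOn L₂ R x) {g : S.Hom T}
    {hg : g.Over y z} {e : L₁.obj T z ≃ₗ[T.carrier] L₂.obj T z} {f : R.Hom S} {hf : f.Over x y}
    (he : L₁.Compares L₂ (g.comp f) (hg.comp hf) e) : L₁.Compares L₂ g hg e := by
  obtain ⟨e', he'⟩ := Compares.exists hS (hx.map hf) g hg
  rwa [he.unique hx (he'.precomp f hf)]

theorem Compares.map (hx : L₁.AgreeOn L₂ R x) {f : R.Hom S} {hf : f.Over x y} {g : S.Hom T}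
    {hg : g.Over y z} {e : L₁.obj S y ≃ₗ[S.carrier] L₂.obj S y}
    {e' : L₁.obj T z ≃ₗ[T.carrier] L₂.obj T z} (he : L₁.Compares L₂ f hf e)
    (he' : L₁.Compares L₂ (g.comp f) (hg.comp hf) e') (m : L₁.obj S y) :
    e' (L₁.map g hg m) = L₂.map g hg (e m) := by
  induction m using L₁.map_induction hf with
  | h m =>
    obtain ⟨m', hm'⟩ := hx.1 m
    rw [he m m' hm']
    exact ((congrArg e' (L₁.map_comp g f hg hf m)).symm.trans (he' m m' hm')).trans
      (L₂.map_comp g f hg hf m')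
  | zero => rw [map_zero, map_zero, map_zero, map_zero]
  | add m n hm hn => rw [map_add, map_add, map_add, map_add, hm, hn]
  | smul s m hm => rw [map_smulₛₗ, map_smul, map_smul, map_smulₛₗ, hm]

theorem Compares.ι (hx : L₁.AgreeOn L₂ R x) {f : R.Hom S} {hf : f.Over x y}
    {e : L₁.obj S y ≃ₗ[S.carrier] L₂.obj S y} (he : L₁.Compares L₂ f hf e) (m : L₁.obj S y) :
    L₂.ι S y (e m) = L₁.ι S y m := by
  induction m using L₁.map_induction hf with
  | h m =>
    obtain ⟨m', hm'⟩ := hx.1 m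
    rw [he m m' hm', ι_map, ι_map, hm']
  | zero => rw [map_zero, map_zero, map_zero]
  | add m n hm hn => rw [map_add, map_add, map_add, hm, hn]
  | smul s m hm => rw [map_smul, map_smulₛₗ, map_smulₛₗ, hm]

variable (L₁ L₂) in
/-- The isomorphism `e` is induced by every homomorphism from a `p`-torsion-free object on which
`L₁` and `L₂` agree. -/
def IsComparison (y : S.Point X) (e : L₁.obj S y ≃ₗ[S.carrier] L₂.obj S y) : Prop :=
  ∀ (R : PDRing.{u} p) (x : R.Point X) (f : R.Hom S) (hf : f.Over x y), R.TorsionFree →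
    L₁.AgreeOn L₂ R x → L₁.Compares L₂ f hf e

/-- Comparison isomorphisms at all objects form an isomorphism of `F`-crystals. -/
theorem eqInside_of_isComparison
    (hcov : ∀ (S : PDRing.{u} p) (y : S.Point X), ∃ (R : PDRing.{u} p) (x : R.Point X)
      (f : R.Hom S), f.Over x y ∧ R.TorsionFree ∧ L₁.AgreeOn L₂ R x ∧ L₁.AgreeOn L₂ R x.frob)
    (h : ∀ (S : PDRing.{u} p) (y : S.Point X), ∃ e, L₁.IsComparison L₂ y e) :
    L₁.EqInside L₂ := by
  choose e he using h
  refine ⟨e, fun S T g y z hg m => ?_, fun S y m => ?_, fun S y m => ?_⟩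
  · obtain ⟨R, x, f, hf, hR, hx, -⟩ := hcov S y
    exact Compares.map hx (he S y R x f hf hR hx) (he T z R x _ (hg.comp hf) hR hx) m
  · obtain ⟨R, x, f, hf, hR, hx, hx'⟩ := hcov S y
    induction m using L₁.map_induction hf.frob with
    | h m =>
      obtain ⟨m', hm'⟩ := hx'.1 m
      have h1 := he S y.frob R x.frob f hf.frob hR hx' m m' hm'
      rw [h1, ← L₁.frob_map f hf, ← L₂.frob_map f hf]
      refine he S y R x f hf hR hx _ _ ?_
      rw [ι_frob, ι_frob, hm']
    | zero => simp only [map_zero]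
    | add m n hm hn => simp only [map_add, hm, hn]
    | smul s m hm => simp only [map_smul, hm]
  · obtain ⟨R, x, f, hf, hR, hx, -⟩ := hcov S y
    exact (he S y R x f hf hR hx).ι hx m

end SubFCrystal

end

section

/-! ### Charts of a smooth scheme -/

variable {p : ℕ} [Fact p.Prime] {k : Type u} [Field k] [CharP k p]

variable (p k) in
/-- An affine open `Spec A` of `X`, with a formally smooth `k`-algebra structure on `A` and a
presentation of `A` as a quotient of a polynomial ring over `W(k)`. -/
structure SmoothChart (X : Scheme.{u}) where
  A : Type u
  [commRing : CommRing A]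
  [algebra : Algebra k A]
  [formallySmooth : Algebra.FormallySmooth k A]
  Q : WittPresentation p k A
  α : Spec (CommRingCat.of A) ⟶ X
  [isOpenImmersion : IsOpenImmersion α]

attribute [instance] SmoothChart.commRing SmoothChart.algebra SmoothChart.formallySmooth
  SmoothChart.isOpenImmersion

namespace SmoothChart

variable [PerfectRing k p] {X : Scheme.{u}} (V : SmoothChart p k X)

/-- The divided power ring of the chart. -/
abbrev ring : PDRing.{u} p := V.Q.ring

/-- The object of the crystalline site of `X` given by the chart: the reduction of the ring of the
chart is an `A`-algebra by the choice of a section, as `A` is formally smooth. -/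
def point : V.ring.Point X where
  hom := Spec.map (CommRingCat.ofHom (R := V.A) (S := V.ring.residue) V.Q.sect) ≫ V.α
  small := ⟨V.α.opensRange, isAffineOpen_opensRange V.α, fun _ => ⟨_, rfl⟩⟩

variable {V}

/-- A homomorphism from the ring of the chart to `B` that lifts `x : Spec (B / I) ⟶ X`. -/
def LiftsPoint {B : PDRing.{u} p} (G : V.ring.Hom B) (x : B.Point X) : Prop :=
  ∃ c : V.A →+* B.residue, Spec.map (CommRingCat.ofHom c) ≫ V.α = x.hom ∧
    WittPresentation.Lifts G c

theorem LiftsPoint.over {B : PDRing.{u} p} {G : V.ring.Hom B} {x : B.Point X}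
    (h : LiftsPoint G x) : G.Over V.point x := by
  obtain ⟨c, hc, hG⟩ := h
  have e : G.residueMap.comp V.Q.sect = c := RingHom.ext fun a => hG.residueMap_sect a
  unfold PDRing.Hom.Over
  rw [← hc, ← e, CommRingCat.ofHom_comp, Spec.map_comp, Category.assoc]
  rfl

theorem LiftsPoint.comp {B T : PDRing.{u} p} {G : V.ring.Hom B} {x : B.Point X}
    (hG : LiftsPoint G x) {h : B.Hom T} {y : T.Point X} (hh : h.Over x y) :
    LiftsPoint (h.comp G) y := by
  obtain ⟨c, hc, hG⟩ := hG
  refine ⟨h.residueMap.comp c, ?_, hG.comp h⟩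
  rw [← hh, ← hc, CommRingCat.ofHom_comp, Spec.map_comp, Category.assoc]

theorem exists_liftsPoint {B : PDRing.{u} p} (x : B.Point X)
    (hx : ∀ t, x.hom t ∈ Set.range V.α) : ∃ G : V.ring.Hom B, LiftsPoint G x := by
  have hr : Set.range x.hom ⊆ Set.range V.α := Set.range_subset_iff.2 hx
  obtain ⟨c, hc⟩ := Spec.map_surjective (IsOpenImmersion.lift V.α x.hom hr)
  have hc' : Spec.map c ≫ V.α = x.hom := by
    rw [hc]
    exact IsOpenImmersion.lift_fac _ _ _
  choose b hb using fun i => Ideal.Quotient.mk_surjective (I := B.ideal)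
    (c.hom (V.Q.π (MvPolynomial.X i)))
  obtain ⟨G, hG, -⟩ := V.Q.exists_lifts_of_forall c.hom b hb
  exact ⟨G, c.hom, hc', hG⟩

/-- For two lifts `G` and `G'` of a point, `G'` and the composite of `G` with an endomorphism `u` of
the ring of the chart factor through one and the same homomorphism from a `p`-torsion-free ring, a
divided power polynomial ring over the ring of the chart. -/
theorem LiftsPoint.exists_joining {B : PDRing.{u} p} {G G' : V.ring.Hom B} {x : B.Point X}
    (hG : LiftsPoint G x) (hG' : LiftsPoint G' x) :
    ∃ (u : V.ring.Hom V.ring) (T : PDRing.{u} p) (y : T.Point X) (h : T.Hom B)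
      (i j : V.ring.Hom T), T.TorsionFree ∧ LiftsPoint u V.point ∧ h.Over y x ∧ LiftsPoint i y ∧
      LiftsPoint j y ∧ (h.comp i).toRingHom = (G.comp u).toRingHom ∧
      (h.comp j).toRingHom = G'.toRingHom := by
  obtain ⟨c, hc, hG⟩ := hG
  obtain ⟨c', hc', hG'⟩ := hG'
  obtain rfl : c = c' := by
    rw [← hc', cancel_mono] at hc
    exact congrArg CommRingCat.Hom.hom (Spec.map_injective hc)
  have hGs : G.residueMap.comp V.Q.sect = c := RingHom.ext fun a => hG.residueMap_sect a
  choose b hb using fun i => Ideal.Quotient.mk_surjective (I := V.ring.ideal)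
    (V.Q.sect (V.Q.π (MvPolynomial.X i)))
  -- The homomorphism `G ∘ u` maps the coordinates to `G (b i)`, which lift the same elements of
  -- `B / I` as the values of `G` and `G'`. The variables `s i` of `T` map to the differences between
  -- the values of `G'` and these.
  obtain ⟨u, hu, -⟩ := V.Q.exists_lifts_of_forall V.Q.sect b hb
  obtain ⟨T, a, h, s, hT, hs, ha, hsε⟩ := exists_adjoin_fin V.Q.ring_torsionFree G V.Q.n
    (fun i => G'.toRingHom (V.Q.of (MvPolynomial.X i)) - G.toRingHom (b i)) (fun i => by
      rw [← Ideal.Quotient.eq, hG', ← hGs, RingHom.comp_apply, ← hb]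
      rfl)
  obtain ⟨j, hj, hjs⟩ := V.Q.exists_lifts_of_forall (a.residueMap.comp V.Q.sect)
    (fun i => a.toRingHom (b i) + s i) (fun i => by
      rw [map_add, Ideal.Quotient.eq_zero_iff_mem.2 (hs i), add_zero, RingHom.comp_apply, ← hb]
      rfl)
  have hha : h.residueMap.comp a.residueMap = G.residueMap :=
    Ideal.Quotient.ringHom_ext (RingHom.ext fun r => congrArg (Ideal.Quotient.mk B.ideal) (ha r))
  let y : T.Point X :=
    { hom := Spec.map (CommRingCat.ofHom (R := V.A) (S := T.residue)
        (a.residueMap.comp V.Q.sect)) ≫ V.α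
      small := ⟨V.α.opensRange, isAffineOpen_opensRange V.α, fun _ => ⟨_, rfl⟩⟩ }
  have hy : h.residueMap.comp (a.residueMap.comp V.Q.sect) = c := by
    rw [← RingHom.comp_assoc, hha, hGs]
  refine ⟨u, T, y, h, a.comp u, j, hT, ⟨_, rfl, hu⟩, ?_, ⟨_, rfl, hu.comp a⟩, ⟨_, rfl, hj⟩,
    RingHom.ext fun r => ha _, ?_⟩
  · change Spec.map _ ≫ Spec.map _ ≫ _ = _
    rw [← Category.assoc, ← Spec.map_comp, ← CommRingCat.ofHom_comp, hy, hc]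
  · have hhj : WittPresentation.Lifts (h.comp j) c := by
      have h1 := hj.comp h
      rwa [hy] at h1
    refine hhj.toRingHom_ext hG' fun i => ?_
    change h.toRingHom (j.toRingHom _) = _
    rw [hjs, map_add, ha, hsε]
    ring

end SmoothChart

namespace SubFCrystal

variable [PerfectRing k p] {X : Scheme.{u}} {E : FIsocrystal.{u} p X} {L₁ L₂ : SubFCrystal E}

variable (L₁ L₂) in
/-- `L₁` and `L₂` agree at all points with values in perfect fields. -/
def AgreeEverywhere : Prop := ∀ (K : Type u) [Field K] [CharP K p] [PerfectRing K p]
  (y : Spec (CommRingCat.of K) ⟶ X), L₁.AgreeAt L₂ y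

theorem AgreeEverywhere.agreeOn (h : L₁.AgreeEverywhere L₂) (V : SmoothChart p k X)
    (x : V.ring.Point X) : L₁.AgreeOn L₂ V.ring x :=
  agreeOn_completionPDRing V.Q.p_mem_ker x h

open SmoothChart

/-- The comparison isomorphism does not depend on the lift of a point to a chart. -/
theorem Compares.of_liftsPoint (h : L₁.AgreeEverywhere L₂) {V : SmoothChart p k X}
    {B : PDRing.{u} p} {G G' : V.ring.Hom B} {x : B.Point X} (hG : LiftsPoint G x)
    (hG' : LiftsPoint G' x) {e : L₁.obj B x ≃ₗ[B.carrier] L₂.obj B x}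
    (he : L₁.Compares L₂ G hG.over e) : L₁.Compares L₂ G' hG'.over e := by
  obtain ⟨u, T, y, f, i, j, hT, hu, hf, hi, hj, ei, ej⟩ := hG.exists_joining hG'
  have h1 := he.precomp u hu.over
  have h2 : L₁.Compares L₂ (f.comp i) (hf.comp hi.over) e := h1.congr ei.symm
  have h3 := Compares.of_precomp (hf := hi.over) (hg := hf) hT (h.agreeOn V V.point) h2
  exact (h3.precomp j hj.over).congr ej

/-- The comparison isomorphism does not depend on the chart. -/
theorem Compares.of_liftsPoint_of_subset (h : L₁.AgreeEverywhere L₂) {V W V' : SmoothChart p k X}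
    (hW : Set.range W.α ⊆ Set.range V.α) (hW' : Set.range W.α ⊆ Set.range V'.α)
    {B : PDRing.{u} p} {G : V.ring.Hom B} {G' : V'.ring.Hom B} {x : B.Point X}
    (hx : ∀ t, x.hom t ∈ Set.range W.α) (hG : LiftsPoint G x)
    (hG' : LiftsPoint G' x) {e : L₁.obj B x ≃ₗ[B.carrier] L₂.obj B x}
    (he : L₁.Compares L₂ G hG.over e) : L₁.Compares L₂ G' hG'.over e := by
  have hpt : ∀ t, W.point.hom t ∈ Set.range W.α := fun t => ⟨_, rfl⟩
  obtain ⟨H, hH⟩ := exists_liftsPoint (V := W) x hx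
  obtain ⟨v, hv⟩ := exists_liftsPoint (V := V) W.point (fun t => hW (hpt t))
  obtain ⟨v', hv'⟩ := exists_liftsPoint (V := V') W.point (fun t => hW' (hpt t))
  have h1 : L₁.Compares L₂ (H.comp v) (hH.over.comp hv.over) e :=
    he.of_liftsPoint h hG (hv.comp hH.over)
  have h2 := Compares.of_precomp (hf := hv.over) (hg := hH.over) W.Q.ring_torsionFree
    (h.agreeOn V V.point) h1
  exact Compares.of_liftsPoint h (hv'.comp hH.over) hG' (h2.precomp v' hv'.over)

/-- If `X` is covered by charts, with intersections that are charts, then `F`-crystals inside `E`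
that agree everywhere are equal. -/
theorem AgreeEverywhere.eqInside (h : L₁.AgreeEverywhere L₂)
    (hX : ∀ U : X.Opens, IsAffineOpen U → ∃ V : SmoothChart p k X, Set.range V.α = U)
    (hsep : ∀ U V : X.Opens, IsAffineOpen U → IsAffineOpen V → IsAffineOpen (U ⊓ V)) :
    L₁.EqInside L₂ := by
  have hcov : ∀ (S : PDRing.{u} p) (y : S.Point X), ∃ (V : SmoothChart p k X)
      (G : V.ring.Hom S), IsAffineOpen V.α.opensRange ∧ LiftsPoint G y ∧
        ∀ t, y.hom t ∈ Set.range V.α := fun S y => by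
    obtain ⟨U, hU, hy⟩ := y.small
    obtain ⟨V, hV⟩ := hX U hU
    have hy' : ∀ t, y.hom t ∈ Set.range V.α := fun t => by
      rw [hV]
      exact hy t
    obtain ⟨G, hG⟩ := exists_liftsPoint (V := V) y hy'
    exact ⟨V, G, isAffineOpen_opensRange V.α, hG, hy'⟩
  refine eqInside_of_isComparison (fun S y => ?_) fun S y => ?_
  · obtain ⟨V, G, -, hG, -⟩ := hcov S y
    exact ⟨V.ring, V.point, G, hG.over, V.Q.ring_torsionFree, h.agreeOn V _, h.agreeOn V _⟩
  · obtain ⟨V, G, hV, hG, hy⟩ := hcov S y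
    obtain ⟨e, he⟩ := Compares.exists V.Q.ring_torsionFree (h.agreeOn V V.point) G hG.over
    refine ⟨e, fun R x f hf hR hx => ?_⟩
    obtain ⟨V', H, hV', hH, hx'⟩ := hcov R x
    obtain ⟨W, hW⟩ := hX _ (hsep _ _ hV hV')
    have h1 : L₁.Compares L₂ (f.comp H) (hf.comp hH.over) e := by
      refine he.of_liftsPoint_of_subset (W := W) h ?_ ?_ (fun t => ?_) hG (hH.comp hf)
      · rw [hW]
        exact fun t ht => ht.1
      · rw [hW]
        exact fun t ht => ht.2
      · rw [hW, ← hf]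
        refine ⟨?_, hx' _⟩
        change (Spec.map (CommRingCat.ofHom f.residueMap) ≫ x.hom) t ∈ Set.range V.α
        rw [hf]
        exact hy t
    exact Compares.of_precomp (hf := hH.over) (hg := hf) hR (h.agreeOn V' V'.point) h1

end SubFCrystal

end

section

/-! ### Smooth separated schemes over a field -/

theorem charP_residueField {p : ℕ} {k : Type u} [Field k] [CharP k p] {C : Scheme.{u}}
    (f : C ⟶ Spec (CommRingCat.of k)) (c : C) : CharP (C.residueField c) p :=
  charP_of_injective_ringHom (Spec.preimage (C.fromSpecResidueField c ≫ f)).hom.injective p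

theorem exists_smoothChart {p : ℕ} [Fact p.Prime] {k : Type u} [Field k] [CharP k p]
    {C : Scheme.{u}} (f : C ⟶ Spec (CommRingCat.of k)) [Smooth f] {U : C.Opens}
    (hU : IsAffineOpen U) : ∃ V : SmoothChart p k C, Set.range V.α = U := by
  let g : k →+* Γ(C, U) := (f.appLE ⊤ U le_top).hom.comp
    (Scheme.ΓSpecIso (CommRingCat.of k)).inv.hom
  have hg : g.Smooth := by
    have h := Smooth.smooth_appLE f (isAffineOpen_top _) hU le_top
    exact .comp (.of_bijective (ConcreteCategory.bijective_of_isIso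
      (Scheme.ΓSpecIso (CommRingCat.of k)).inv)) h
  let _ : Algebra k Γ(C, U) := g.toAlgebra
  have hs : Algebra.Smooth k Γ(C, U) := hg
  obtain ⟨Q⟩ := WittPresentation.nonempty p k Γ(C, U)
  exact ⟨{ A := Γ(C, U), Q := Q, α := hU.fromSpec }, hU.range_fromSpec⟩

end

end FCrys

end

theorem mainTheorem9 {p : ℕ} [Fact p.Prime] {k : Type u} [Field k] [CharP k p] [PerfectField k]
    (C : Scheme.{u}) (f : C ⟶ Spec (CommRingCat.of k)) [SmoothOfRelativeDimension 1 f]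
    [IsSeparated f] [QuasiCompact f] [ConnectedSpace C]
    (E : FCrys.FIsocrystal.{u} p C) (L₁ L₂ : FCrys.SubFCrystal E)
    (h₁ : L₁.IsOrdinary) (h₂ : L₂.IsOrdinary)
    (K : Type u) [Field K] [CharP K p] [PerfectRing K p] (x : Spec (CommRingCat.of K) ⟶ C)
    (hx : L₁.AgreeAt L₂ x) :
    L₁.EqInside L₂ := by
  have : Smooth f := SmoothOfRelativeDimension.smooth 1 f
  have : IsLocallyNoetherian C := LocallyOfFiniteType.isLocallyNoetherian f
  have : CompactSpace C := QuasiCompact.compactSpace_of_compactSpace f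
  have : IsNoetherian C := {}
  have h : L₁.AgreeEverywhere L₂ := fun K' _ _ _ y =>
    h₁.agreeAt_of_agreeAt (FCrys.charP_residueField f) h₂ x hx y
  refine h.eqInside (k := k) (fun U hU => FCrys.exists_smoothChart f hU) fun U V hU hV => ?_
  have hd : IsAffineHom (Limits.pullback.diagonal f) := inferInstance
  exact isAffineHom_diagonal_iff.1 hd ⊤ (isAffineOpen_top _) U le_top V le_top hU hV
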